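/- Let $M$ be a smooth manifold of even dimension $n$. For a closed $2$-form $F$ and a $3$-form $H$ with $dH=-F\wedge F$, let $E_{H,F}$ be the bundle $E=TM\oplus T^*M\oplus\mathbb R$ with scalar product $\langle X+\xi+\lambda,Y+\eta+\mu\rangle=\tfrac12(\eta(X)+\xi(Y))+\lambda\mu$ and Dorfman bracket $$[X+\xi+\lambda,Y+\eta+\mu]=\mathcal L_XY+\mathcal L_X\eta-i_Yd\xi+2\mu\,d\lambda+i_Xi_YH-2(\mu\, i_XF-\lambda\, i_YF)+X(\mu)-Y(\lambda)+F(X,Y),$$ and write $E_H:=E_{H,0}$ (so $dH=0$). A generalized metric is a rank $n$ subbundle $E_-\subset E$ on which $\langle\cdot,\cdot\rangle$ is non-degenerate and which projects isomorphically onto $TM$; $\mathcal G^{\mathrm{end}}$ is the endomorphism equal to $\pm\mathrm{Id}$ on $E_\pm$, where $E_+=E_-^\perp$. A $B_n$-generalized almost complex structure is an isotropic complex rank $n$ subbundle $L\subset E_{\mathbb C}$ with $L\cap\bar L=0$, identified with the endomorphism $\mathcal F$ of $E$ equal to $\pm i$ on $L$, $\bar L$ and to $0$ on $(L\oplus\bar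 L)^\perp$; it is integrable if the sections of $L$ are closed under the (complexified) bracket. A $B_n$-generalized pseudo-Kähler structure is a pair $(\mathcal G,\mathcal F)$ with $\mathcal G^{\mathrm{end}}\mathcal F=\mathcal F\mathcal G^{\mathrm{end}}$ such that $\mathcal F$ and $\mathcal G^{\mathrm{end}}\mathcal F$ are both integrable $B_n$-generalized almost complex structures. When $\mathcal G$ is in standard form, i.e. $E_-=\{X-i_Xg\}$ for a pseudo-Riemannian metric $g$, the components $(g,J_+,J_-,X_+,X_-,c_+)$ of $(\mathcal G,\mathcal F)$ are defined as follows: $X_++i_{X_+}g+c_+$ is a smooth section of $\ker\mathcal F$ of square $1$ (this fixes $(X_+,c_+)$ up to a sign on each connected component of $M$); $J_-$ is $\mathcal F|_{E_-}$ under the isomorphism $E_-\cong TM$, $X-i_Xg\mapsto X$; and, under the isomorphism $E_+\cong TM\oplus\mathbb R$, $X+i_Xg+a\mapsto X+a$, the $TM$-part of $\mathcal F|_{E_+}$ is $X+a\mapsto J_+X+aX_-$. **Statement.** Let $(\mathcal G,\mathcal F)$ be a $B_n$-generalized pseudo-Kähler structure on $E_H$ with components $(g,J_+,J_-,X_+,X_-,c_+)$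 such that $c_+(p)\notin\{-1,0,1\}$ for all $p\in M$. Put $\epsilon=\mathrm{sign}(1-c_+^2)$, $\tilde g=\epsilon g$, $\tilde H=\epsilon H$, $\tilde X_\pm=|1-c_+^2|^{-1/2}X_\pm$, $\tilde J_-=J_-$, and let $\tilde J_+\in\mathrm{End}(TM)$ be the endomorphism with $\tilde J_+X_+=\tilde J_+X_-=0$ and $\tilde J_+=J_+$ on the $g$-orthogonal complement of $\{X_+,X_-\}$. Then $\tilde H$ is a smooth closed $3$-form, $\tilde J_+$ is well defined (it exists and is unique), and $(\tilde g,\tilde J_+,\tilde J_-,\tilde X_+,\tilde X_-,\tilde c_+:=0)$ are the components of a $B_n$-generalized pseudo-Kähler structure on $E_{\tilde H}$. -/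

import Mathlib

open scoped Manifold ContDiff TensorProduct

namespace BnGen

section

variable {n : ℕ} {M : Type*} [TopologicalSpace M] [ChartedSpace (EuclideanSpace ℝ (Fin n)) M]

/-! ### Tensor fields on an `n`-dimensional manifold -/

variable (n M) in
/-- Vector fields on `M` (no smoothness imposed). -/
abbrev VField := ∀ x : M, TangentSpace (𝓡 n) x

variable (n M) in
/-- Fields of covectors on `M` (no smoothness imposed). -/
abbrev CovField := ∀ x : M, TangentSpace (𝓡 n) x →L[ℝ] ℝ

variable (n M) in
/-- Fields of alternating `k`-linear forms on `M` (no smoothness imposed). -/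
abbrev FormField (k : ℕ) := ∀ x : M, TangentSpace (𝓡 n) x [⋀^Fin k]→L[ℝ] ℝ

variable (n M) in
/-- Fields of bilinear forms on `M` (no smoothness imposed). -/
abbrev BilinField :=
  ∀ x : M, TangentSpace (𝓡 n) x →L[ℝ] TangentSpace (𝓡 n) x →L[ℝ] ℝ

variable (n M) in
/-- Fields of endomorphisms of `TM` (no smoothness imposed). -/
abbrev EndField := ∀ x : M, TangentSpace (𝓡 n) x →L[ℝ] TangentSpace (𝓡 n) x

/-- Smooth real functions. -/
def SmoothFun (f : M → ℝ) : Prop := ContMDiff (𝓡 n) 𝓘(ℝ, ℝ) ∞ f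

/-- Smooth vector fields. -/
def SmoothVField [IsManifold (𝓡 n) ∞ M] (X : VField n M) : Prop :=
  ContMDiff (𝓡 n) (𝓡 n).tangent ∞ (fun x => (⟨x, X x⟩ : TangentBundle (𝓡 n) M))

/-- Smooth one-forms, as smooth sections of the cotangent bundle. -/
def SmoothCovField [IsManifold (𝓡 n) ∞ M] (ξ : CovField n M) : Prop :=
  ContMDiff (𝓡 n) ((𝓡 n).prod 𝓘(ℝ, EuclideanSpace ℝ (Fin n) →L[ℝ] ℝ)) ∞
    (fun x => Bundle.TotalSpace.mk' (EuclideanSpace ℝ (Fin n) →L[ℝ] ℝ)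
      (E := fun y : M => TangentSpace (𝓡 n) y →L[ℝ] ℝ) x (ξ x))

/-- Smooth fields of bilinear forms, as smooth sections of `T*M ⊗ T*M`. -/
def SmoothBilinField [IsManifold (𝓡 n) ∞ M] (g : BilinField n M) : Prop :=
  ContMDiff (𝓡 n)
    ((𝓡 n).prod 𝓘(ℝ, EuclideanSpace ℝ (Fin n) →L[ℝ] EuclideanSpace ℝ (Fin n) →L[ℝ] ℝ)) ∞
    (fun x => Bundle.TotalSpace.mk'
      (EuclideanSpace ℝ (Fin n) →L[ℝ] EuclideanSpace ℝ (Fin n) →L[ℝ] ℝ)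
      (E := fun y : M => TangentSpace (𝓡 n) y →L[ℝ] TangentSpace (𝓡 n) y →L[ℝ] ℝ) x (g x))

/-- A field of endomorphisms of `TM` is smooth if it maps smooth vector fields to smooth vector
fields. -/
def SmoothEndField [IsManifold (𝓡 n) ∞ M] (J : EndField n M) : Prop :=
  ∀ X : VField n M, SmoothVField X → SmoothVField (fun x => J x (X x))

/-- The coordinate expression of a `k`-form in the preferred chart at `x₀`, i.e. its pullback
under the inverse of the chart. -/
noncomputable def formInChart {k : ℕ} (x₀ : M) (φ : FormField n M k) :
    EuclideanSpace ℝ (Fin n) → EuclideanSpace ℝ (Fin n) [⋀^Fin k]→L[ℝ] ℝ := fun y =>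
  (φ ((extChartAt (𝓡 n) x₀).symm y)).compContinuousLinearMap
    (mfderiv 𝓘(ℝ, EuclideanSpace ℝ (Fin n)) (𝓡 n) (extChartAt (𝓡 n) x₀).symm y)

/-- Smooth `k`-forms: the coordinate expressions are smooth. -/
def SmoothForm {k : ℕ} (φ : FormField n M k) : Prop :=
  ∀ x₀ : M, ContDiffOn ℝ ∞ (formInChart x₀ φ) (extChartAt (𝓡 n) x₀).target

/-- The exterior derivative of a `k`-form, computed at `x` in the preferred chart at `x`. -/
noncomputable def extD {k : ℕ} (φ : FormField n M k) : FormField n M (k + 1) := fun x =>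
  (extDeriv (formInChart x φ) (extChartAt (𝓡 n) x x)).compContinuousLinearMap
    (mfderiv (𝓡 n) 𝓘(ℝ, EuclideanSpace ℝ (Fin n)) (extChartAt (𝓡 n) x) x)

/-- The differential of a function. -/
noncomputable def dFun (f : M → ℝ) : CovField n M := fun x =>
  (mfderiv (𝓡 n) 𝓘(ℝ, ℝ) f x : TangentSpace (𝓡 n) x →L[ℝ] ℝ)

/-- Identification of covectors with alternating forms of degree one. -/
noncomputable def covToForm (ξ : CovField n M) : FormField n M 1 := fun x =>
  ContinuousAlternatingMap.ofSubsingleton ℝ (TangentSpace (𝓡 n) x) ℝ (0 : Fin 1) (ξ x)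

/-- `i_X φ` for a two-form `φ`, as a covector: `Z ↦ φ(X, Z)`. -/
noncomputable def iota (X : VField n M) (φ : FormField n M 2) : CovField n M := fun x =>
  (φ x).toContinuousMultilinearMap.toContinuousLinearMap ![X x, 0] 1

/-- `i_Y i_X φ` for a three-form `φ`, as a covector: `Z ↦ φ(X, Y, Z)`. -/
noncomputable def iota₂ (X Y : VField n M) (φ : FormField n M 3) : CovField n M := fun x =>
  (φ x).toContinuousMultilinearMap.toContinuousLinearMap ![X x, Y x, 0] 2

theorem iota_apply (X : VField n M) (φ : FormField n M 2) (x : M) (Z : TangentSpace (𝓡 n) x) :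
    iota X φ x Z = φ x ![X x, Z] := by
  change φ x (Function.update ![X x, 0] 1 Z) = _
  congr 1; ext i : 1; fin_cases i <;> rfl

theorem iota₂_apply (X Y : VField n M) (φ : FormField n M 3) (x : M)
    (Z : TangentSpace (𝓡 n) x) : iota₂ X Y φ x Z = φ x ![X x, Y x, Z] := by
  change φ x (Function.update ![X x, Y x, 0] 2 Z) = _
  congr 1; ext i : 1; fin_cases i <;> rfl

/-- The Lie derivative of a one-form, `L_X η = d (η(X)) + i_X dη`. -/
noncomputable def lieDerivCov (X : VField n M) (η : CovField n M) : CovField n M :=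
  dFun (fun y => η y (X y)) + iota X (extD (covToForm η))

/-! ### The Courant algebroid `E_{H,F}` of type `B_n` -/

variable (n) in
/-- The fibre at `x` of `E = TM ⊕ T*M ⊕ ℝ`; `(X, ξ, l)` stands for `X + ξ + l`. -/
abbrev EFib (x : M) : Type :=
  TangentSpace (𝓡 n) x × (TangentSpace (𝓡 n) x →L[ℝ] ℝ) × ℝ

variable (n M) in
/-- Sections of `E` (no smoothness imposed). -/
abbrev ESec := ∀ x : M, EFib n x

/-- Smooth sections of `E`: the three components are smooth. -/
def SmoothESec [IsManifold (𝓡 n) ∞ M] (u : ESec n M) : Prop :=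
  SmoothVField (fun x => (u x).1) ∧ SmoothCovField (fun x => (u x).2.1) ∧
    SmoothFun (n := n) (fun x => (u x).2.2)

variable (n M) in
/-- Fields of endomorphisms of `E` (no smoothness imposed). -/
abbrev EEnd := ∀ x : M, EFib n x →ₗ[ℝ] EFib n x

/-- A field of endomorphisms of `E` is smooth if it maps smooth sections to smooth sections. -/
def SmoothEEnd [IsManifold (𝓡 n) ∞ M] (A : EEnd n M) : Prop :=
  ∀ u : ESec n M, SmoothESec u → SmoothESec (fun x => A x (u x))

/-- The pair `(H, F)` is admissible for twisting: `H`, `F` are smooth, `dF = 0` and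
`dH = - F ∧ F`, where
`(F ∧ F)(a,b,c,d) = 2 (F(a,b) F(c,d) - F(a,c) F(b,d) + F(a,d) F(b,c))`. -/
structure IsTwist (H : FormField n M 3) (F : FormField n M 2) : Prop where
  smooth_H : SmoothForm H
  smooth_F : SmoothForm F
  closed_F : extD F = 0
  d_H : ∀ (x : M) (a b c d : TangentSpace (𝓡 n) x),
    extD H x ![a, b, c, d] =
      - (2 * (F x ![a, b] * F x ![c, d] - F x ![a, c] * F x ![b, d]
        + F x ![a, d] * F x ![b, c]))

/-- The scalar product
`⟨X + ξ + l, Y + η + m⟩ = (η(X) + ξ(Y)) / 2 + l m` on the fibre of `E`. -/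
noncomputable def pairing (x : M) : LinearMap.BilinForm ℝ (EFib n x) :=
  LinearMap.mk₂ ℝ (fun u v => (1 / 2 : ℝ) * (v.2.1 u.1 + u.2.1 v.1) + u.2.2 * v.2.2)
    (by intro u u' v; simp; ring) (by intro a u v; simp; ring)
    (by intro u v v'; simp; ring) (by intro a u v; simp; ring)

/-- The Dorfman bracket twisted by `(H, F)`: for `u = X + ξ + l` and `v = Y + η + m`,
`[u, v] = [X, Y] + L_X η - i_Y dξ + 2 m dl + i_X i_Y H - 2 (m i_X F - l i_Y F)
  + X(m) - Y(l) + F(X, Y)`. -/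
noncomputable def dorfman (H : FormField n M 3) (F : FormField n M 2) (u v : ESec n M) :
    ESec n M := fun x =>
  let X : VField n M := fun y => (u y).1
  let ξ : CovField n M := fun y => (u y).2.1
  let l : M → ℝ := fun y => (u y).2.2
  let Y : VField n M := fun y => (v y).1
  let η : CovField n M := fun y => (v y).2.1
  let m : M → ℝ := fun y => (v y).2.2
  (VectorField.mlieBracket (𝓡 n) X Y x,
    lieDerivCov X η x - iota Y (extD (covToForm ξ)) x + (2 * m x) • dFun l x
      + iota₂ Y X H x - (2 : ℝ) • (m x • iota X F x - l x • iota Y F x),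
    dFun m x (X x) - dFun l x (Y x) + F x ![X x, Y x])

/-! ### Generalized metrics -/

/-- The bundle `E_- = ker (𝒢 + 1)` of a field of endomorphisms `𝒢` of `E`. -/
noncomputable def Eminus (G : EEnd n M) (x : M) : Submodule ℝ (EFib n x) :=
  Module.End.eigenspace (G x) (-1)

/-- `G` is the endomorphism `𝒢^end` of an (admissible) generalized metric on `E`, that is: `G` is
smooth, its `(-1)`-eigenbundle `E_-` has rank `n`, the scalar product is non-degenerate on `E_-`,
`G` is the identity on the orthogonal complement of `E_-`, and the anchor restricts to an
isomorphism `E_- ≅ TM`. Generalized metrics `E_-` correspond bijectively to such `G`. -/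
structure IsGenMetric [IsManifold (𝓡 n) ∞ M] (G : EEnd n M) : Prop where
  smooth : SmoothEEnd G
  finrank_eq : ∀ x, Module.finrank ℝ (Eminus G x) = n
  nondegenerate : ∀ x, ∀ u ∈ Eminus G x, (∀ v ∈ Eminus G x, pairing x u v = 0) → u = 0
  eq_on_orthogonal : ∀ x, ∀ u : EFib n x, (∀ v ∈ Eminus G x, pairing x u v = 0) → G x u = u
  admissible : ∀ x, Function.Bijective (fun u : Eminus G x => (u : EFib n x).1)

/-! ### `B_n`-generalized complex structures -/

/-- The element `u + i v` of the complexified fibre `E_ℂ`. -/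
noncomputable def cpx (x : M) (u v : EFib n x) : ℂ ⊗[ℝ] EFib n x :=
  (1 : ℂ) ⊗ₜ[ℝ] u + Complex.I ⊗ₜ[ℝ] v

/-- The `a`-eigenbundle in `E_ℂ` of a field of endomorphisms of `E`. -/
noncomputable def eigBundle (A : EEnd n M) (a : ℂ) (x : M) : Submodule ℂ (ℂ ⊗[ℝ] EFib n x) :=
  Module.End.eigenspace ((A x).baseChange ℂ) a

/-- `A` is (the endomorphism of) a `B_n`-generalized almost complex structure: `A` is smooth, its
`i`-eigenbundle `L ⊂ E_ℂ` has complex rank `n` and is isotropic for the complex bilinear extension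
of the scalar product, and `A` vanishes on the orthogonal complement `U` of `L ⊕ L̄`. As `A` is
real, `L̄` is its `(-i)`-eigenbundle and `L ∩ L̄ = 0`. -/
structure IsGenAlmostComplex [IsManifold (𝓡 n) ∞ M] (A : EEnd n M) : Prop where
  smooth : SmoothEEnd A
  finrank_eq : ∀ x, Module.finrank ℂ (eigBundle A Complex.I x) = n
  isotropic : ∀ x, ∀ a ∈ eigBundle A Complex.I x, ∀ b ∈ eigBundle A Complex.I x,
    LinearMap.BilinForm.baseChange ℂ (pairing x) a b = 0
  ker : ∀ x, ∀ u : EFib n x,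
    (∀ a ∈ eigBundle A Complex.I x ⊔ eigBundle A (-Complex.I) x,
      LinearMap.BilinForm.baseChange ℂ (pairing x) ((1 : ℂ) ⊗ₜ[ℝ] u) a = 0) → A x u = 0

/-- Integrability of the `i`-eigenbundle `L` of `A`: the smooth sections of `L ⊂ E_ℂ` are closed
under the complex bilinear extension
`[u + i v, u' + i v'] = [u, u'] - [v, v'] + i ([u, v'] + [v, u'])` of the Dorfman bracket. -/
def IsIntegrable [IsManifold (𝓡 n) ∞ M] (H : FormField n M 3) (F : FormField n M 2)
    (A : EEnd n M) : Prop :=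
  ∀ u v u' v' : ESec n M, SmoothESec u → SmoothESec v → SmoothESec u' → SmoothESec v' →
    (∀ x, cpx x (u x) (v x) ∈ eigBundle A Complex.I x) →
    (∀ x, cpx x (u' x) (v' x) ∈ eigBundle A Complex.I x) →
    ∀ x, cpx x (dorfman H F u u' x - dorfman H F v v' x)
      (dorfman H F u v' x + dorfman H F v u' x) ∈ eigBundle A Complex.I x

/-- `A` is a `B_n`-generalized complex structure on `E_{H,F}`. -/
structure IsGenComplex [IsManifold (𝓡 n) ∞ M] (H : FormField n M 3) (F : FormField n M 2)
    (A : EEnd n M) : Prop where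
  almost : IsGenAlmostComplex A
  integrable : IsIntegrable H F A

/-- `(G, A)` is a `B_n`-generalized pseudo-Kähler structure on `E_{H,F}`: `G` is a generalized
metric, `A` and `G A` are `B_n`-generalized complex structures, and `G A = A G`. -/
structure IsGenPseudoKahler [IsManifold (𝓡 n) ∞ M] (H : FormField n M 3) (F : FormField n M 2)
    (G A : EEnd n M) : Prop where
  metric : IsGenMetric G
  commute : ∀ x, G x ∘ₗ A x = A x ∘ₗ G x
  complex₁ : IsGenComplex H F A
  complex₂ : IsGenComplex H F (fun x => G x ∘ₗ A x)

/-! ### Components in even dimension -/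

/-- A smooth pseudo-Riemannian metric on `M`. -/
structure IsPseudoMetric [IsManifold (𝓡 n) ∞ M] (g : BilinField n M) : Prop where
  smooth : SmoothBilinField g
  symm : ∀ x v w, g x v w = g x w v
  nondegenerate : ∀ x v, (∀ w, g x v w = 0) → v = 0

variable (n M) in
/-- Data `(g, J₊, J₋, X₊, X₋, c₊)` on `M`. -/
structure Data where
  g : BilinField n M
  Jp : EndField n M
  Jm : EndField n M
  Xp : VField n M
  Xm : VField n M
  c : M → ℝ

/-- The element `X + i_X g + a` of `E_+`. -/
noncomputable def Data.plus (D : Data n M) (x : M) (X : TangentSpace (𝓡 n) x) (a : ℝ) : EFib n x :=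
  (X, D.g x X, a)

/-- The element `X - i_X g` of `E_-`. -/
noncomputable def Data.minus (D : Data n M) (x : M) (X : TangentSpace (𝓡 n) x) : EFib n x :=
  (X, - D.g x X, 0)

/-- `D = (g, J₊, J₋, X₊, X₋, c₊)` are the components of the `B_n`-generalized almost
pseudo-Hermitian structure `(G, A)`, `n` even, with `G` in standard form: `E_-` is the bundle of
all `X - i_X g`; a smooth section of `ker A` of square one is `u₊ = X₊ + i_{X₊} g + c₊`; under
`E_- ≅ TM`, `X - i_X g ↦ X`, the restriction `A|E_-` is `J₋`; under `E_+ ≅ TM ⊕ ℝ`,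
`X + i_X g + a ↦ X + a`, the endomorphism `A|E_+` maps `X` to `J₊ X` modulo `ℝ`, and maps `1`
to `X₋` modulo `ℝ`. -/
structure IsComponents [IsManifold (𝓡 n) ∞ M] (G A : EEnd n M) (D : Data n M) : Prop where
  metric : IsPseudoMetric D.g
  smooth_Jp : SmoothEndField D.Jp
  smooth_Jm : SmoothEndField D.Jm
  smooth_Xp : SmoothVField D.Xp
  smooth_Xm : SmoothVField D.Xm
  smooth_c : SmoothFun (n := n) D.c
  standard : ∀ x (u : EFib n x), u ∈ Eminus G x ↔ ∃ X, u = D.minus x X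
  ker_u : ∀ x, A x (D.plus x (D.Xp x) (D.c x)) = 0
  norm_u : ∀ x, pairing x (D.plus x (D.Xp x) (D.c x)) (D.plus x (D.Xp x) (D.c x)) = 1
  Jm_eq : ∀ x X, D.Jm x X = (A x (D.minus x X)).1
  Jp_eq : ∀ x X, D.Jp x X = (A x (D.plus x X 0)).1
  Xm_eq : ∀ x, D.Xm x = (A x (D.plus x 0 1)).1

/-! ### The rescaled data -/

/-- The sign `ε` of `1 - c₊²`. -/
noncomputable def Data.eps (D : Data n M) (x : M) : ℝ := Real.sign (1 - D.c x ^ 2)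

/-- `J` is the endomorphism field which vanishes on `X₊` and `X₋` and agrees with `J₊` on the
`g`-orthogonal complement of `{X₊, X₋}`. -/
def Data.IsModifiedJp (D : Data n M) (J : EndField n M) : Prop :=
  ∀ x, J x (D.Xp x) = 0 ∧ J x (D.Xm x) = 0 ∧
    ∀ v, D.g x v (D.Xp x) = 0 → D.g x v (D.Xm x) = 0 → J x v = D.Jp x v

/-- The data `(ε g, J, J₋, |1 - c₊²|^{-1/2} X₊, |1 - c₊²|^{-1/2} X₋, 0)`. -/
noncomputable def Data.rescale (D : Data n M) (J : EndField n M) : Data n M where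
  g := fun x => D.eps x • D.g x
  Jp := J
  Jm := D.Jm
  Xp := fun x => |1 - D.c x ^ 2| ^ (-(1 / 2) : ℝ) • D.Xp x
  Xm := fun x => |1 - D.c x ^ 2| ^ (-(1 / 2) : ℝ) • D.Xm x
  c := fun _ => 0

end

end BnGen

open scoped Topology
open Bundle

/-! ### Calculus of smooth functions, vector fields and covector fields. -/

namespace BnGen
section
variable {n : ℕ} {M : Type*} [TopologicalSpace M] [ChartedSpace (EuclideanSpace ℝ (Fin n)) M]

/-! Write `E_±` for the eigenbundles of `𝒢`, `A` for `ℱ`, and `u` for the square-one section `X₊ +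
i_{X₊}g + c₊` of `ker A`. All bracket conditions are tested through the scalar `⟨[a, b], w⟩`, called
`tri`.

Algebra. Being an almost complex structure amounts to `A` being skew with `A² = -1 + ⟨·, u⟩ u`
(`skew_and_sq_of_almostComplex`, with converse `almostComplex_of_skew_and_sq`). Read on `E_±`, this
yields the identities of `Data.IsHermitian`, among them `J₊X₊ = -c₊X₋`, `J₊X₋ = c₊X₊` and `g(X_±,
X_±) = 1 - c₊²`. As `1 - c₊²` is nonzero, `X₊` and `X₋` span a nondegenerate plane, the modified
endomorphism is `J₊` plus a rank-two correction with coefficient `c₊/(1 - c₊²)`, and the identities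
hold again after rescaling, with constant `0` in place of `c₊`.

Integrability. `ℱ` and `𝒢ℱ` agree on `E_+` and differ by a sign on `E_-`. On mixed triples of
sections the Nijenhuis expression of either one is a part free of the sign plus the sign times
another part, so integrability of both separates the parts. The outcome is that `v ↦ [s, v]_+` on
`E_+` (for `s` in `E_-`) and `s ↦ [v, s]_-` on `E_-` (for `v` in `E_+`) commute with `A`. For three
sections of the same bundle, the bracket is a combination of mixed brackets plus `H`, and these
commutation rules leave a purely algebraic condition on `H`. The four conditions form
`Data.IsCompatible`; they are equivalent to integrability by `Data.IsModel.isCompatible` and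
`Data.IsModel.isIntegrable`.

Rescaling. On `TM ⊂ E_+` the first family of operators is the metric connection `∇ - ½H`
(`Data.conn`). The section `u` is parallel, and so is `X₋`, the image under `A` of the parallel
section `1`; hence `dc₊ = 0` and `X₊`, `X₋` are parallel. So `ε`, `|1 - c₊²|^{-1/2}` and `c₊/(1 -
c₊²)` have zero differential, the connection is multiplied by `ε`, and the correction of `J₊` is
parallel: the commutation rules survive. For `H`, the algebraic condition evaluated on `u` and `X₋`
shows that `i_{X₊}H` and `i_{X₋}H` are `J₊`-invariant on the complement of `X₊`, `X₋`, and that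
`H(y, X₋, X₊) = 0` there; this removes every term by which the new condition differs from the old
one. -/

theorem SmoothFun.add {f h : M → ℝ} (hf : SmoothFun (n := n) f) (hh : SmoothFun (n := n) h) :
    SmoothFun (n := n) (fun x => f x + h x) := ContMDiff.add hf hh

theorem SmoothFun.neg {f : M → ℝ} (hf : SmoothFun (n := n) f) :
    SmoothFun (n := n) (fun x => - f x) := ContMDiff.neg hf

theorem SmoothFun.mul {f h : M → ℝ} (hf : SmoothFun (n := n) f) (hh : SmoothFun (n := n) h) :
    SmoothFun (n := n) (fun x => f x * h x) := ContMDiff.mul hf hh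

theorem smoothFun_const (a : ℝ) : SmoothFun (n := n) (fun _ : M => a) := contMDiff_const

theorem SmoothFun.mdifferentiableAt {f : M → ℝ} (hf : SmoothFun (n := n) f) (x : M) :
    MDifferentiableAt (𝓡 n) 𝓘(ℝ, ℝ) f x := (ContMDiff.mdifferentiable hf (by simp)) x

theorem dFun_add {f h : M → ℝ} (hf : SmoothFun (n := n) f) (hh : SmoothFun (n := n) h) (x : M)
    (v : TangentSpace (𝓡 n) x) :
    dFun (fun y => f y + h y) x v = dFun f x v + dFun h x v := by
  have := mfderiv_add (hf.mdifferentiableAt x) (hh.mdifferentiableAt x)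
  exact congrArg (fun φ : EuclideanSpace ℝ (Fin n) →L[ℝ] ℝ => φ v) this

theorem dFun_mul {f h : M → ℝ} (hf : SmoothFun (n := n) f) (hh : SmoothFun (n := n) h) (x : M)
    (v : TangentSpace (𝓡 n) x) :
    dFun (fun y => f y * h y) x v = f x * dFun h x v + h x * dFun f x v := by
  have := ((hf.mdifferentiableAt x).hasMFDerivAt.mul (hh.mdifferentiableAt x).hasMFDerivAt).mfderiv
  exact congrArg (fun φ : EuclideanSpace ℝ (Fin n) →L[ℝ] ℝ => φ v) this

theorem dFun_neg {f : M → ℝ} (x : M) (v : TangentSpace (𝓡 n) x) :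
    dFun (fun y => - f y) x v = - dFun f x v := by
  have := mfderiv_neg (I := 𝓡 n) (f := f) (x := x)
  exact congrArg (fun φ : EuclideanSpace ℝ (Fin n) →L[ℝ] ℝ => φ v) this

theorem dFun_const (a : ℝ) (x : M) : dFun (n := n) (fun _ : M => a) x = 0 := mfderiv_const

/-- The Lie bracket of vector fields. -/
noncomputable abbrev lieBr (X Y : VField n M) : VField n M := VectorField.mlieBracket (𝓡 n) X Y

theorem lieBr_swap (X Y : VField n M) (x : M) : lieBr X Y x = - lieBr Y X x :=
  VectorField.mlieBracket_swap_apply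

variable [IsManifold (𝓡 n) ∞ M]

/-- A local extension is cut off by a bump function whose closed support lies where the extension is
smooth. Pointwise identities can therefore be tested on smooth sections. -/
theorem exists_smoothVField [T2Space M] (x : M)
    (v : TangentSpace (𝓡 n) x) : ∃ X : VField n M, SmoothVField X ∧ X x = v := by
  obtain ⟨s, hs, hσ⟩ := FiberBundle.exists_contMDiffOn_extend (k := ∞) (𝓡 n)
    (EuclideanSpace ℝ (Fin n)) (V := fun y : M => TangentSpace (𝓡 n) y) v
  obtain ⟨f, hf⟩ := ((SmoothBumpFunction.nhds_basis_tsupport (I := 𝓡 n) x).mem_iff).1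
    (interior_mem_nhds.2 hs)
  refine ⟨(f : M → ℝ) • FiberBundle.extend (EuclideanSpace ℝ (Fin n)) v, ?_, ?_⟩
  · exact ContMDiffOn.smul_section_of_tsupport f.contMDiff.contMDiffOn isOpen_interior hf.2
      (hσ.mono interior_subset)
  · simp

theorem SmoothVField.add {X Y : VField n M} (hX : SmoothVField X) (hY : SmoothVField Y) :
    SmoothVField (fun x => X x + Y x) := ContMDiff.add_section hX hY

theorem SmoothVField.sub {X Y : VField n M} (hX : SmoothVField X) (hY : SmoothVField Y) :
    SmoothVField (fun x => X x - Y x) := ContMDiff.sub_section hX hY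

theorem SmoothVField.neg {X : VField n M} (hX : SmoothVField X) :
    SmoothVField (fun x => - X x) := ContMDiff.neg_section hX

theorem SmoothVField.smul {f : M → ℝ} {X : VField n M} (hf : SmoothFun (n := n) f)
    (hX : SmoothVField X) : SmoothVField (fun x => f x • X x) := ContMDiff.smul_section hf hX

theorem SmoothVField.const_smul (a : ℝ) {X : VField n M}
    (hX : SmoothVField X) : SmoothVField (fun x => a • X x) := ContMDiff.const_smul_section hX

theorem smoothVField_zero : SmoothVField (fun x : M => (0 : TangentSpace (𝓡 n) x)) :=
  contMDiff_zeroSection ℝ (fun x : M => TangentSpace (𝓡 n) x)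

theorem SmoothCovField.add {X Y : CovField n M} (hX : SmoothCovField X) (hY : SmoothCovField Y) :
    SmoothCovField (fun x => X x + Y x) :=
  ContMDiff.add_section (V := fun y : M => TangentSpace (𝓡 n) y →L[ℝ] ℝ) hX hY

theorem SmoothCovField.neg {X : CovField n M} (hX : SmoothCovField X) :
    SmoothCovField (fun x => - X x) :=
  ContMDiff.neg_section (V := fun y : M => TangentSpace (𝓡 n) y →L[ℝ] ℝ) hX

theorem SmoothCovField.smul {f : M → ℝ} {X : CovField n M} (hf : SmoothFun (n := n) f)
    (hX : SmoothCovField X) : SmoothCovField (fun x => f x • X x) :=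
  ContMDiff.smul_section (V := fun y : M => TangentSpace (𝓡 n) y →L[ℝ] ℝ) hf hX

theorem SmoothBilinField.smul {f : M → ℝ} {g : BilinField n M} (hf : SmoothFun (n := n) f)
    (hg : SmoothBilinField g) : SmoothBilinField (fun x => f x • g x) :=
  ContMDiff.smul_section
    (V := fun y : M => TangentSpace (𝓡 n) y →L[ℝ] TangentSpace (𝓡 n) y →L[ℝ] ℝ) hf hg

theorem SmoothBilinField.apply {g : BilinField n M} {X : VField n M} (hg : SmoothBilinField g)
    (hX : SmoothVField X) : SmoothCovField (fun x => g x (X x)) :=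
  ContMDiff.clm_bundle_apply (F₁ := EuclideanSpace ℝ (Fin n))
    (F₂ := EuclideanSpace ℝ (Fin n) →L[ℝ] ℝ) (E₁ := fun y : M => TangentSpace (𝓡 n) y)
    (E₂ := fun y : M => TangentSpace (𝓡 n) y →L[ℝ] ℝ) (b := fun x => x) hg hX

theorem SmoothCovField.apply {ξ : CovField n M} {X : VField n M} (hξ : SmoothCovField ξ)
    (hX : SmoothVField X) : SmoothFun (n := n) (fun x => ξ x (X x)) := by
  have h (x : M) := (contMDiffAt_totalSpace.1
    (ContMDiff.clm_bundle_apply (F₁ := EuclideanSpace ℝ (Fin n))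
      (F₂ := ℝ) (E₁ := fun y : M => TangentSpace (𝓡 n) y)
      (E₂ := Bundle.Trivial M ℝ) (b := fun x => x) hξ hX x)).2
  exact fun x => h x

theorem SmoothBilinField.apply₂ {g : BilinField n M} {X Y : VField n M} (hg : SmoothBilinField g)
    (hX : SmoothVField X) (hY : SmoothVField Y) :
    SmoothFun (n := n) (fun x => g x (X x) (Y x)) := (hg.apply hX).apply hY

theorem SmoothVField.mdifferentiableAt {X : VField n M} (hX : SmoothVField X) (x : M) :
    MDifferentiableAt (𝓡 n) (𝓡 n).tangent (fun x => (⟨x, X x⟩ : TangentBundle (𝓡 n) M)) x :=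
  (ContMDiff.mdifferentiable hX (by simp)) x

theorem lieBr_add_left {X X' : VField n M} (hX : SmoothVField X) (hX' : SmoothVField X')
    (Y : VField n M) (x : M) :
    lieBr (fun y => X y + X' y) Y x = lieBr X Y x + lieBr X' Y x :=
  VectorField.mlieBracket_add_left (hX.mdifferentiableAt x) (hX'.mdifferentiableAt x)

theorem lieBr_add_right {X X' : VField n M} (hX : SmoothVField X) (hX' : SmoothVField X')
    (Y : VField n M) (x : M) :
    lieBr Y (fun y => X y + X' y) x = lieBr Y X x + lieBr Y X' x :=
  VectorField.mlieBracket_add_right (hX.mdifferentiableAt x) (hX'.mdifferentiableAt x)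

end

end BnGen

/-! ### Vector fields, brackets and differentials in the preferred chart. -/

namespace BnGen
section
variable {n : ℕ} {M : Type*} [TopologicalSpace M] [ChartedSpace (EuclideanSpace ℝ (Fin n)) M]
variable [IsManifold (𝓡 n) ∞ M]

/-- The expression of a vector field in the preferred chart at `x₀`. -/
noncomputable def fieldInChart (x₀ : M) (X : VField n M) :
    EuclideanSpace ℝ (Fin n) → EuclideanSpace ℝ (Fin n) :=
  VectorField.mpullbackWithin 𝓘(ℝ, EuclideanSpace ℝ (Fin n)) (𝓡 n) (extChartAt (𝓡 n) x₀).symm X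
    (Set.range (𝓡 n))

omit [IsManifold (𝓡 n) ∞ M] in
theorem mfderivWithin_range_symm (x₀ : M) (y : EuclideanSpace ℝ (Fin n)) :
    mfderivWithin 𝓘(ℝ, EuclideanSpace ℝ (Fin n)) (𝓡 n) (extChartAt (𝓡 n) x₀).symm
      (Set.range (𝓡 n)) y =
    mfderiv 𝓘(ℝ, EuclideanSpace ℝ (Fin n)) (𝓡 n) (extChartAt (𝓡 n) x₀).symm y := by
  rw [ModelWithCorners.range_eq_univ, mfderivWithin_univ]

theorem mfderiv_symm_fieldInChart {x₀ : M} (X : VField n M) {y : EuclideanSpace ℝ (Fin n)}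
    (hy : y ∈ (extChartAt (𝓡 n) x₀).target) :
    mfderiv 𝓘(ℝ, EuclideanSpace ℝ (Fin n)) (𝓡 n) (extChartAt (𝓡 n) x₀).symm y
      (fieldInChart x₀ X y) = X ((extChartAt (𝓡 n) x₀).symm y) := by
  rw [← mfderivWithin_range_symm]
  obtain ⟨e, he⟩ := isInvertible_mfderivWithin_extChartAt_symm (I := 𝓡 n) hy
  rw [fieldInChart, VectorField.mpullbackWithin_apply, ← he, ContinuousLinearMap.inverse_equiv]
  exact e.apply_symm_apply _

theorem differentiableAt_fieldInChart {X : VField n M} (hX : SmoothVField X) (x : M) :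
    DifferentiableAt ℝ (fieldInChart x X) (extChartAt (𝓡 n) x x) := by
  have h := (mdifferentiableWithinAt_univ.2
    (hX.mdifferentiableAt x)).differentiableWithinAt_mpullbackWithin_vectorField
  have hs : (extChartAt (𝓡 n) x).symm ⁻¹' Set.univ ∩ Set.range (𝓡 n) = Set.univ := by
    rw [ModelWithCorners.range_eq_univ, Set.preimage_univ, Set.univ_inter]
  rw [hs] at h
  exact differentiableWithinAt_univ.1 h

theorem fieldInChart_self (x : M) (X : VField n M) :
    fieldInChart x X (extChartAt (𝓡 n) x x) =
      mfderiv (𝓡 n) 𝓘(ℝ, EuclideanSpace ℝ (Fin n)) (extChartAt (𝓡 n) x) x (X x) := by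
  have h1 := mfderiv_symm_fieldInChart X (mem_extChartAt_target (I := 𝓡 n) x)
  have h2 := mfderiv_extChartAt_comp_mfderivWithin_extChartAt_symm (I := 𝓡 n)
    (mem_extChartAt_target (I := 𝓡 n) x)
  rw [mfderivWithin_range_symm, extChartAt_to_inv] at h2
  rw [extChartAt_to_inv] at h1
  rw [← h1]
  exact (congrArg (fun φ : EuclideanSpace ℝ (Fin n) →L[ℝ] EuclideanSpace ℝ (Fin n) =>
    φ (fieldInChart x X (extChartAt (𝓡 n) x x))) h2).symm

/-- The manifold bracket is defined by applying the inverse of the derivative of the chart to the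
bracket of the chart expressions; that inverse is the derivative of the inverse chart. -/
theorem mfderiv_symm_lieBracket (x : M) (X Y : VField n M) :
    mfderiv 𝓘(ℝ, EuclideanSpace ℝ (Fin n)) (𝓡 n) (extChartAt (𝓡 n) x).symm (extChartAt (𝓡 n) x x)
      (VectorField.lieBracket ℝ (fieldInChart x X) (fieldInChart x Y) (extChartAt (𝓡 n) x x)) =
    lieBr X Y x := by
  have h2 := mfderivWithin_extChartAt_symm_comp_mfderiv_extChartAt' (I := 𝓡 n)
    (mem_extChartAt_source (I := 𝓡 n) x)
  obtain ⟨e, he⟩ := isInvertible_mfderiv_extChartAt (I := 𝓡 n) (mem_extChartAt_source (I := 𝓡 n) x)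
  rw [lieBr, ← VectorField.mlieBracketWithin_univ, VectorField.mlieBracketWithin_apply]
  have hs : (extChartAt (𝓡 n) x).symm ⁻¹' Set.univ ∩ Set.range (𝓡 n) = Set.univ := by
    rw [ModelWithCorners.range_eq_univ, Set.preimage_univ, Set.univ_inter]
  rw [hs]
  rw [mfderivWithin_range_symm, ← he] at h2
  rw [← he, ContinuousLinearMap.inverse_equiv]
  have h3 (w : EuclideanSpace ℝ (Fin n)) := congrArg (fun φ : EuclideanSpace ℝ (Fin n) →L[ℝ]
    EuclideanSpace ℝ (Fin n) => φ (e.symm w)) h2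
  have h4 (w : EuclideanSpace ℝ (Fin n)) : mfderiv 𝓘(ℝ, EuclideanSpace ℝ (Fin n)) (𝓡 n)
      (extChartAt (𝓡 n) x).symm (extChartAt (𝓡 n) x x) w = e.symm w := by
    refine Eq.trans ?_ (h3 w)
    exact congrArg _ (e.apply_symm_apply w).symm
  refine (h4 _).trans (congrArg e.symm ?_)
  exact congrFun VectorField.lieBracketWithin_univ.symm _

theorem fderiv_comp_symm {f : M → ℝ} (hf : SmoothFun (n := n) f) (x : M)
    (v : TangentSpace (𝓡 n) x) :
    fderiv ℝ (fun y => f ((extChartAt (𝓡 n) x).symm y)) (extChartAt (𝓡 n) x x)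
      (mfderiv (𝓡 n) 𝓘(ℝ, EuclideanSpace ℝ (Fin n)) (extChartAt (𝓡 n) x) x v) = dFun f x v := by
  have h2 := mfderivWithin_extChartAt_symm_comp_mfderiv_extChartAt' (I := 𝓡 n)
    (mem_extChartAt_source (I := 𝓡 n) x)
  rw [mfderivWithin_range_symm] at h2
  have hd := mdifferentiableWithinAt_extChartAt_symm (I := 𝓡 n) (mem_extChartAt_target (I := 𝓡 n) x)
  rw [ModelWithCorners.range_eq_univ, mdifferentiableWithinAt_univ] at hd
  have h1 := mfderiv_comp (extChartAt (𝓡 n) x x) (g := f)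
    (hf.mdifferentiableAt _) hd
  rw [mfderiv_eq_fderiv] at h1
  have h3 := congrArg (fun φ : EuclideanSpace ℝ (Fin n) →L[ℝ] ℝ =>
    φ (mfderiv (𝓡 n) 𝓘(ℝ, EuclideanSpace ℝ (Fin n)) (extChartAt (𝓡 n) x) x v)) h1
  refine Eq.trans h3 ?_
  have h4 := congrArg (fun φ : EuclideanSpace ℝ (Fin n) →L[ℝ] EuclideanSpace ℝ (Fin n) => φ v) h2
  -- The inverse chart returns `x` only up to a propositional equality, so the change of base point
  -- is done for a free variable `z`.
  have h5 : ∀ z, z = x → ∀ w : EuclideanSpace ℝ (Fin n),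
      (mfderiv (𝓡 n) 𝓘(ℝ, ℝ) f z : EuclideanSpace ℝ (Fin n) →L[ℝ] ℝ) w =
      (mfderiv (𝓡 n) 𝓘(ℝ, ℝ) f x : EuclideanSpace ℝ (Fin n) →L[ℝ] ℝ) w := by
    rintro z rfl w; rfl
  refine Eq.trans (h5 _ (extChartAt_to_inv x) _) ?_
  exact congrArg (mfderiv (𝓡 n) 𝓘(ℝ, ℝ) f x : EuclideanSpace ℝ (Fin n) →L[ℝ] ℝ) h4

end
end BnGen

/-! ### The exterior derivative of a one-form on vector fields. -/

namespace BnGen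
section
variable {n : ℕ} {M : Type*} [TopologicalSpace M] [ChartedSpace (EuclideanSpace ℝ (Fin n)) M]
variable [IsManifold (𝓡 n) ∞ M]

/-- Smoothness of `η` is smoothness in the bundle trivialization at `x`. On the chart target this
trivialization is composition with the derivative of the inverse chart, which is how `formInChart`
is built. -/
theorem differentiableAt_formInChart_covToForm {η : CovField n M} (hη : SmoothCovField η) (x : M) :
    DifferentiableAt ℝ (formInChart x (covToForm η)) (extChartAt (𝓡 n) x x) := by
  have h1 := ((contMDiffAt_hom_bundle _).1 (hη x)).2
  have h2 : ContMDiffAt 𝓘(ℝ, EuclideanSpace ℝ (Fin n)) (𝓡 n) ∞ (extChartAt (𝓡 n) x).symm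
      (extChartAt (𝓡 n) x x) :=
    (contMDiffOn_extChartAt_symm x).contMDiffAt (extChartAt_target_mem_nhds x)
  have h4 := (ContMDiffAt.comp_of_eq h1 h2 (extChartAt_to_inv x)).contDiffAt.differentiableAt
    (by simp)
  have h5 := (ContinuousAlternatingMap.ofSubsingletonLIE (𝕜 := ℝ) (E := EuclideanSpace ℝ (Fin n))
    (F := ℝ) (0 : Fin 1)).differentiable
  refine ((h5 _).comp _ h4).congr_of_eventuallyEq ?_
  filter_upwards [extChartAt_target_mem_nhds (I := 𝓡 n) x] with y hy
  have hz : (extChartAt (𝓡 n) x).symm y ∈ (chartAt (EuclideanSpace ℝ (Fin n)) x).source := by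
    simpa using! (extChartAt (𝓡 n) x).map_target hy
  have h6 := TangentBundle.symmL_trivializationAt (I := 𝓡 n) hz
  rw [(extChartAt (𝓡 n) x).right_inv hy, mfderivWithin_range_symm] at h6
  have h7 : ContinuousLinearMap.inCoordinates (EuclideanSpace ℝ (Fin n)) (TangentSpace (𝓡 n)) ℝ
      (fun _ : M => ℝ) x ((extChartAt (𝓡 n) x).symm y) x ((extChartAt (𝓡 n) x).symm y)
      (η ((extChartAt (𝓡 n) x).symm y)) = (η ((extChartAt (𝓡 n) x).symm y)).comp
        (mfderiv 𝓘(ℝ, EuclideanSpace ℝ (Fin n)) (𝓡 n) (extChartAt (𝓡 n) x).symm y) := by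
    rw [ContinuousLinearMap.inCoordinates, h6]
    ext v
    exact congrArg (fun φ : ℝ →L[ℝ] ℝ => φ _)
      (Bundle.Trivial.continuousLinearMapAt_trivialization ℝ M ℝ _)
  exact congrArg (ContinuousAlternatingMap.ofSubsingletonLIE (𝕜 := ℝ)
    (E := EuclideanSpace ℝ (Fin n)) (F := ℝ) (0 : Fin 1)) h7.symm

/-- Cartan's formula holds for the chart expressions; the two derivatives and the bracket term are
then carried back to `M` separately. -/
theorem extD_covToForm_apply {η : CovField n M} {X Y : VField n M} (hη : SmoothCovField η)
    (hX : SmoothVField X) (hY : SmoothVField Y) (x : M) :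
    extD (covToForm η) x ![X x, Y x] = dFun (fun y => η y (Y y)) x (X x)
      - dFun (fun y => η y (X y)) x (Y x) - η x (lieBr X Y x) := by
  have h3 : extChartAt (𝓡 n) x x ∈ (extChartAt (𝓡 n) x).target := mem_extChartAt_target x
  have h := extDeriv_apply_vectorField (differentiableAt_formInChart_covToForm hη x)
    (V := ![fieldInChart x X, fieldInChart x Y])
    (by intro i; fin_cases i
        exacts [differentiableAt_fieldInChart hX x, differentiableAt_fieldInChart hY x])
  have key : ∀ (Z : VField n M) (y : EuclideanSpace ℝ (Fin n)),
      y ∈ (extChartAt (𝓡 n) x).target → formInChart x (covToForm η) y ![fieldInChart x Z y] =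
      η ((extChartAt (𝓡 n) x).symm y) (Z ((extChartAt (𝓡 n) x).symm y)) := by
    intro Z y hy
    exact congrArg (η ((extChartAt (𝓡 n) x).symm y)) (mfderiv_symm_fieldInChart Z hy)
  have hd : ∀ Z W : VField n M, SmoothVField Z → 
      fderiv ℝ (fun y => formInChart x (covToForm η) y ![fieldInChart x Z y])
        (extChartAt (𝓡 n) x x) (fieldInChart x W (extChartAt (𝓡 n) x x)) =
      dFun (fun y => η y (Z y)) x (W x) := by
    intro Z W hZ
    rw [fieldInChart_self, ← fderiv_comp_symm (hη.apply hZ)]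
    refine congrArg (fun φ : EuclideanSpace ℝ (Fin n) →L[ℝ] ℝ => φ _)
      (Filter.EventuallyEq.fderiv_eq ?_)
    filter_upwards [extChartAt_target_mem_nhds (I := 𝓡 n) x] with y hy
    exact key Z y hy
  have hb : formInChart x (covToForm η) (extChartAt (𝓡 n) x x)
      ![VectorField.lieBracket ℝ (fieldInChart x X) (fieldInChart x Y) (extChartAt (𝓡 n) x x)]
      = η x (lieBr X Y x) := by
    rw [← mfderiv_symm_lieBracket]
    have h5 : ∀ z, z = x → ∀ w : EuclideanSpace ℝ (Fin n),
      (η z : EuclideanSpace ℝ (Fin n) →L[ℝ] ℝ) w = (η x : EuclideanSpace ℝ (Fin n) →L[ℝ] ℝ) w := by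
      rintro z rfl w; rfl
    exact h5 _ (extChartAt_to_inv x) _
  rw [← hb, ← hd Y X hY, ← hd X Y hX]
  have e1 : extD (covToForm η) x ![X x, Y x] =
      extDeriv (formInChart x (covToForm η)) (extChartAt (𝓡 n) x x)
     (fun i => (![fieldInChart x X, fieldInChart x Y] i (extChartAt (𝓡 n) x x))) := by
    refine congrArg (extDeriv (formInChart x (covToForm η)) (extChartAt (𝓡 n) x x)) ?_
    ext i : 1
    fin_cases i
    · exact (fieldInChart_self x X).symm
    · exact (fieldInChart_self x Y).symm
  have r0 (y : EuclideanSpace ℝ (Fin n)) : (Fin.removeNth 0 fun i =>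
      ![fieldInChart x X, fieldInChart x Y] i y) = ![fieldInChart x Y y] := by
    ext i : 1; fin_cases i; rfl
  have r1 (y : EuclideanSpace ℝ (Fin n)) : (Fin.removeNth 1 fun i =>
      ![fieldInChart x X, fieldInChart x Y] i y) = ![fieldInChart x X y] := by
    ext i : 1; fin_cases i; rfl
  have r2 (w : EuclideanSpace ℝ (Fin n)) (f : Fin 0 → EuclideanSpace ℝ (Fin n)) :
      Matrix.vecCons w f = ![w] := by
    ext i : 1; fin_cases i; rfl
  refine (e1.trans h).trans ((congrArg₂ (· - ·) (Fin.sum_univ_two _)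
    (Fin.sum_univ_one _)).trans ?_)
  refine (congrArg (_ - ·) (Finset.sum_singleton _ (0 : Fin 1))).trans ?_
  have r3 (w : EuclideanSpace ℝ (Fin n)) (f : Fin 0 → EuclideanSpace ℝ (Fin n)) :
      ((-1 : ℤ) ^ (((0 : Fin 1) : ℕ) + ((0 : Fin 1) : ℕ))) •
        formInChart x (covToForm η) (extChartAt (𝓡 n) x x) (Matrix.vecCons w f) =
      formInChart x (covToForm η) (extChartAt (𝓡 n) x x) ![w] := by
    rw [r2]; simp
  refine congrArg₂ (· - ·) ?_ (r3 _ _)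
  have r4 (a b a' b' : ℝ) (ha : a = a') (hb : b = b') :
      ((-1 : ℤ) ^ ((0 : Fin 2) : ℕ)) • a + ((-1 : ℤ) ^ ((1 : Fin 2) : ℕ)) • b = a' - b' := by
    rw [ha, hb]; simp; ring
  refine r4 _ _ _ _ ?_ ?_
  · simp only [r0]; rfl
  · simp only [r1]; rfl

end
end BnGen

/-! ### The trilinear expression `⟨[u, v], w⟩` and the Courant algebroid identities. -/

namespace BnGen
section
variable {n : ℕ} {M : Type*} [TopologicalSpace M] [ChartedSpace (EuclideanSpace ℝ (Fin n)) M]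

/-- The scalar `⟨[u, v], w⟩` on `E_{H,0}`; it depends on `w` only through its value at `x`. -/
noncomputable def tri (H : FormField n M 3) (u v : ESec n M) (x : M) (w : EFib n x) : ℝ :=
  pairing x (dorfman H 0 u v x) w

theorem pairing_apply (x : M) (u v : EFib n x) :
    pairing x u v = (1 / 2 : ℝ) * (v.2.1 u.1 + u.2.1 v.1) + u.2.2 * v.2.2 := rfl

theorem pairing_comm (x : M) (u v : EFib n x) : pairing x u v = pairing x v u := by
  simp only [pairing_apply]; ring

theorem tri_add (H : FormField n M 3) (u v : ESec n M) (x : M) (w w' : EFib n x) :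
    tri H u v x (w + w') = tri H u v x w + tri H u v x w' := map_add _ _ _

theorem tri_neg (H : FormField n M 3) (u v : ESec n M) (x : M) (w : EFib n x) :
    tri H u v x (-w) = - tri H u v x w := map_neg _ _

theorem tri_smul (H : FormField n M 3) (u v : ESec n M) (x : M) (a : ℝ) (w : EFib n x) :
    tri H u v x (a • w) = a * tri H u v x w := map_smul _ _ _

theorem tri_zero (H : FormField n M 3) (u v : ESec n M) (x : M) :
    tri H u v x 0 = 0 := map_zero _

/-! Multilinearity of a three-form, in a form convenient for rewriting. -/

/-- A three-form as a function of three vectors. -/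
noncomputable def three (H : FormField n M 3) (x : M) (a b c : TangentSpace (𝓡 n) x) : ℝ :=
  H x ![a, b, c]

section three

variable (H : FormField n M 3) (x : M) (a a' b b' c c' : TangentSpace (𝓡 n) x) (r : ℝ)

theorem three_add_left : three H x (a + a') b c = three H x a b c + three H x a' b c := by
  have e (z : TangentSpace (𝓡 n) x) : Function.update ![a, b, c] 0 z = ![z, b, c] := by
    ext i : 1; fin_cases i <;> rfl
  have h := (H x).map_update_add ![a, b, c] 0 a a'
  rw [e, e, e] at h
  exact h

theorem three_smul_left : three H x (r • a) b c = r * three H x a b c := by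
  have e (z : TangentSpace (𝓡 n) x) : Function.update ![a, b, c] 0 z = ![z, b, c] := by
    ext i : 1; fin_cases i <;> rfl
  have h := (H x).map_update_smul ![a, b, c] 0 r a
  rw [e, e] at h
  exact h

theorem three_swap_left : three H x a b c = - three H x b a c := by
  have e : ![b, a, c] ∘ Equiv.swap (0 : Fin 3) 1 = ![a, b, c] := by
    ext i : 1; fin_cases i <;> rfl
  have h := (H x).toAlternatingMap.map_swap ![b, a, c] (i := 0) (j := 1) (by decide)
  rw [e] at h
  exact h

theorem three_swap_right : three H x a b c = - three H x a c b := by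
  have e : ![a, c, b] ∘ Equiv.swap (1 : Fin 3) 2 = ![a, b, c] := by
    ext i : 1; fin_cases i <;> rfl
  have h := (H x).toAlternatingMap.map_swap ![a, c, b] (i := 1) (j := 2) (by decide)
  rw [e] at h
  exact h

theorem three_add_mid : three H x a (b + b') c = three H x a b c + three H x a b' c := by
  rw [three_swap_left, three_add_left, three_swap_left, three_swap_left H x b']; ring

theorem three_add_right : three H x a b (c + c') = three H x a b c + three H x a b c' := by
  rw [three_swap_right, three_add_mid, three_swap_right, three_swap_right H x a c']; ring

theorem three_smul_mid : three H x a (r • b) c = r * three H x a b c := by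
  rw [three_swap_left, three_smul_left, three_swap_left]; ring

theorem three_smul_right : three H x a b (r • c) = r * three H x a b c := by
  rw [three_swap_right, three_smul_mid, three_swap_right]; ring

theorem three_self_right : three H x a b b = 0 := by
  linarith [three_swap_right H x a b b]

theorem three_self_outer : three H x a b a = 0 := by
  rw [three_swap_left, three_self_right, neg_zero]

end three

variable [IsManifold (𝓡 n) ∞ M]

/-- Cartan's formula eliminates both exterior derivatives, and the factor `2` clears the `1/2` in
the scalar product. `H` enters with a minus sign because `i_X i_Y H` evaluates to `H(Y, X, ·)`. -/
theorem two_mul_tri {H : FormField n M 3} {u v w : ESec n M} (hu : SmoothESec u)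
    (hv : SmoothESec v) (hw : SmoothESec w) (x : M) :
    2 * tri H u v x (w x) =
      (w x).2.1 (lieBr (fun y => (u y).1) (fun y => (v y).1) x)
      + dFun (fun y => (v y).2.1 (w y).1) x (u x).1
      - (v x).2.1 (lieBr (fun y => (u y).1) (fun y => (w y).1) x)
      - dFun (fun y => (u y).2.1 (w y).1) x (v x).1
      + dFun (fun y => (u y).2.1 (v y).1) x (w x).1
      + (u x).2.1 (lieBr (fun y => (v y).1) (fun y => (w y).1) x)
      + 2 * (v x).2.2 * dFun (fun y => (u y).2.2) x (w x).1
      - three H x (u x).1 (v x).1 (w x).1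
      + 2 * (w x).2.2 * (dFun (fun y => (v y).2.2) x (u x).1
        - dFun (fun y => (u y).2.2) x (v x).1) := by
  have h1 := extD_covToForm_apply hv.2.1 hu.1 hw.1 x
  have h2 := extD_covToForm_apply hu.2.1 hv.1 hw.1 x
  have h3 := three_swap_left H x (u x).1 (v x).1 (w x).1
  have h4 := iota_apply (fun y => (u y).1) (extD (covToForm fun y => (v y).2.1)) x (w x).1
  have h5 := iota_apply (fun y => (v y).1) (extD (covToForm fun y => (u y).2.1)) x (w x).1
  have h6 := iota₂_apply (fun y => (v y).1) (fun y => (u y).1) H x (w x).1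
  have h7 := iota_apply (fun y => (v y).1) (0 : FormField n M 2) x (w x).1
  have h8 := iota_apply (fun y => (u y).1) (0 : FormField n M 2) x (w x).1
  change _ = (0 : ℝ) at h7
  change _ = (0 : ℝ) at h8
  change _ = three H x (v x).1 (u x).1 (w x).1 at h6
  have h9 : (0 : TangentSpace (𝓡 n) x [⋀^Fin 2]→L[ℝ] ℝ) ![(u x).1, (v x).1] = 0 := rfl
  rw [tri, pairing_apply]
  simp only [dorfman, lieDerivCov, Pi.add_apply, Pi.zero_apply, add_apply, sub_apply, smul_apply,
    smul_eq_mul, h4, h5, h6, h7, h8, h9]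
  simp only [h1, h2, h3]
  ring

/-! Behaviour of `tri` under permutations and sums. -/

theorem SmoothESec.add {u v : ESec n M} (hu : SmoothESec u) (hv : SmoothESec v) :
    SmoothESec (fun x => u x + v x) :=
  ⟨hu.1.add hv.1, hu.2.1.add hv.2.1, hu.2.2.add hv.2.2⟩

theorem SmoothESec.smul {f : M → ℝ} {u : ESec n M} (hf : SmoothFun (n := n) f)
    (hu : SmoothESec u) : SmoothESec (fun x => f x • u x) :=
  ⟨hu.1.smul hf, hu.2.1.smul hf, hf.mul hu.2.2⟩

theorem SmoothESec.pairing {u v : ESec n M} (hu : SmoothESec u) (hv : SmoothESec v) :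
    SmoothFun (n := n) (fun x => BnGen.pairing x (u x) (v x)) :=
  ((smoothFun_const _).mul ((hv.2.1.apply hu.1).add (hu.2.1.apply hv.1))).add
    (hu.2.2.mul hv.2.2)

theorem dFun_pairing {u v : ESec n M} (hu : SmoothESec u) (hv : SmoothESec v) (x : M)
    (Z : TangentSpace (𝓡 n) x) :
    2 * dFun (fun y => pairing y (u y) (v y)) x Z = dFun (fun y => (v y).2.1 (u y).1) x Z
      + dFun (fun y => (u y).2.1 (v y).1) x Z + 2 * (u x).2.2 * dFun (fun y => (v y).2.2) x Z
      + 2 * (v x).2.2 * dFun (fun y => (u y).2.2) x Z := by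
  simp only [pairing_apply]
  rw [dFun_add ((smoothFun_const _).mul ((hv.2.1.apply hu.1).add (hu.2.1.apply hv.1)))
    (hu.2.2.mul hv.2.2), dFun_mul hu.2.2 hv.2.2,
    dFun_mul (smoothFun_const _) ((hv.2.1.apply hu.1).add (hu.2.1.apply hv.1)), dFun_const,
    dFun_add (hv.2.1.apply hu.1) (hu.2.1.apply hv.1)]
  simp only [zero_apply]
  ring

variable {H : FormField n M 3} {u u' v v' w : ESec n M}

/-- The symmetric part of the bracket is the differential of the scalar product. -/
theorem tri_swap_left (hu : SmoothESec u) (hv : SmoothESec v) (hw : SmoothESec w) (x : M) :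
    tri H u v x (w x) + tri H v u x (w x) = dFun (fun y => pairing y (u y) (v y)) x (w x).1 := by
  have h1 := two_mul_tri (H := H) hu hv hw x
  have h2 := two_mul_tri (H := H) hv hu hw x
  rw [lieBr_swap, three_swap_left, map_neg] at h2
  linarith [dFun_pairing hu hv x (w x).1]

/-- The bracket with `u` is a derivation of the scalar product. -/
theorem tri_swap_right (hu : SmoothESec u) (hv : SmoothESec v) (hw : SmoothESec w) (x : M) :
    tri H u v x (w x) + tri H u w x (v x) = dFun (fun y => pairing y (v y) (w y)) x (u x).1 := by
  have h1 := two_mul_tri (H := H) hu hv hw x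
  have h2 := two_mul_tri (H := H) hu hw hv x
  rw [lieBr_swap (fun y => (w y).1), three_swap_right, map_neg] at h2
  linarith [dFun_pairing hv hw x (u x).1]

/-- Covectors are extended as `g(Z', ·)`, so extending tangent vectors suffices. -/
theorem exists_smoothESec [T2Space M] (g : BilinField n M) (hg : SmoothBilinField g) (x : M)
    (w : EFib n x) (h : ∃ Z, g x Z = w.2.1) : ∃ w' : ESec n M, SmoothESec w' ∧ w' x = w := by
  obtain ⟨Z, hZ⟩ := h
  obtain ⟨Z', hZ', e⟩ := exists_smoothVField x Z
  obtain ⟨X', hX', e'⟩ := exists_smoothVField x w.1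
  refine ⟨fun y => (X' y, g y (Z' y), w.2.2), ⟨hX', hg.apply hZ', smoothFun_const _⟩, ?_⟩
  simp only [e, e', hZ]

theorem tri_add_left (hu : SmoothESec u) (hu' : SmoothESec u') (hv : SmoothESec v)
    (hw : SmoothESec w) (x : M) :
    tri H (fun y => u y + u' y) v x (w x) = tri H u v x (w x) + tri H u' v x (w x) := by
  have h1 := two_mul_tri (H := H) (hu.add hu') hv hw x
  have h2 := two_mul_tri (H := H) hu hv hw x
  have h3 := two_mul_tri (H := H) hu' hv hw x
  simp only [Prod.fst_add, Prod.snd_add, add_apply, map_add, three_add_left] at h1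
  rw [lieBr_add_left hu.1 hu'.1, lieBr_add_left hu.1 hu'.1, map_add, map_add,
    dFun_add (hu.2.1.apply hw.1) (hu'.2.1.apply hw.1),
    dFun_add (hu.2.1.apply hv.1) (hu'.2.1.apply hv.1), dFun_add hu.2.2 hu'.2.2,
    dFun_add hu.2.2 hu'.2.2] at h1
  linarith

theorem tri_add_mid (hu : SmoothESec u) (hv : SmoothESec v) (hv' : SmoothESec v')
    (hw : SmoothESec w) (x : M) :
    tri H u (fun y => v y + v' y) x (w x) = tri H u v x (w x) + tri H u v' x (w x) := by
  have h1 := two_mul_tri (H := H) hu (hv.add hv') hw x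
  have h2 := two_mul_tri (H := H) hu hv hw x
  have h3 := two_mul_tri (H := H) hu hv' hw x
  simp only [Prod.fst_add, Prod.snd_add, add_apply, map_add, three_add_mid] at h1
  rw [lieBr_add_right hv.1 hv'.1, lieBr_add_left hv.1 hv'.1, map_add, map_add,
    dFun_add (hv.2.1.apply hw.1) (hv'.2.1.apply hw.1),
    dFun_add (hu.2.1.apply hv.1) (hu.2.1.apply hv'.1), dFun_add hv.2.2 hv'.2.2] at h1
  linarith

end
end BnGen

/-! ### Brackets of sections of `E_+` and `E_-`: connections with torsion. -/

namespace BnGen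
section
variable {n : ℕ} {M : Type*} [TopologicalSpace M] [ChartedSpace (EuclideanSpace ℝ (Fin n)) M]

/-- The Koszul expression `2 g(∇_X Y, Z)` of the Levi-Civita connection. -/
noncomputable def koszul (g : BilinField n M) (X Y Z : VField n M) (x : M) : ℝ :=
  dFun (fun y => g y (Y y) (Z y)) x (X x) + dFun (fun y => g y (X y) (Z y)) x (Y x)
    - dFun (fun y => g y (X y) (Y y)) x (Z x) + g x (lieBr X Y x) (Z x)
    - g x (lieBr X Z x) (Y x) - g x (lieBr Y Z x) (X x)

variable (D : Data n M)

/-- The section `X - i_X g` of `E_-`. -/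
noncomputable def Data.minusSec (X : VField n M) : ESec n M := fun x => D.minus x (X x)

/-- The section `Y + i_Y g + b` of `E_+`. -/
noncomputable def Data.plusSec (Y : VField n M) (b : M → ℝ) : ESec n M :=
  fun x => D.plus x (Y x) (b x)

theorem pairing_minus_minus (x : M) (hs : ∀ v w, D.g x v w = D.g x w v)
    (X Y : TangentSpace (𝓡 n) x) : pairing x (D.minus x X) (D.minus x Y) = - D.g x X Y := by
  simp only [pairing_apply, Data.minus, neg_apply]; rw [hs Y X]; ring

theorem pairing_plus_plus (x : M) (hs : ∀ v w, D.g x v w = D.g x w v)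
    (X Y : TangentSpace (𝓡 n) x) (a b : ℝ) :
    pairing x (D.plus x X a) (D.plus x Y b) = D.g x X Y + a * b := by
  simp only [pairing_apply, Data.plus]; rw [hs Y X]; ring

theorem pairing_minus_plus (x : M) (hs : ∀ v w, D.g x v w = D.g x w v)
    (X Y : TangentSpace (𝓡 n) x) (b : ℝ) : pairing x (D.minus x X) (D.plus x Y b) = 0 := by
  simp only [pairing_apply, Data.plus, Data.minus, neg_apply]; rw [hs Y X]; ring

variable [IsManifold (𝓡 n) ∞ M] {D} {H : FormField n M 3}

theorem IsPseudoMetric.smooth_minusSec (hg : IsPseudoMetric D.g) {X : VField n M}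
    (hX : SmoothVField X) : SmoothESec (D.minusSec X) :=
  ⟨hX, (hg.smooth.apply hX).neg, smoothFun_const 0⟩

theorem IsPseudoMetric.smooth_plusSec (hg : IsPseudoMetric D.g) {X : VField n M} {b : M → ℝ}
    (hX : SmoothVField X) (hb : SmoothFun (n := n) b) : SmoothESec (D.plusSec X b) :=
  ⟨hX, hg.smooth.apply hX, hb⟩

section

variable (hg : IsPseudoMetric D.g) {X Y Z : VField n M} {a b k : M → ℝ} (hX : SmoothVField X)
  (hY : SmoothVField Y) (hZ : SmoothVField Z) (ha : SmoothFun (n := n) a)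
  (hb : SmoothFun (n := n) b) (hk : SmoothFun (n := n) k) (x : M)
include hg hX hY hZ

/-- On `TM ⊕ ℝ ≅ E_+` the bracket with a section of `E_-` acts as the direct sum of the connection
`∇ - ½H` and the trivial connection `d`. -/
theorem two_mul_tri_minus_plus_plus (hb : SmoothFun (n := n) b) (k : ℝ) :
    2 * tri H (D.minusSec X) (D.plusSec Y b) x (D.plus x (Z x) k) =
      koszul D.g X Y Z x - three H x (X x) (Y x) (Z x) + 2 * k * dFun b x (X x) := by
  have h := two_mul_tri (H := H) (hg.smooth_minusSec hX) (hg.smooth_plusSec hY hb)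
    (hg.smooth_plusSec hZ (smoothFun_const k)) x
  have e : (fun y => D.g y (Y y) (X y)) = fun y => D.g y (X y) (Y y) := by
    funext y; rw [hg.symm]
  simp only [Data.minusSec, Data.plusSec, Data.minus, Data.plus, neg_apply, dFun_neg, dFun_const,
    zero_apply] at h
  simp only [Data.plus, koszul]
  rw [h, hg.symm x (Z x), hg.symm x (Y x), hg.symm x (X x)]
  ring

/-- On `E_-` the connection is `∇ + ½H`; the overall sign comes from the scalar product being `-g`
there. -/
theorem two_mul_tri_plus_minus_minus (hb : SmoothFun (n := n) b) :
    2 * tri H (D.plusSec Y b) (D.minusSec X) x (D.minus x (Z x)) =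
      - (koszul D.g Y X Z x + three H x (Y x) (X x) (Z x)) := by
  have h := two_mul_tri (H := H) (hg.smooth_plusSec hY hb) (hg.smooth_minusSec hX)
    (hg.smooth_minusSec hZ) x
  simp only [Data.minusSec, Data.plusSec, Data.minus, Data.plus, neg_apply, dFun_neg, dFun_const,
    zero_apply] at h
  simp only [Data.minus, koszul]
  rw [h, hg.symm x (Z x), hg.symm x (Y x), hg.symm x (X x)]
  ring

-- The Koszul expressions of the three mixed triples add up to the pure triple. Each mixed triple
-- contributes `-½H` and the pure one only `-½H` in total, so the correction is `+H`. This identity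
-- turns integrability along `E_+` into a condition on `H`.
include ha hb hk in
theorem tri_plus_plus_plus :
    tri H (D.plusSec X a) (D.plusSec Y b) x (D.plusSec Z k x) =
      tri H (D.minusSec Z) (D.plusSec X a) x (D.plusSec Y b x)
      + tri H (D.minusSec X) (D.plusSec Y b) x (D.plusSec Z k x)
      - tri H (D.minusSec Y) (D.plusSec X a) x (D.plusSec Z k x)
      + three H x (X x) (Y x) (Z x) := by
  have h := two_mul_tri (H := H) (hg.smooth_plusSec hX ha) (hg.smooth_plusSec hY hb)
    (hg.smooth_plusSec hZ hk) x
  have h1 := two_mul_tri_minus_plus_plus (H := H) hg hZ hX hY x ha (b x)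
  have h2 := two_mul_tri_minus_plus_plus (H := H) hg hX hY hZ x hb (k x)
  have h3 := two_mul_tri_minus_plus_plus (H := H) hg hY hX hZ x ha (k x)
  have e (U V : VField n M) : (fun y => D.g y (U y) (V y)) = fun y => D.g y (V y) (U y) := by
    funext y; rw [hg.symm]
  simp only [koszul] at h1 h2 h3
  rw [e Z Y, e Z X, lieBr_swap Z X, lieBr_swap Z Y, three_swap_left, three_swap_right] at h1
  rw [e Y X, lieBr_swap Y X, three_swap_left] at h3
  simp only [Data.plusSec, Data.plus] at h h1 h2 h3 ⊢
  simp only [map_neg, neg_apply] at h1 h3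
  rw [hg.symm x (Z x), hg.symm x (Y x), hg.symm x (X x)] at h
  linarith

/-- The same count of `H`-terms as on `E_+`. The functions `a`, `b`, `k` are free, since the
`ℝ`-part of a section of `E_+` does not affect these triples. -/
theorem tri_minus_minus_minus (a b k : M → ℝ) (ha : SmoothFun (n := n) a)
    (hb : SmoothFun (n := n) b) (hk : SmoothFun (n := n) k) :
    tri H (D.minusSec X) (D.minusSec Y) x (D.minusSec Z x) =
      tri H (D.plusSec Z k) (D.minusSec X) x (D.minusSec Y x)
      + tri H (D.plusSec X a) (D.minusSec Y) x (D.minusSec Z x)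
      - tri H (D.plusSec Y b) (D.minusSec X) x (D.minusSec Z x)
      + three H x (X x) (Y x) (Z x) := by
  have h := two_mul_tri (H := H) (hg.smooth_minusSec hX) (hg.smooth_minusSec hY)
    (hg.smooth_minusSec hZ) x
  have h1 := two_mul_tri_plus_minus_minus (H := H) hg hX hZ hY x hk
  have h2 := two_mul_tri_plus_minus_minus (H := H) hg hY hX hZ x ha
  have h3 := two_mul_tri_plus_minus_minus (H := H) hg hX hY hZ x hb
  have e (U V : VField n M) : (fun y => D.g y (U y) (V y)) = fun y => D.g y (V y) (U y) := by
    funext y; rw [hg.symm]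
  simp only [koszul] at h1 h2 h3
  rw [e Z Y, e Z X, lieBr_swap Z X, lieBr_swap Z Y, three_swap_left, three_swap_right] at h1
  rw [e Y X, lieBr_swap Y X, three_swap_left] at h3
  simp only [Data.minusSec, Data.minus, neg_apply, dFun_neg, dFun_const, zero_apply] at h h1 h2 h3 ⊢
  simp only [map_neg, neg_apply] at h1 h3
  rw [hg.symm x (Z x), hg.symm x (Y x), hg.symm x (X x)] at h
  linarith

end

end
end BnGen

namespace BnGen

/-! ### Eigenspaces of the complexification of a real endomorphism -/

section complexification

variable {V : Type*} [AddCommGroup V] [Module ℝ V]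

/-- The imaginary part of an element of a complexification. -/
noncomputable def imPart : ℂ ⊗[ℝ] V →ₗ[ℝ] V :=
  (TensorProduct.lid ℝ V).toLinearMap ∘ₗ Complex.imLm.rTensor V

/-- The real part of an element of a complexification. -/
noncomputable def rePart : ℂ ⊗[ℝ] V →ₗ[ℝ] V :=
  (TensorProduct.lid ℝ V).toLinearMap ∘ₗ Complex.reLm.rTensor V

theorem imPart_tmul (z : ℂ) (v : V) : imPart (z ⊗ₜ[ℝ] v) = z.im • v := rfl

theorem rePart_tmul (z : ℂ) (v : V) : rePart (z ⊗ₜ[ℝ] v) = z.re • v := rfl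

theorem tmul_rePart_add_tmul_imPart (z : ℂ ⊗[ℝ] V) :
    (1 : ℂ) ⊗ₜ[ℝ] rePart z + Complex.I ⊗ₜ[ℝ] imPart z = z := by
  induction z with
  | zero => simp
  | tmul a v =>
    rw [rePart_tmul, imPart_tmul, ← TensorProduct.smul_tmul, ← TensorProduct.smul_tmul,
      ← TensorProduct.add_tmul]
    congr 1
    apply Complex.ext <;> simp
  | add a b ha hb =>
    rw [map_add, map_add, TensorProduct.tmul_add, TensorProduct.tmul_add]
    nth_rw 3 [← ha]
    nth_rw 3 [← hb]
    abel

theorem tmul_add_I_tmul_inj {u v u' v' : V} :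
    (1 : ℂ) ⊗ₜ[ℝ] u + Complex.I ⊗ₜ[ℝ] v = (1 : ℂ) ⊗ₜ[ℝ] u' + Complex.I ⊗ₜ[ℝ] v' ↔
      u = u' ∧ v = v' := by
  refine ⟨fun h => ⟨?_, ?_⟩, by rintro ⟨rfl, rfl⟩; rfl⟩
  · simpa [rePart_tmul] using congrArg rePart h
  · simpa [imPart_tmul] using congrArg imPart h

theorem mem_eigenspace_I {A : V →ₗ[ℝ] V} {u v : V} :
    (1 : ℂ) ⊗ₜ[ℝ] u + Complex.I ⊗ₜ[ℝ] v ∈ Module.End.eigenspace (A.baseChange ℂ) Complex.I ↔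
      A u = - v ∧ A v = u := by
  rw [Module.End.mem_eigenspace_iff, map_add, LinearMap.baseChange_tmul,
    LinearMap.baseChange_tmul, smul_add, TensorProduct.smul_tmul', TensorProduct.smul_tmul',
    smul_eq_mul, smul_eq_mul, mul_one, Complex.I_mul_I, TensorProduct.neg_tmul,
    ← TensorProduct.tmul_neg, add_comm (Complex.I ⊗ₜ[ℝ] u), tmul_add_I_tmul_inj]

theorem mem_eigenspace_neg_I {A : V →ₗ[ℝ] V} {u v : V} :
    (1 : ℂ) ⊗ₜ[ℝ] u + Complex.I ⊗ₜ[ℝ] v ∈ Module.End.eigenspace (A.baseChange ℂ) (-Complex.I) ↔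
      A u = v ∧ A v = - u := by
  rw [Module.End.mem_eigenspace_iff, map_add, LinearMap.baseChange_tmul,
    LinearMap.baseChange_tmul, smul_add, TensorProduct.smul_tmul', TensorProduct.smul_tmul',
    smul_eq_mul, smul_eq_mul, mul_one, neg_mul, Complex.I_mul_I, neg_neg, TensorProduct.neg_tmul,
    ← TensorProduct.tmul_neg, add_comm (Complex.I ⊗ₜ[ℝ] (-u)), tmul_add_I_tmul_inj]

/-- The real form of the sum of the `i`- and `(-i)`-eigenspaces. -/
def complexPart (A : V →ₗ[ℝ] V) : Submodule ℝ V where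
  carrier := {v | A (A v) = - v}
  zero_mem' := by simp
  add_mem' := by
    intro a b ha hb
    simp only [Set.mem_ofPred_eq] at *
    rw [map_add, map_add, ha, hb, neg_add]
  smul_mem' := by
    intro c a ha
    simp only [Set.mem_ofPred_eq] at *
    rw [map_smul, map_smul, ha, smul_neg]

theorem mem_complexPart {A : V →ₗ[ℝ] V} {v : V} : v ∈ complexPart A ↔ A (A v) = - v := Iff.rfl

/-- The real isomorphism between the complex part and the `i`-eigenspace. -/
noncomputable def complexPartEquiv (A : V →ₗ[ℝ] V) :
    complexPart A ≃ₗ[ℝ] (Module.End.eigenspace (A.baseChange ℂ) Complex.I).restrictScalars ℝ where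
  toFun v := ⟨(1 : ℂ) ⊗ₜ[ℝ] A v + Complex.I ⊗ₜ[ℝ] (v : V), mem_eigenspace_I.2 ⟨v.2, rfl⟩⟩
  map_add' u v := by
    ext
    simp only [Submodule.coe_add, map_add, TensorProduct.tmul_add]
    abel
  map_smul' a v := by
    ext
    simp only [Submodule.coe_smul, map_smul, TensorProduct.tmul_smul, RingHom.id_apply, smul_add]
  invFun z := ⟨imPart z.1, by
    have h := z.2
    rw [Submodule.restrictScalars_mem, ← tmul_rePart_add_tmul_imPart z.1, mem_eigenspace_I] at h
    rw [mem_complexPart, h.2, h.1]⟩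
  left_inv v := by ext; simp [imPart_tmul]
  right_inv z := by
    have h := z.2
    rw [Submodule.restrictScalars_mem, ← tmul_rePart_add_tmul_imPart z.1, mem_eigenspace_I] at h
    ext
    simp only [h.2]
    exact tmul_rePart_add_tmul_imPart z.1

theorem finrank_complexPart (A : V →ₗ[ℝ] V) :
    Module.finrank ℝ (complexPart A) =
      2 * Module.finrank ℂ (Module.End.eigenspace (A.baseChange ℂ) Complex.I) := by
  rw [(complexPartEquiv A).finrank_eq, ← Complex.finrank_real_complex]
  exact (Module.finrank_mul_finrank ℝ ℂ
    (Module.End.eigenspace (A.baseChange ℂ) Complex.I)).symm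

theorem baseChange_apply_re_im (B : LinearMap.BilinForm ℝ V) (u v u' v' : V) :
    LinearMap.BilinForm.baseChange ℂ B ((1 : ℂ) ⊗ₜ[ℝ] u + Complex.I ⊗ₜ[ℝ] v)
      ((1 : ℂ) ⊗ₜ[ℝ] u' + Complex.I ⊗ₜ[ℝ] v') =
      ((B u u' - B v v' : ℝ) : ℂ) + ((B u v' + B v u' : ℝ) : ℂ) * Complex.I := by
  simp only [map_add, LinearMap.add_apply, LinearMap.BilinForm.baseChange_tmul]
  apply Complex.ext <;> simp <;> ring

end complexification

/-! ### Almost complex structures through `A²` and skewness. -/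

section almostComplex

variable {V : Type*} [AddCommGroup V] [Module ℝ V] {B : LinearMap.BilinForm ℝ V}
  {A : V →ₗ[ℝ] V}

/-- An element of the `i`-eigenspace is `A v + i v` with `v` in `complexPart A`; the two equations
are the real and imaginary parts of isotropy. -/
theorem isotropic_eigenspace_iff :
    (∀ a ∈ Module.End.eigenspace (A.baseChange ℂ) Complex.I,
      ∀ b ∈ Module.End.eigenspace (A.baseChange ℂ) Complex.I,
        LinearMap.BilinForm.baseChange ℂ B a b = 0) ↔
    ∀ v ∈ complexPart A, ∀ w ∈ complexPart A, B (A v) (A w) = B v w ∧ B (A v) w = - B v (A w) := by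
  constructor
  · intro h v hv w hw
    have := h _ (mem_eigenspace_I (u := A v) (v := v).2 ⟨hv, rfl⟩) _
      (mem_eigenspace_I (u := A w) (v := w).2 ⟨hw, rfl⟩)
    rw [baseChange_apply_re_im, Complex.ext_iff] at this
    simp at this
    constructor <;> linarith [this.1, this.2]
  · intro h a ha b hb
    rw [← tmul_rePart_add_tmul_imPart a, mem_eigenspace_I] at ha
    rw [← tmul_rePart_add_tmul_imPart b, mem_eigenspace_I] at hb
    rw [← tmul_rePart_add_tmul_imPart a, ← tmul_rePart_add_tmul_imPart b, baseChange_apply_re_im]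
    have h1 := h (imPart a) (by rw [mem_complexPart, ha.2, ha.1]) (imPart b)
      (by rw [mem_complexPart, hb.2, hb.1])
    rw [ha.2, hb.2] at h1
    rw [h1.1, h1.2]
    simp

theorem orthogonal_eigenspaces_iff {u : V} :
    (∀ a ∈ Module.End.eigenspace (A.baseChange ℂ) Complex.I ⊔
      Module.End.eigenspace (A.baseChange ℂ) (-Complex.I),
      LinearMap.BilinForm.baseChange ℂ B ((1 : ℂ) ⊗ₜ[ℝ] u) a = 0) ↔
    ∀ v ∈ complexPart A, B u v = 0 := by
  have e : (1 : ℂ) ⊗ₜ[ℝ] u = (1 : ℂ) ⊗ₜ[ℝ] u + Complex.I ⊗ₜ[ℝ] (0 : V) := by simp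
  rw [e]
  constructor
  · intro h v hv
    have := h _ (Submodule.mem_sup_left (mem_eigenspace_I (u := A v) (v := v).2 ⟨hv, rfl⟩))
    rw [baseChange_apply_re_im, Complex.ext_iff] at this
    simpa using this.2
  · intro h a ha
    obtain ⟨b, hb, c, hc, rfl⟩ := Submodule.mem_sup.1 ha
    rw [← tmul_rePart_add_tmul_imPart b, mem_eigenspace_I] at hb
    rw [← tmul_rePart_add_tmul_imPart c, mem_eigenspace_neg_I] at hc
    rw [map_add, ← tmul_rePart_add_tmul_imPart b, ← tmul_rePart_add_tmul_imPart c,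
      baseChange_apply_re_im, baseChange_apply_re_im,
      h (rePart b) (by rw [mem_complexPart, hb.1, map_neg, hb.2]),
      h (imPart b) (by rw [mem_complexPart, hb.2, hb.1]),
      h (rePart c) (by rw [mem_complexPart, hc.1, hc.2]),
      h (imPart c) (by rw [mem_complexPart, hc.2, map_neg, hc.1])]
    simp

variable [FiniteDimensional ℝ V] {n : ℕ} {u₀ : V}

/-- The complex part is a hyperplane not containing `u₀`. The kernel condition forces its orthogonal
complement into the line of `u₀`, so `u₀` is orthogonal to it, and both identities can be checked on
the splitting into hyperplane and line. -/
theorem skew_and_sq_of_almostComplex (hV : Module.finrank ℝ V = 2 * n + 1)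
    (hBs : ∀ u v, B u v = B v u)
    (hL : Module.finrank ℂ (Module.End.eigenspace (A.baseChange ℂ) Complex.I) = n)
    (hiso : ∀ v ∈ complexPart A, ∀ w ∈ complexPart A,
      B (A v) (A w) = B v w ∧ B (A v) w = - B v (A w))
    (hker : ∀ u, (∀ v ∈ complexPart A, B u v = 0) → A u = 0)
    (h0 : A u₀ = 0) (h1 : B u₀ u₀ = 1) :
    (∀ v, A (A v) = - v + B v u₀ • u₀) ∧ ∀ v w, B (A v) w = - B v (A w) := by
  have hW := finrank_complexPart A
  rw [hL] at hW
  have hu₀ : u₀ ≠ 0 := by rintro rfl; simp at h1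
  have hu₀W : u₀ ∉ complexPart A := by
    rw [mem_complexPart, h0, map_zero]
    intro h; exact hu₀ (by simpa using h.symm)
  have hsup : complexPart A ⊔ ℝ ∙ u₀ = ⊤ := by
    apply Submodule.eq_top_of_finrank_eq
    have hlt : complexPart A < complexPart A ⊔ ℝ ∙ u₀ := by
      refine lt_of_le_of_ne le_sup_left fun h => hu₀W ?_
      rw [h]; exact Submodule.mem_sup_right (Submodule.mem_span_singleton_self _)
    have h2 := Submodule.finrank_lt_finrank_of_lt hlt
    have h3 := Submodule.finrank_le (complexPart A ⊔ ℝ ∙ u₀)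
    omega
  have hdec (v : V) : ∃ w ∈ complexPart A, ∃ a : ℝ, v = w + a • u₀ := by
    have : v ∈ complexPart A ⊔ ℝ ∙ u₀ := by rw [hsup]; trivial
    obtain ⟨w, hw, c, hc, rfl⟩ := Submodule.mem_sup.1 this
    obtain ⟨a, rfl⟩ := Submodule.mem_span_singleton.1 hc
    exact ⟨w, hw, a, rfl⟩
  -- A space of dimension `2n + 1` mapped to the dual of a space of dimension `2n` has nonzero
  -- kernel.
  obtain ⟨z, hz, hz0⟩ : ∃ z : V, (∀ v ∈ complexPart A, B z v = 0) ∧ z ≠ 0 := by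
    let φ : V →ₗ[ℝ] Module.Dual ℝ (complexPart A) := (complexPart A).dualRestrict ∘ₗ B
    have : LinearMap.ker φ ≠ ⊥ := LinearMap.ker_ne_bot_of_finrank_lt
      (by rw [Subspace.dual_finrank_eq]; omega)
    obtain ⟨z, hz, hz0⟩ := (Submodule.ne_bot_iff _).1 this
    exact ⟨z, fun v hv => congrArg (fun ψ : Module.Dual ℝ (complexPart A) => ψ ⟨v, hv⟩) hz, hz0⟩
  have horth : ∀ v ∈ complexPart A, B u₀ v = 0 := by
    obtain ⟨w, hw, a, rfl⟩ := hdec z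
    have hA := hker _ hz
    rw [map_add, map_smul, h0, smul_zero, add_zero] at hA
    have hw0 : w = 0 := by
      rw [mem_complexPart, hA, map_zero] at hw
      simpa using hw.symm
    subst hw0
    rw [zero_add] at hz hz0
    intro v hv
    have := hz v hv
    rw [map_smul, LinearMap.smul_apply, smul_eq_mul] at this
    exact (mul_eq_zero.1 this).resolve_left fun h => hz0 (by rw [h, zero_smul])
  have hAW : ∀ v ∈ complexPart A, A v ∈ complexPart A := by
    intro v hv
    rw [mem_complexPart] at *
    rw [hv, map_neg]
  constructor
  · intro v
    obtain ⟨w, hw, a, rfl⟩ := hdec v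
    rw [map_add, map_smul, h0, smul_zero, add_zero, mem_complexPart.1 hw, map_add,
      LinearMap.add_apply, hBs w, horth w hw, map_smul, LinearMap.smul_apply, h1]
    simp
  · intro v v'
    obtain ⟨w, hw, a, rfl⟩ := hdec v
    obtain ⟨w', hw', a', rfl⟩ := hdec v'
    simp only [map_add, map_smul, h0, smul_zero, add_zero, LinearMap.add_apply,
      LinearMap.smul_apply, horth _ (hAW _ hw'), hBs _ u₀, horth _ (hAW _ hw),
      (hiso w hw w' hw').2]

/-- By the formula for `A²`, the complex part is exactly the hyperplane orthogonal to `u₀`; its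
dimension `2n` gives the rank `n`. -/
theorem almostComplex_of_skew_and_sq (hV : Module.finrank ℝ V = 2 * n + 1)
    (hBs : ∀ u v, B u v = B v u) (hB : ∀ u, (∀ v, B u v = 0) → u = 0)
    (h0 : A u₀ = 0) (h1 : B u₀ u₀ = 1)
    (hsq : ∀ v, A (A v) = - v + B v u₀ • u₀) (hskew : ∀ v w, B (A v) w = - B v (A w)) :
    Module.finrank ℂ (Module.End.eigenspace (A.baseChange ℂ) Complex.I) = n ∧
    (∀ v ∈ complexPart A, ∀ w ∈ complexPart A,
      B (A v) (A w) = B v w ∧ B (A v) w = - B v (A w)) ∧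
    (∀ u, (∀ v ∈ complexPart A, B u v = 0) → A u = 0) := by
  have hu₀ : u₀ ≠ 0 := by rintro rfl; simp at h1
  have hmem (v : V) : v ∈ complexPart A ↔ B v u₀ = 0 := by
    rw [mem_complexPart, hsq]
    simp [hu₀]
  have hW : complexPart A = LinearMap.ker (B u₀) := by
    ext v; rw [hmem, LinearMap.mem_ker, hBs]
  refine ⟨?_, fun v hv w hw => ⟨?_, hskew v w⟩, fun u hu => ?_⟩
  · have h2 := finrank_complexPart A
    have h3 := LinearMap.finrank_range_add_finrank_ker (B u₀)
    have h4 : LinearMap.range (B u₀) = ⊤ := by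
      refine LinearMap.range_eq_top.2 fun r => ⟨r • u₀, ?_⟩
      rw [map_smul, h1, smul_eq_mul, mul_one]
    rw [h4, finrank_top, Module.finrank_self, ← hW, hV] at h3
    omega
  · rw [hskew, hw, map_neg, neg_neg]
  · apply hB
    intro v
    rw [hskew, hu (A v), neg_zero]
    rw [mem_complexPart, hsq v, map_add, map_neg, map_smul, h0, smul_zero, add_zero]

end almostComplex
end BnGen

/-! ### The fibre of `E`, the splitting `E_- ⊕ E_+`, and the algebra of components. -/

namespace BnGen
section
variable {n : ℕ} {M : Type*} [TopologicalSpace M] [ChartedSpace (EuclideanSpace ℝ (Fin n)) M]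

instance (x : M) : FiniteDimensional ℝ (TangentSpace (𝓡 n) x) :=
  inferInstanceAs (FiniteDimensional ℝ (EuclideanSpace ℝ (Fin n)))

instance (x : M) : FiniteDimensional ℝ (TangentSpace (𝓡 n) x →L[ℝ] ℝ) :=
  inferInstanceAs (FiniteDimensional ℝ (EuclideanSpace ℝ (Fin n) →L[ℝ] ℝ))

theorem finrank_tangentSpace (x : M) : Module.finrank ℝ (TangentSpace (𝓡 n) x) = n :=
  finrank_euclideanSpace_fin (𝕜 := ℝ) (n := n)

theorem finrank_cotangentSpace (x : M) :
    Module.finrank ℝ (TangentSpace (𝓡 n) x →L[ℝ] ℝ) = n := by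
  have h : Module.finrank ℝ (EuclideanSpace ℝ (Fin n) →L[ℝ] ℝ) = n := by
    rw [← (LinearMap.toContinuousLinearMap (𝕜 := ℝ) (E := EuclideanSpace ℝ (Fin n))
      (F' := ℝ)).finrank_eq, Module.finrank_linearMap, Module.finrank_self,
      finrank_euclideanSpace_fin, mul_one]
  exact h

theorem finrank_EFib (x : M) : Module.finrank ℝ (EFib n x) = 2 * n + 1 := by
  rw [Module.finrank_prod, Module.finrank_prod, finrank_tangentSpace, finrank_cotangentSpace,
    Module.finrank_self]
  ring

theorem pairing_nondegenerate (x : M) (u : EFib n x) (h : ∀ v, pairing x u v = 0) : u = 0 := by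
  have h1 (Y : TangentSpace (𝓡 n) x) := h (Y, 0, 0)
  have h2 (η : TangentSpace (𝓡 n) x →L[ℝ] ℝ) := h (0, η, 0)
  have h3 := h (0, 0, 1)
  simp only [pairing_apply, zero_apply, map_zero, mul_zero, zero_add, add_zero, mul_one] at h1 h2 h3
  have e1 : u.1 = 0 := by
    have key : ∀ v : EuclideanSpace ℝ (Fin n),
        (∀ φ : EuclideanSpace ℝ (Fin n) →L[ℝ] ℝ, φ v = 0) → v = 0 := by
      intro v hv
      ext i
      exact hv (EuclideanSpace.proj i)
    have h4 (φ : TangentSpace (𝓡 n) x →L[ℝ] ℝ) : φ u.1 = 0 := by simpa using h2 φ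
    exact key u.1 h4
  have e2 : u.2.1 = 0 := by
    ext Y; have := h1 Y; simpa using this
  exact Prod.ext e1 (Prod.ext e2 h3)

theorem exists_flat_eq {g : TangentSpace (𝓡 n) (x : M) →L[ℝ] TangentSpace (𝓡 n) x →L[ℝ] ℝ}
    (hg : ∀ v, (∀ w, g v w = 0) → v = 0) (ξ : TangentSpace (𝓡 n) x →L[ℝ] ℝ) : ∃ Z, g Z = ξ := by
  have hinj : Function.Injective
      (g : TangentSpace (𝓡 n) x →ₗ[ℝ] (TangentSpace (𝓡 n) x →L[ℝ] ℝ)) := by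
    rw [← LinearMap.ker_eq_bot, LinearMap.ker_eq_bot']
    intro v hv
    exact hg v fun w => congrArg (fun φ : TangentSpace (𝓡 n) x →L[ℝ] ℝ => φ w) hv
  exact (LinearMap.injective_iff_surjective_of_finrank_eq_finrank
    ((finrank_tangentSpace x).trans (finrank_cotangentSpace x).symm)).1 hinj ξ

variable (D : Data n M) (x : M)

theorem Data.minus_add (X Y : TangentSpace (𝓡 n) x) :
    D.minus x (X + Y) = D.minus x X + D.minus x Y := by
  simp [Data.minus, add_comm]

theorem Data.minus_smul (a : ℝ) (X : TangentSpace (𝓡 n) x) :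
    D.minus x (a • X) = a • D.minus x X := by
  simp [Data.minus]

theorem Data.plus_add (X Y : TangentSpace (𝓡 n) x) (a b : ℝ) :
    D.plus x (X + Y) (a + b) = D.plus x X a + D.plus x Y b := by
  simp [Data.plus]

theorem Data.plus_smul (r : ℝ) (X : TangentSpace (𝓡 n) x) (a : ℝ) :
    D.plus x (r • X) (r * a) = r • D.plus x X a := by
  simp [Data.plus]

theorem Data.exists_minus_add_plus (hg : ∀ v, (∀ w, D.g x v w = 0) → v = 0) (u : EFib n x) :
    ∃ X Y a, u = D.minus x X + D.plus x Y a := by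
  obtain ⟨Z, hZ⟩ := exists_flat_eq hg u.2.1
  refine ⟨(1 / 2 : ℝ) • (u.1 - Z), (1 / 2 : ℝ) • (u.1 + Z), u.2.2, ?_⟩
  refine Prod.ext ?_ (Prod.ext ?_ ?_)
  · simp only [Data.minus, Data.plus, Prod.fst_add]; module
  · simp only [Data.minus, Data.plus, Prod.fst_add, Prod.snd_add, map_smul, map_add, map_sub, hZ]
    module
  · simp [Data.minus, Data.plus]

theorem Data.minus_add_plus_inj {X X' Y Y' : TangentSpace (𝓡 n) x} {a a' : ℝ}
    (hg : ∀ v, (∀ w, D.g x v w = 0) → v = 0)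
    (h : D.minus x X + D.plus x Y a = D.minus x X' + D.plus x Y' a') :
    X = X' ∧ Y = Y' ∧ a = a' := by
  have hz : ∀ Z, D.g x Z = 0 → Z = 0 := fun Z hZ => hg Z fun w => by rw [hZ]; rfl
  have h1 : X + Y = X' + Y' := congrArg Prod.fst h
  have h2 : - D.g x X + D.g x Y = - D.g x X' + D.g x Y' := congrArg (fun u => u.2.1) h
  have h3 : a = a' := by simpa [Data.minus, Data.plus] using congrArg (fun u => u.2.2) h
  have h4 : (Y - X) - (Y' - X') = 0 := hz _ (by
    simp only [map_sub]
    linear_combination (norm := module) h2)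
  refine ⟨?_, ?_, h3⟩
  · linear_combination (norm := module) (1 / 2 : ℝ) • h1 - (1 / 2 : ℝ) • h4
  · linear_combination (norm := module) (1 / 2 : ℝ) • h1 + (1 / 2 : ℝ) • h4

variable [IsManifold (𝓡 n) ∞ M]

/-- The algebraic relations between the components of a `B_n`-generalized almost pseudo-Hermitian
structure. -/
structure Data.IsHermitian (D : Data n M) : Prop where
  metric : IsPseudoMetric D.g
  Jm_sq : ∀ x X, D.Jm x (D.Jm x X) = - X
  Jm_skew : ∀ x X Y, D.g x (D.Jm x X) Y = - D.g x X (D.Jm x Y)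
  Jp_sq : ∀ x X, D.Jp x (D.Jp x X) =
    - X + D.g x X (D.Xp x) • D.Xp x + D.g x X (D.Xm x) • D.Xm x
  Jp_skew : ∀ x X Y, D.g x (D.Jp x X) Y = - D.g x X (D.Jp x Y)
  Jp_Xp : ∀ x, D.Jp x (D.Xp x) = - D.c x • D.Xm x
  Jp_Xm : ∀ x, D.Jp x (D.Xm x) = D.c x • D.Xp x
  g_Xp_Xm : ∀ x, D.g x (D.Xp x) (D.Xm x) = 0
  g_Xp_Xp : ∀ x, D.g x (D.Xp x) (D.Xp x) = 1 - D.c x ^ 2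
  g_Xm_Xm : ∀ x, D.g x (D.Xm x) (D.Xm x) = 1 - D.c x ^ 2

/-- `G` and `A` are the endomorphism fields of `E` determined by the data `D`. -/
structure Data.IsModel (D : Data n M) (G A : EEnd n M) : Prop where
  hermitian : D.IsHermitian
  smooth_Jp : SmoothEndField D.Jp
  smooth_Jm : SmoothEndField D.Jm
  smooth_Xp : SmoothVField D.Xp
  smooth_Xm : SmoothVField D.Xm
  smooth_c : SmoothFun (n := n) D.c
  smooth_G : SmoothEEnd G
  G_minus : ∀ x X, G x (D.minus x X) = - D.minus x X
  G_plus : ∀ x X a, G x (D.plus x X a) = D.plus x X a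
  A_minus : ∀ x X, A x (D.minus x X) = D.minus x (D.Jm x X)
  A_plus : ∀ x X a, A x (D.plus x X a) =
    D.plus x (D.Jp x X + a • D.Xm x) (- D.g x X (D.Xm x))

/-- The square-one section `X₊ + i_{X₊} g + c₊` of `ker A`. -/
noncomputable def Data.unit (D : Data n M) : ESec n M := fun x => D.plus x (D.Xp x) (D.c x)

variable {D} {G A : EEnd n M}

namespace Data.IsModel

variable (h : D.IsModel G A)
include h

theorem exists_decomp (u : EFib n x) : ∃ X Y a, u = D.minus x X + D.plus x Y a :=
  D.exists_minus_add_plus x (h.hermitian.metric.nondegenerate x) u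

theorem A_unit : A x (D.unit x) = 0 := by
  have hh := h.hermitian
  rw [Data.unit, h.A_plus, hh.Jp_Xp, hh.g_Xp_Xm]
  simp [Data.plus]

theorem pairing_unit_unit : pairing x (D.unit x) (D.unit x) = 1 := by
  rw [Data.unit, pairing_plus_plus D x (h.hermitian.metric.symm x), h.hermitian.g_Xp_Xp]
  ring

theorem A_sq (u : EFib n x) : A x (A x u) = - u + pairing x u (D.unit x) • D.unit x := by
  have hh := h.hermitian
  have hs := hh.metric.symm x
  obtain ⟨X, Y, a, rfl⟩ := h.exists_decomp x u
  rw [map_add, map_add, h.A_minus, h.A_minus, h.A_plus, h.A_plus, hh.Jm_sq, map_add, map_smul,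
    hh.Jp_sq, hh.Jp_Xm, map_add, add_apply, hh.Jp_skew, hh.Jp_Xm, map_smul, map_smul, smul_apply,
    hh.g_Xm_Xm, Data.unit, map_add, LinearMap.add_apply, pairing_minus_plus D x hs,
    pairing_plus_plus D x hs, ← D.plus_smul, zero_add]
  rw [show -(D.minus x X + D.plus x Y a) = D.minus x (-X) + D.plus x (-Y) (-a) by
    simp [Data.minus, Data.plus, add_comm], add_assoc (D.minus x (-X)), ← D.plus_add]
  congr 2
  · module
  · simp only [smul_eq_mul]; ring

theorem A_skew (u v : EFib n x) : pairing x (A x u) v = - pairing x u (A x v) := by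
  have hh := h.hermitian
  have hs := hh.metric.symm x
  obtain ⟨X, Y, a, rfl⟩ := h.exists_decomp x u
  obtain ⟨X', Y', a', rfl⟩ := h.exists_decomp x v
  simp only [map_add, h.A_minus, h.A_plus, LinearMap.add_apply, pairing_minus_minus D x hs,
    pairing_plus_plus D x hs, pairing_minus_plus D x hs,
    pairing_comm x (D.plus x _ _) (D.minus x _),
    hh.Jm_skew, add_apply, map_smul, smul_apply, smul_eq_mul, hh.Jp_skew x Y, hs (D.Xm x)]
  ring

theorem G_sq (u : EFib n x) : G x (G x u) = u := by
  obtain ⟨X, Y, a, rfl⟩ := h.exists_decomp x u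
  simp only [map_add, h.G_minus, h.G_plus, map_neg, neg_neg]

theorem G_A (u : EFib n x) : G x (A x u) = A x (G x u) := by
  obtain ⟨X, Y, a, rfl⟩ := h.exists_decomp x u
  simp only [map_add, h.G_minus, h.G_plus, map_neg, h.A_minus, h.A_plus]

theorem G_symm (u v : EFib n x) : pairing x (G x u) v = pairing x u (G x v) := by
  have hs := h.hermitian.metric.symm x
  obtain ⟨X, Y, a, rfl⟩ := h.exists_decomp x u
  obtain ⟨X', Y', a', rfl⟩ := h.exists_decomp x v
  simp only [map_add, h.G_minus, h.G_plus, LinearMap.add_apply, map_neg, LinearMap.neg_apply,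
    pairing_minus_plus D x hs, pairing_comm x (D.plus x _ _) (D.minus x _)]
  ring

end Data.IsModel

end
end BnGen

/-! ### Passage between structures, components and models. -/

namespace BnGen
section
variable {n : ℕ} {M : Type*} [TopologicalSpace M] [ChartedSpace (EuclideanSpace ℝ (Fin n)) M]
variable [IsManifold (𝓡 n) ∞ M] {D : Data n M} {G A : EEnd n M} {H : FormField n M 3}
  {F : FormField n M 2}

/-- Commuting with `𝒢`, the endomorphism `A` preserves `E_±`. Its values on `E_+` are known modulo
`ℝ`, and skewness against the section `1` supplies the missing part `-g(X, X₋)`. The Hermitian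
identities are then `A u = 0`, `⟨u, u⟩ = 1`, skewness and the formula for `A²`, read in components.
-/
theorem IsGenPseudoKahler.isModel (hK : IsGenPseudoKahler H F G A) (hD : IsComponents G A D) :
    D.IsModel G A := by
  have hs (x : M) := hD.metric.symm x
  have hnd (x : M) := hD.metric.nondegenerate x
  have hunit (x : M) : A x (D.unit x) = 0 := hD.ker_u x
  have hone (x : M) : pairing x (D.unit x) (D.unit x) = 1 := hD.norm_u x
  have hAA (x : M) := skew_and_sq_of_almostComplex (B := pairing x) (A := A x) (n := n)
    (u₀ := D.unit x) (finrank_EFib x) (pairing_comm x) (hK.complex₁.almost.finrank_eq x)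
    (isotropic_eigenspace_iff.1 (hK.complex₁.almost.isotropic x))
    (fun u hu => hK.complex₁.almost.ker x u (orthogonal_eigenspaces_iff.2 hu))
    (hunit x) (hone x)
  have Gm (x : M) (X : TangentSpace (𝓡 n) x) : G x (D.minus x X) = - D.minus x X := by
    have := (hD.standard x (D.minus x X)).2 ⟨X, rfl⟩
    rw [Eminus, Module.End.mem_eigenspace_iff] at this
    rw [this, neg_one_smul]
  have Gp (x : M) (X : TangentSpace (𝓡 n) x) (a : ℝ) : G x (D.plus x X a) = D.plus x X a := by
    refine hK.metric.eq_on_orthogonal x _ fun v hv => ?_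
    obtain ⟨Y, rfl⟩ := (hD.standard x v).1 hv
    rw [pairing_comm, pairing_minus_plus D x (hs x)]
  have hcomm (x : M) (u : EFib n x) : G x (A x u) = A x (G x u) :=
    congrArg (fun φ : EFib n x →ₗ[ℝ] EFib n x => φ u) (hK.commute x)
  have Am (x : M) (X : TangentSpace (𝓡 n) x) : A x (D.minus x X) = D.minus x (D.Jm x X) := by
    have : A x (D.minus x X) ∈ Eminus G x := by
      rw [Eminus, Module.End.mem_eigenspace_iff, hcomm, Gm, map_neg, neg_one_smul]
    obtain ⟨Y, hY⟩ := (hD.standard x _).1 this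
    rw [hY, hD.Jm_eq, hY]
    rfl
  have Ap' (x : M) (X : TangentSpace (𝓡 n) x) (a : ℝ) :
      ∃ k, A x (D.plus x X a) = D.plus x (D.Jp x X + a • D.Xm x) k := by
    obtain ⟨X1, X2, k, hk⟩ := D.exists_minus_add_plus x (hnd x) (A x (D.plus x X a))
    have h1 := hcomm x (D.plus x X a)
    rw [Gp, hk, map_add, Gm, Gp, show - D.minus x X1 = D.minus x (-X1) by simp [Data.minus]] at h1
    have h2 := (D.minus_add_plus_inj x (hnd x) h1).1
    have h3 : X1 = 0 := by linear_combination (norm := module) (-1 / 2 : ℝ) • h2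
    have h4 : D.plus x X a = D.plus x X 0 + a • D.plus x 0 1 := by simp [Data.plus]
    have h5 : D.Jp x X + a • D.Xm x = X2 := by
      rw [hD.Jp_eq, hD.Xm_eq]
      have := congrArg Prod.fst hk
      rw [h4, map_add, map_smul, h3] at this
      simpa [Data.minus, Data.plus] using this
    refine ⟨k, ?_⟩
    rw [hk, h5, h3]
    simp [Data.minus]
  have Ap (x : M) (X : TangentSpace (𝓡 n) x) (a : ℝ) : A x (D.plus x X a) =
      D.plus x (D.Jp x X + a • D.Xm x) (- D.g x X (D.Xm x)) := by
    obtain ⟨k, hk⟩ := Ap' x X a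
    obtain ⟨k', hk'⟩ := Ap' x 0 1
    have h1 := (hAA x).2 (D.plus x X a) (D.plus x 0 1)
    have h2 := (hAA x).2 (D.plus x 0 1) (D.plus x 0 1)
    rw [hk, hk', pairing_plus_plus D x (hs x), pairing_plus_plus D x (hs x)] at h1
    rw [hk', pairing_plus_plus D x (hs x), pairing_plus_plus D x (hs x)] at h2
    simp at h1 h2
    -- Skewness gives `⟨A1, 1⟩ = -⟨1, A1⟩`, so `A1` has no `ℝ`-part.
    have h3 : k' = 0 := by linarith
    rw [hk]
    congr 1
    rw [h1, h3]; ring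
  have hu (x : M) := hunit x
  simp only [Data.unit, Ap] at hu
  have hXpm (x : M) : D.g x (D.Xp x) (D.Xm x) = 0 := by
    simpa [Data.plus] using congrArg (fun u => u.2.2) (hu x)
  have sq1 (x : M) := (hAA x).1 (D.plus x 0 1)
  simp only [Data.unit, Ap, pairing_plus_plus D _ (hs _)] at sq1
  refine ⟨⟨hD.metric, fun x X => ?_, fun x X Y => ?_, fun x X => ?_, fun x X Y => ?_, fun x => ?_,
    fun x => ?_, hXpm, fun x => ?_, fun x => ?_⟩, hD.smooth_Jp, hD.smooth_Jm, hD.smooth_Xp,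
    hD.smooth_Xm, hD.smooth_c, hK.metric.smooth, Gm, Gp, Am, Ap⟩
  · have := (hAA x).1 (D.minus x X)
    rw [Am, Am, Data.unit, pairing_minus_plus D x (hs x), zero_smul, add_zero] at this
    exact congrArg Prod.fst this
  · have := (hAA x).2 (D.minus x X) (D.minus x Y)
    rw [Am, Am, pairing_minus_minus D x (hs x), pairing_minus_minus D x (hs x)] at this
    linarith
  · have := congrArg Prod.fst ((hAA x).1 (D.plus x X 0))
    simp only [Data.unit, Ap, pairing_plus_plus D _ (hs _)] at this
    simp only [Data.plus, zero_smul, add_zero, Prod.fst_add, Prod.fst_neg, Prod.smul_fst,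
      zero_mul] at this
    linear_combination (norm := module) this
  · have := (hAA x).2 (D.plus x X 0) (D.plus x Y 0)
    rw [Ap, Ap, pairing_plus_plus D x (hs x), pairing_plus_plus D x (hs x)] at this
    simpa using this
  · have h1 : D.Jp x (D.Xp x) + D.c x • D.Xm x = 0 := congrArg Prod.fst (hu x)
    linear_combination (norm := module) h1
  · have h1 := congrArg Prod.fst (sq1 x)
    simpa [Data.plus] using h1
  · have := hone x
    rw [Data.unit, pairing_plus_plus D x (hs x)] at this
    linarith
  · have h1 := congrArg (fun u => u.2.2) (sq1 x)
    simp [Data.plus] at h1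
    linarith

namespace Data.IsModel

variable (h : D.IsModel G A)
include h

theorem mem_Eminus_iff (x : M) (u : EFib n x) : u ∈ Eminus G x ↔ ∃ X, u = D.minus x X := by
  rw [Eminus, Module.End.mem_eigenspace_iff, neg_one_smul]
  constructor
  · intro hu
    obtain ⟨X, Y, a, rfl⟩ := h.exists_decomp x u
    rw [map_add, h.G_minus, h.G_plus] at hu
    rw [neg_add] at hu
    have h2 : (2 : ℝ) • D.plus x Y a = 0 := by
      rw [two_smul]; nth_rw 1 [add_left_cancel hu]; exact neg_add_cancel _
    have h1 : D.plus x Y a = 0 := (smul_eq_zero.1 h2).resolve_left two_ne_zero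
    exact ⟨X, by rw [h1, add_zero]⟩
  · rintro ⟨X, rfl⟩
    exact h.G_minus x X

theorem isGenMetric : IsGenMetric G where
  smooth := h.smooth_G
  finrank_eq x := by
    let φ : TangentSpace (𝓡 n) x →ₗ[ℝ] Eminus G x :=
      { toFun := fun X => ⟨D.minus x X, (h.mem_Eminus_iff x _).2 ⟨X, rfl⟩⟩
        map_add' := fun X Y => Subtype.ext (D.minus_add x X Y)
        map_smul' := fun a X => Subtype.ext (D.minus_smul x a X) }
    have hφ : Function.Bijective φ :=
      ⟨fun X Y hXY => congrArg (fun u : Eminus G x => (u : EFib n x).1) hXY, fun u => by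
        obtain ⟨X, hX⟩ := (h.mem_Eminus_iff x _).1 u.2
        exact ⟨X, Subtype.ext hX.symm⟩⟩
    rw [← (LinearEquiv.ofBijective φ hφ).finrank_eq, finrank_tangentSpace]
  nondegenerate x u hu huv := by
    obtain ⟨X, rfl⟩ := (h.mem_Eminus_iff x _).1 hu
    have : X = 0 := h.hermitian.metric.nondegenerate x X fun Y => by
      have := huv (D.minus x Y) ((h.mem_Eminus_iff x _).2 ⟨Y, rfl⟩)
      rw [pairing_minus_minus D x (h.hermitian.metric.symm x)] at this
      linarith
    rw [this]; simp [Data.minus]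
  eq_on_orthogonal x u huv := by
    obtain ⟨X, Y, a, rfl⟩ := h.exists_decomp x u
    have : X = 0 := h.hermitian.metric.nondegenerate x X fun Z => by
      have := huv (D.minus x Z) ((h.mem_Eminus_iff x _).2 ⟨Z, rfl⟩)
      rw [map_add, LinearMap.add_apply, pairing_minus_minus D x (h.hermitian.metric.symm x),
        pairing_comm x (D.plus x _ _), pairing_minus_plus D x (h.hermitian.metric.symm x)] at this
      linarith
    rw [map_add, h.G_minus, h.G_plus, this]; simp [Data.minus]
  admissible x := by
    constructor
    · intro u v huv
      obtain ⟨X, hX⟩ := (h.mem_Eminus_iff x _).1 u.2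
      obtain ⟨Y, hY⟩ := (h.mem_Eminus_iff x _).1 v.2
      refine Subtype.ext ?_
      have h1 : X = Y := by simpa [hX, hY, Data.minus] using huv
      rw [hX, hY, h1]
    · intro X
      exact ⟨⟨D.minus x X, (h.mem_Eminus_iff x _).2 ⟨X, rfl⟩⟩, rfl⟩

theorem isComponents : IsComponents G A D where
  metric := h.hermitian.metric
  smooth_Jp := h.smooth_Jp
  smooth_Jm := h.smooth_Jm
  smooth_Xp := h.smooth_Xp
  smooth_Xm := h.smooth_Xm
  smooth_c := h.smooth_c
  standard := h.mem_Eminus_iff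
  ker_u := h.A_unit
  norm_u := h.pairing_unit_unit
  Jm_eq x X := by rw [h.A_minus]; rfl
  Jp_eq x X := by rw [h.A_plus]; simp [Data.plus]
  Xm_eq x := by rw [h.A_plus]; simp [Data.plus]

/-- The projections to `E_∓` are `½(1 ∓ 𝒢)`, so smoothness of `𝒢` makes both parts of a smooth
section smooth. -/
theorem smooth_decomp {u : ESec n M} (hu : SmoothESec u) :
    ∃ X Y b, SmoothVField X ∧ SmoothVField Y ∧ SmoothFun (n := n) b ∧
      u = fun x => D.minusSec X x + D.plusSec Y b x := by
  refine ⟨fun x => (1 / 2 : ℝ) • ((u x).1 - (G x (u x)).1),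
    fun x => (1 / 2 : ℝ) • ((u x).1 + (G x (u x)).1), fun x => (u x).2.2,
    (hu.1.sub (h.smooth_G u hu).1).const_smul _, (hu.1.add (h.smooth_G u hu).1).const_smul _,
    hu.2.2, ?_⟩
  funext x
  obtain ⟨X, Y, a, e⟩ := h.exists_decomp x (u x)
  have e1 : (u x).1 = X + Y := congrArg Prod.fst e
  have e2 : (G x (u x)).1 = - X + Y := by rw [e, map_add, h.G_minus, h.G_plus]; rfl
  have e3 : (u x).2.2 = a := by simp [e, Data.minus, Data.plus]
  have e4 : (1 / 2 : ℝ) • ((u x).1 - (G x (u x)).1) = X := by rw [e1, e2]; module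
  have e5 : (1 / 2 : ℝ) • ((u x).1 + (G x (u x)).1) = Y := by rw [e1, e2]; module
  simp only [Data.minusSec, Data.plusSec]
  rw [e4, e5, e3]
  exact e

theorem A_decomp (X Y : VField n M) (b : M → ℝ) :
    (fun x => A x (D.minusSec X x + D.plusSec Y b x)) = fun x =>
      D.minusSec (fun x => D.Jm x (X x)) x +
      D.plusSec (fun x => D.Jp x (Y x) + b x • D.Xm x) (fun x => - D.g x (Y x) (D.Xm x)) x := by
  funext x
  rw [map_add]
  exact congrArg₂ (· + ·) (h.A_minus x _) (h.A_plus x _ _)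

theorem smooth_A : SmoothEEnd A := by
  intro u hu
  obtain ⟨X, Y, b, hX, hY, hb, rfl⟩ := h.smooth_decomp hu
  rw [h.A_decomp]
  have hg := h.hermitian.metric
  exact (hg.smooth_minusSec (h.smooth_Jm X hX)).add (hg.smooth_plusSec
    ((h.smooth_Jp Y hY).add (h.smooth_Xm.smul hb)) (hg.smooth.apply₂ hY h.smooth_Xm).neg)

theorem isGenAlmostComplex : IsGenAlmostComplex A := by
  have key (x : M) := almostComplex_of_skew_and_sq (B := pairing x) (A := A x) (n := n)
    (finrank_EFib x) (pairing_comm x) (pairing_nondegenerate x) (h.A_unit x)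
    (h.pairing_unit_unit x) (h.A_sq x) (h.A_skew x)
  exact ⟨h.smooth_A, fun x => (key x).1, fun x => isotropic_eigenspace_iff.2 (key x).2.1,
    fun x u hu => (key x).2.2 u (orthogonal_eigenspaces_iff.1 hu)⟩

theorem isGenAlmostComplex_comp : IsGenAlmostComplex (fun x => G x ∘ₗ A x) := by
  have key (x : M) := almostComplex_of_skew_and_sq (B := pairing x) (A := G x ∘ₗ A x) (n := n)
    (u₀ := D.unit x) (finrank_EFib x) (pairing_comm x) (pairing_nondegenerate x)
    (by rw [LinearMap.comp_apply, h.A_unit, map_zero])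
    (h.pairing_unit_unit x)
    (fun v => by
      rw [LinearMap.comp_apply, LinearMap.comp_apply, h.G_A x v, h.G_A, h.G_A,
        h.G_sq, h.A_sq])
    (fun v w => by
      rw [LinearMap.comp_apply, LinearMap.comp_apply, h.G_symm, h.A_skew, h.G_A])
  exact ⟨fun u hu => h.smooth_G _ (h.smooth_A u hu), fun x => (key x).1,
    fun x => isotropic_eigenspace_iff.2 (key x).2.1,
    fun x u hu => (key x).2.2 u (orthogonal_eigenspaces_iff.1 hu)⟩

end Data.IsModel

end
end BnGen

namespace BnGen
section
variable {n : ℕ} {M : Type*} [TopologicalSpace M] [ChartedSpace (EuclideanSpace ℝ (Fin n)) M]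
variable [IsManifold (𝓡 n) ∞ M] {D : Data n M} {G A : EEnd n M} {H : FormField n M 3}

/-! ### Further properties of `tri` -/

section

variable {u v w : ESec n M}

theorem SmoothESec.neg (hu : SmoothESec u) : SmoothESec (fun x => - u x) :=
  ⟨hu.1.neg, hu.2.1.neg, hu.2.2.neg⟩

theorem tri_neg_left (hu : SmoothESec u) (hv : SmoothESec v) (hw : SmoothESec w) (x : M) :
    tri H (fun y => - u y) v x (w x) = - tri H u v x (w x) := by
  have h1 := tri_add_left (H := H) hu hu.neg hv hw x
  -- Additivity for `0 + 0` shows that the zero section contributes zero.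
  have h2 := tri_add_left (H := H) (hu.add hu.neg) (hu.add hu.neg) hv hw x
  simp only [add_neg_cancel, add_zero] at h1 h2
  linarith

theorem tri_neg_mid (hu : SmoothESec u) (hv : SmoothESec v) (hw : SmoothESec w) (x : M) :
    tri H u (fun y => - v y) x (w x) = - tri H u v x (w x) := by
  have h1 := tri_add_mid (H := H) hu hv hv.neg hw x
  have h2 := tri_add_mid (H := H) hu (hv.add hv.neg) (hv.add hv.neg) hw x
  simp only [add_neg_cancel, add_zero] at h1 h2
  linarith

theorem tri_antisymm_right (hu : SmoothESec u) (hv : SmoothESec v) (hw : SmoothESec w) (x : M)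
    (h : ∀ y, pairing y (v y) (w y) = 0) : tri H u v x (w x) = - tri H u w x (v x) := by
  have := tri_swap_right (H := H) hu hv hw x
  simp only [h, dFun_const, zero_apply] at this
  linarith

theorem tri_antisymm_left (hu : SmoothESec u) (hv : SmoothESec v) (hw : SmoothESec w) (x : M)
    (h : ∀ y, pairing y (u y) (v y) = 0) : tri H u v x (w x) = - tri H v u x (w x) := by
  have := tri_swap_left (H := H) hu hv hw x
  simp only [h, dFun_const, zero_apply] at this
  linarith

/-- Used to bring triples of type `(+,+,-)` and `(-,-,+)` to the forms `(-,+,+)` and `(+,-,-)`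
occurring in `Data.IsCompatible`. -/
theorem tri_rotate (hu : SmoothESec u) (hv : SmoothESec v) (hw : SmoothESec w) (x : M)
    (h : ∀ y, pairing y (u y) (w y) = 0) (h' : ∀ y, pairing y (v y) (w y) = 0) :
    tri H u v x (w x) = tri H w u x (v x) := by
  rw [tri_antisymm_right hu hv hw x h', tri_antisymm_left hu hw hv x h, neg_neg]

end

/-! ### Smooth sections of `E_+` and `E_-` -/

/-- Smooth sections of `E_+`. -/
def Data.IsPlus (D : Data n M) (v : ESec n M) : Prop :=
  ∃ Y b, SmoothVField Y ∧ SmoothFun (n := n) b ∧ v = D.plusSec Y b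

/-- Smooth sections of `E_-`. -/
def Data.IsMinus (D : Data n M) (v : ESec n M) : Prop :=
  ∃ X, SmoothVField X ∧ v = D.minusSec X

/-- The section of `E_-` with the same anchor as `v`. -/
noncomputable def Data.toMinus (D : Data n M) (v : ESec n M) : ESec n M :=
  D.minusSec (fun y => (v y).1)

/-- The section of `TM` inside `E_+` with the same anchor as `v`. -/
noncomputable def Data.toPlus (D : Data n M) (v : ESec n M) : ESec n M :=
  D.plusSec (fun y => (v y).1) (fun _ => 0)

theorem Data.isMinus_toMinus (D : Data n M) {v : ESec n M} (hv : SmoothESec v) :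
    D.IsMinus (D.toMinus v) :=
  ⟨_, hv.1, rfl⟩

theorem Data.isPlus_toPlus (D : Data n M) {v : ESec n M} (hv : SmoothESec v) :
    D.IsPlus (D.toPlus v) :=
  ⟨_, _, hv.1, smoothFun_const 0, rfl⟩

theorem Data.IsPlus.smul {f : M → ℝ} {v : ESec n M} (hv : D.IsPlus v) (hf : SmoothFun (n := n) f) :
    D.IsPlus (fun y => f y • v y) := by
  obtain ⟨Y, b, hY, hb, rfl⟩ := hv
  exact ⟨fun y => f y • Y y, fun y => f y * b y, hY.smul hf, hf.mul hb,
    funext fun y => (D.plus_smul y _ _ _).symm⟩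

theorem Data.IsPlus.neg {v : ESec n M} (hv : D.IsPlus v) : D.IsPlus (fun y => - v y) := by
  have e : (fun y => - v y) = fun y => (-1 : ℝ) • v y :=
    funext fun y => (neg_one_smul ℝ (v y)).symm
  rw [e]
  exact hv.smul (smoothFun_const (-1))

theorem Data.exists_isPlus [T2Space M] (D : Data n M) (x : M) (Y : TangentSpace (𝓡 n) x) (b : ℝ) :
    ∃ v, D.IsPlus v ∧ v x = D.plus x Y b := by
  obtain ⟨Y', hY', e⟩ := exists_smoothVField x Y
  exact ⟨D.plusSec Y' fun _ => b, ⟨_, _, hY', smoothFun_const b, rfl⟩, by rw [plusSec, e]⟩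

theorem Data.exists_isMinus [T2Space M] (D : Data n M) (x : M) (Y : TangentSpace (𝓡 n) x) :
    ∃ v, D.IsMinus v ∧ v x = D.minus x Y := by
  obtain ⟨Y', hY', e⟩ := exists_smoothVField x Y
  exact ⟨D.minusSec Y', ⟨_, hY', rfl⟩, by rw [minusSec, e]⟩

namespace Data.IsModel

variable (h : D.IsModel G A)
include h

theorem smooth_of_isPlus {v : ESec n M} (hv : D.IsPlus v) : SmoothESec v := by
  obtain ⟨Y, b, hY, hb, rfl⟩ := hv
  exact h.hermitian.metric.smooth_plusSec hY hb

theorem smooth_of_isMinus {v : ESec n M} (hv : D.IsMinus v) : SmoothESec v := by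
  obtain ⟨Y, hY, rfl⟩ := hv
  exact h.hermitian.metric.smooth_minusSec hY

theorem isPlus_A {v : ESec n M} (hv : D.IsPlus v) : D.IsPlus (fun y => A y (v y)) := by
  obtain ⟨Y, b, hY, hb, rfl⟩ := hv
  exact ⟨_, _, (h.smooth_Jp Y hY).add (h.smooth_Xm.smul hb),
    (h.hermitian.metric.smooth.apply₂ hY h.smooth_Xm).neg, funext fun y => h.A_plus y _ _⟩

theorem isMinus_A {v : ESec n M} (hv : D.IsMinus v) : D.IsMinus (fun y => A y (v y)) := by
  obtain ⟨Y, hY, rfl⟩ := hv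
  exact ⟨_, h.smooth_Jm Y hY, funext fun y => h.A_minus y _⟩

theorem isPlus_unit : D.IsPlus D.unit := ⟨_, _, h.smooth_Xp, h.smooth_c, rfl⟩

theorem pairing_isMinus_isPlus {s v : ESec n M} (hs : D.IsMinus s) (hv : D.IsPlus v) (x : M) :
    pairing x (s x) (v x) = 0 := by
  obtain ⟨X, hX, rfl⟩ := hs
  obtain ⟨Y, b, hY, hb, rfl⟩ := hv
  exact pairing_minus_plus D x (h.hermitian.metric.symm x) _ _ _

theorem pairing_isPlus_isMinus {s v : ESec n M} (hs : D.IsMinus s) (hv : D.IsPlus v) (x : M) :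
    pairing x (v x) (s x) = 0 := by
  rw [pairing_comm, h.pairing_isMinus_isPlus hs hv]

theorem pairing_A_unit (x : M) (u : EFib n x) : pairing x (A x u) (D.unit x) = 0 := by
  rw [h.A_skew, h.A_unit, map_zero, neg_zero]

theorem A_sq_of_isMinus {s : ESec n M} (hs : D.IsMinus s) (x : M) : A x (A x (s x)) = - s x := by
  rw [h.A_sq, h.pairing_isMinus_isPlus hs h.isPlus_unit, zero_smul, add_zero]

theorem A_sq_of_orthogonal {x : M} {u : EFib n x} (hu : pairing x u (D.unit x) = 0) :
    A x (A x u) = - u := by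
  rw [h.A_sq, hu, zero_smul, add_zero]

theorem tri_isPlus {u v w : ESec n M} (hu : D.IsPlus u) (hv : D.IsPlus v) (hw : D.IsPlus w)
    (x : M) : tri H u v x (w x) = tri H (D.toMinus w) u x (v x) + tri H (D.toMinus u) v x (w x)
      - tri H (D.toMinus v) u x (w x) + three H x (u x).1 (v x).1 (w x).1 := by
  obtain ⟨X, a, hX, ha, rfl⟩ := hu
  obtain ⟨Y, b, hY, hb, rfl⟩ := hv
  obtain ⟨Z, k, hZ, hk, rfl⟩ := hw
  exact tri_plus_plus_plus h.hermitian.metric hX hY hZ ha hb hk x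

theorem tri_isMinus {u v w : ESec n M} (hu : D.IsMinus u) (hv : D.IsMinus v) (hw : D.IsMinus w)
    (x : M) : tri H u v x (w x) = tri H (D.toPlus w) u x (v x) + tri H (D.toPlus u) v x (w x)
      - tri H (D.toPlus v) u x (w x) + three H x (u x).1 (v x).1 (w x).1 := by
  obtain ⟨X, hX, rfl⟩ := hu
  obtain ⟨Y, hY, rfl⟩ := hv
  obtain ⟨Z, hZ, rfl⟩ := hw
  exact tri_minus_minus_minus h.hermitian.metric hX hY hZ x _ _ _ (smoothFun_const 0)
    (smoothFun_const 0) (smoothFun_const 0)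

end Data.IsModel

/-! ### Integrability in real terms -/

/-- The Nijenhuis-type expression of a field of endomorphisms `A` of `E`. -/
noncomputable def nijenhuis (H : FormField n M 3) (A : EEnd n M) (u v : ESec n M) (x : M)
    (w : EFib n x) : ℝ :=
  tri H u v x (A x w) - tri H (fun y => A y (u y)) (fun y => A y (v y)) x (A x w)
    + tri H (fun y => A y (u y)) v x w + tri H u (fun y => A y (v y)) x w

omit [IsManifold (𝓡 n) ∞ M] in
theorem nijenhuis_eq (hskew : ∀ x u v, pairing x (A x u) v = - pairing x u (A x v))
    (u v : ESec n M) (x : M) (w : EFib n x) :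
    nijenhuis H A u v x w =
      pairing x (A x (dorfman H 0 (fun y => A y (u y)) (fun y => A y (v y)) x - dorfman H 0 u v x)
        + (dorfman H 0 (fun y => A y (u y)) v x + dorfman H 0 u (fun y => A y (v y)) x)) w := by
  simp only [nijenhuis, tri, map_add, map_sub, LinearMap.add_apply, LinearMap.sub_apply, hskew]
  ring

/-- The sections `A u + i u` and `A v + i v` lie in `L`, and one of the two real equations saying
that their bracket lies in `L` is the vanishing of this expression. -/
theorem IsIntegrable.nijenhuis_eq_zero (hI : IsIntegrable H 0 A) (hA : SmoothEEnd A)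
    (hskew : ∀ x u v, pairing x (A x u) v = - pairing x u (A x v)) {u v : ESec n M}
    (hu : SmoothESec u) (hv : SmoothESec v) (hu' : ∀ x, A x (A x (u x)) = - u x)
    (hv' : ∀ x, A x (A x (v x)) = - v x) (x : M) (w : EFib n x) : nijenhuis H A u v x w = 0 := by
  have := hI _ u _ v (hA u hu) hu (hA v hv) hv (fun x => mem_eigenspace_I.2 ⟨hu' x, rfl⟩)
    (fun x => mem_eigenspace_I.2 ⟨hv' x, rfl⟩) x
  rw [nijenhuis_eq hskew, (mem_eigenspace_I.1 this).1, neg_add_cancel]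
  simp

/-- Membership of the bracket in `L` consists of two real equations. The first is the Nijenhuis
identity for `(v, v')`, the second the one for `(v, A v')`. Testing on extended sections `w'` is
needed because sign rules for `tri` are proved for smooth sections. -/
theorem isIntegrable_of_nijenhuis (hA : SmoothEEnd A)
    (hskew : ∀ x u v, pairing x (A x u) v = - pairing x u (A x v))
    (hext : ∀ x (w : EFib n x), ∃ w' : ESec n M, SmoothESec w' ∧ w' x = w)
    (hN : ∀ u v : ESec n M, SmoothESec u → SmoothESec v → (∀ x, A x (A x (u x)) = - u x) →
      (∀ x, A x (A x (v x)) = - v x) → ∀ x w, nijenhuis H A u v x w = 0) :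
    IsIntegrable H 0 A := by
  intro u v u' v' hu hv hu' hv' hm hm' x
  have h1 (y : M) := mem_eigenspace_I.1 (hm y)
  have h2 (y : M) := mem_eigenspace_I.1 (hm' y)
  have e1 : (fun y => A y (v y)) = u := funext fun y => (h1 y).2
  have e2 : (fun y => A y (v' y)) = u' := funext fun y => (h2 y).2
  have e3 : (fun y => A y (u' y)) = fun y => - v' y := funext fun y => (h2 y).1
  have hv2 (y : M) : A y (A y (v y)) = - v y := by rw [(h1 y).2, (h1 y).1]
  have hv2' (y : M) : A y (A y (v' y)) = - v' y := by rw [(h2 y).2, (h2 y).1]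
  have hu2' (y : M) : A y (A y (u' y)) = - u' y := by rw [(h2 y).1, map_neg, (h2 y).2]
  refine mem_eigenspace_I.2 ⟨?_, ?_⟩
  · have h3 (w : EFib n x) := hN v v' hv hv' hv2 hv2' x w
    simp only [nijenhuis_eq hskew, e1, e2] at h3
    rw [add_comm (dorfman H 0 u v' x)] at *
    have := pairing_nondegenerate x _ h3
    rw [eq_neg_iff_add_eq_zero, ← this, add_comm (dorfman H 0 v u' x)]
  · rw [← sub_eq_zero]
    refine pairing_nondegenerate x _ fun w => ?_
    obtain ⟨w', hw', rfl⟩ := hext x w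
    have h3 := hN v u' hv hu' hv2 hu2' x (w' x)
    simp only [nijenhuis, e1, e3] at h3
    have h4 := tri_neg_mid (H := H) hu hv' (hA _ hw') x
    have h5 := tri_neg_mid (H := H) hv hv' hw' x
    simp only [map_add, map_sub, LinearMap.add_apply, LinearMap.sub_apply, hskew]
    simp only [tri] at h3 h4 h5
    linarith

end
end BnGen

namespace BnGen
section
variable {n : ℕ} {M : Type*} [TopologicalSpace M] [ChartedSpace (EuclideanSpace ℝ (Fin n)) M]
variable {D : Data n M} {G A B : EEnd n M} {H : FormField n M 3} {τ : ℝ}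

/-! ### Integrability of a pair `(𝒢, ℱ)` -/

theorem EFib.neg_one_smul {x : M} (u : EFib n x) : (-1 : ℝ) • u = - u :=
  _root_.neg_one_smul ℝ u

/-- `B` agrees with `A` on `E_+` and with `τ A` on `E_-`, where `τ` is a sign. -/
structure Data.AgreesUpToSign (D : Data n M) (A B : EEnd n M) (τ : ℝ) : Prop where
  sign : τ = 1 ∨ τ = -1
  plus : ∀ x Y b, B x (D.plus x Y b) = A x (D.plus x Y b)
  minus : ∀ x X, B x (D.minus x X) = τ • A x (D.minus x X)

variable [IsManifold (𝓡 n) ∞ M]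

/-- The equations for `(D, H, A)` which are equivalent to the integrability of `ℱ` and `𝒢ℱ`. -/
structure Data.IsCompatible (D : Data n M) (H : FormField n M 3) (A : EEnd n M) : Prop where
  minus_plus : ∀ s v w : ESec n M, D.IsMinus s → D.IsPlus v → D.IsPlus w → ∀ x,
    tri H s (fun y => A y (v y)) x (w x) + tri H s v x (A x (w x)) = 0
  plus_minus : ∀ v s s' : ESec n M, D.IsPlus v → D.IsMinus s → D.IsMinus s' → ∀ x,
    tri H v (fun y => A y (s y)) x (s' x) + tri H v s x (A x (s' x)) = 0
  three_plus : ∀ (x : M) (Y Y' Z : TangentSpace (𝓡 n) x) (a b k : ℝ),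
    D.g x Y (D.Xp x) + a * D.c x = 0 → D.g x Y' (D.Xp x) + b * D.c x = 0 →
    three H x Y Y' (D.Jp x Z + k • D.Xm x)
      - three H x (D.Jp x Y + a • D.Xm x) (D.Jp x Y' + b • D.Xm x) (D.Jp x Z + k • D.Xm x)
      + three H x Y (D.Jp x Y' + b • D.Xm x) Z + three H x (D.Jp x Y + a • D.Xm x) Y' Z = 0
  three_minus : ∀ (x : M) (X Y Z : TangentSpace (𝓡 n) x),
    three H x X Y (D.Jm x Z) - three H x (D.Jm x X) (D.Jm x Y) (D.Jm x Z)
      + three H x X (D.Jm x Y) Z + three H x (D.Jm x X) Y Z = 0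

namespace Data.AgreesUpToSign

variable (hB : D.AgreesUpToSign A B τ)
include hB

omit [IsManifold (𝓡 n) ∞ M] in
theorem mul_self : τ * τ = 1 := by
  rcases hB.sign with rfl | rfl <;> norm_num

theorem apply_isPlus {v : ESec n M} (hv : D.IsPlus v) :
    (fun y => B y (v y)) = fun y => A y (v y) := by
  obtain ⟨Y, b, _, _, rfl⟩ := hv
  exact funext fun y => hB.plus y _ _

theorem apply_isMinus {v : ESec n M} (hv : D.IsMinus v) :
    (fun y => B y (v y)) = fun y => τ • A y (v y) := by
  obtain ⟨X, _, rfl⟩ := hv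
  exact funext fun y => hB.minus y _

variable {u v w : ESec n M}

theorem tri_left (hu : SmoothESec u) (hv : SmoothESec v) (hw : SmoothESec w) (x : M) :
    tri H (fun y => τ • u y) v x (w x) = τ * tri H u v x (w x) := by
  rcases hB.sign with rfl | rfl
  · simp only [one_smul, one_mul]
  · simp only [EFib.neg_one_smul, tri_neg_left hu hv hw, neg_one_mul]

theorem tri_mid (hu : SmoothESec u) (hv : SmoothESec v) (hw : SmoothESec w) (x : M) :
    tri H u (fun y => τ • v y) x (w x) = τ * tri H u v x (w x) := by
  rcases hB.sign with rfl | rfl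
  · simp only [one_smul, one_mul]
  · simp only [EFib.neg_one_smul, tri_neg_mid hu hv hw, neg_one_mul]

variable (h : D.IsModel G A) {s s' s'' v v' w : ESec n M}
include h

omit hB in
theorem smooth_sign (τ : ℝ) (hs : D.IsMinus s) : SmoothESec (fun y => τ • A y (s y)) :=
  (h.smooth_of_isMinus (h.isMinus_A hs)).smul (smoothFun_const τ)

/-- Only terms in which `B` hits the `E_-` argument carry `τ`. Applied with `τ = 1` (`ℱ`) and `τ =
-1` (`𝒢ℱ`), the formula separates the two groups. -/
theorem nijenhuis_minus_plus_plus (hs : D.IsMinus s) (hv : D.IsPlus v) (hw : D.IsPlus w) (x : M) :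
    nijenhuis H B s v x (w x) =
      tri H s (fun y => A y (v y)) x (w x) + tri H s v x (A x (w x))
      + τ * (tri H (fun y => A y (s y)) v x (w x)
        - tri H (fun y => A y (s y)) (fun y => A y (v y)) x (A x (w x))) := by
  have e : B x (w x) = A x (w x) := congrFun (hB.apply_isPlus hw) x
  have hs' := h.smooth_of_isMinus (h.isMinus_A hs)
  have hv' := h.smooth_of_isPlus (h.isPlus_A hv)
  have hw' := h.smooth_of_isPlus (h.isPlus_A hw)
  have h1 := hB.tri_left (H := H) hs' hv' hw' x
  have h2 := hB.tri_left (H := H) hs' (h.smooth_of_isPlus hv) (h.smooth_of_isPlus hw) x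
  rw [nijenhuis, hB.apply_isPlus hv, hB.apply_isMinus hs, e, h1, h2]
  ring

theorem nijenhuis_minus_minus_plus (hs : D.IsMinus s) (hs' : D.IsMinus s') (hv : D.IsPlus v)
    (x : M) : nijenhuis H B s s' x (v x) =
      tri H s s' x (A x (v x))
      - tri H (fun y => A y (s y)) (fun y => A y (s' y)) x (A x (v x))
      + τ * (tri H (fun y => A y (s y)) s' x (v x) + tri H s (fun y => A y (s' y)) x (v x)) := by
  have e : B x (v x) = A x (v x) := congrFun (hB.apply_isPlus hv) x
  have a1 := h.smooth_of_isMinus (h.isMinus_A hs)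
  have a2 := h.smooth_of_isMinus (h.isMinus_A hs')
  have a3 := h.smooth_of_isPlus (h.isPlus_A hv)
  have a4 := h.smooth_of_isPlus hv
  have h1 := hB.tri_left (H := H) a1 (smooth_sign h τ hs') a3 x
  have h2 := hB.tri_mid (H := H) a1 a2 a3 x
  have h3 := hB.tri_left (H := H) a1 (h.smooth_of_isMinus hs') a4 x
  have h4 := hB.tri_mid (H := H) (h.smooth_of_isMinus hs) a2 a4 x
  rw [nijenhuis, hB.apply_isMinus hs, hB.apply_isMinus hs', e, h1, h2, h3, h4]
  linear_combination
    (- tri H (fun y => A y (s y)) (fun y => A y (s' y)) x (A x (v x))) * hB.mul_self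

omit h in
theorem nijenhuis_plus_plus_minus (hv : D.IsPlus v) (hv' : D.IsPlus v') (hs : D.IsMinus s)
    (x : M) : nijenhuis H B v v' x (s x) =
      τ * (tri H v v' x (A x (s x))
      - tri H (fun y => A y (v y)) (fun y => A y (v' y)) x (A x (s x)))
      + tri H (fun y => A y (v y)) v' x (s x) + tri H v (fun y => A y (v' y)) x (s x) := by
  have e : B x (s x) = τ • A x (s x) := congrFun (hB.apply_isMinus hs) x
  rw [nijenhuis, hB.apply_isPlus hv, hB.apply_isPlus hv', e, tri_smul, tri_smul]
  ring

/-- Where `B` hits both `E_-` arguments the factor is `τ² = 1`, so that term joins the sign-free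
group. -/
theorem nijenhuis_minus_plus_minus (hs : D.IsMinus s) (hv : D.IsPlus v) (hs' : D.IsMinus s')
    (x : M) : nijenhuis H B s v x (s' x) =
      τ * (tri H s v x (A x (s' x)) + tri H (fun y => A y (s y)) v x (s' x))
      - tri H (fun y => A y (s y)) (fun y => A y (v y)) x (A x (s' x))
      + tri H s (fun y => A y (v y)) x (s' x) := by
  have e : B x (s' x) = τ • A x (s' x) := congrFun (hB.apply_isMinus hs') x
  have a1 := h.smooth_of_isMinus (h.isMinus_A hs)
  have h1 := hB.tri_left (H := H) a1 (h.smooth_of_isPlus (h.isPlus_A hv))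
    (h.smooth_of_isMinus (h.isMinus_A hs')) x
  have h2 := hB.tri_left (H := H) a1 (h.smooth_of_isPlus hv) (h.smooth_of_isMinus hs') x
  rw [nijenhuis, hB.apply_isMinus hs, hB.apply_isPlus hv, e, tri_smul, tri_smul, h1, h2]
  linear_combination
    (- tri H (fun y => A y (s y)) (fun y => A y (v y)) x (A x (s' x))) * hB.mul_self

theorem nijenhuis_minus_minus_minus (hs : D.IsMinus s) (hs' : D.IsMinus s') (hs'' : D.IsMinus s'')
    (x : M) : nijenhuis H B s s' x (s'' x) = τ * nijenhuis H A s s' x (s'' x) := by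
  have e : B x (s'' x) = τ • A x (s'' x) := congrFun (hB.apply_isMinus hs'') x
  have a1 := h.smooth_of_isMinus (h.isMinus_A hs)
  have a2 := h.smooth_of_isMinus (h.isMinus_A hs')
  have a3 := h.smooth_of_isMinus (h.isMinus_A hs'')
  have h1 := hB.tri_left (H := H) a1 (smooth_sign h τ hs') a3 x
  have h2 := hB.tri_mid (H := H) a1 a2 a3 x
  have h3 := hB.tri_left (H := H) a1 (h.smooth_of_isMinus hs') (h.smooth_of_isMinus hs'') x
  have h4 := hB.tri_mid (H := H) (h.smooth_of_isMinus hs) a2 (h.smooth_of_isMinus hs'') x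
  rw [nijenhuis, nijenhuis, hB.apply_isMinus hs, hB.apply_isMinus hs', e, tri_smul, tri_smul, h1,
    h2, h3, h4]
  linear_combination
    (- τ * tri H (fun y => A y (s y)) (fun y => A y (s' y)) x (A x (s'' x))) * hB.mul_self

omit h in
theorem nijenhuis_plus_plus_plus (hv : D.IsPlus v) (hv' : D.IsPlus v') (hw : D.IsPlus w)
    (x : M) : nijenhuis H B v v' x (w x) = nijenhuis H A v v' x (w x) := by
  have e : B x (w x) = A x (w x) := congrFun (hB.apply_isPlus hw) x
  rw [nijenhuis, nijenhuis, hB.apply_isPlus hv, hB.apply_isPlus hv', e]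

end Data.AgreesUpToSign

omit [IsManifold (𝓡 n) ∞ M] in
theorem Data.agreesUpToSign_self (D : Data n M) (A : EEnd n M) : D.AgreesUpToSign A A 1 :=
  ⟨Or.inl rfl, fun _ _ _ => rfl, fun _ _ => (one_smul _ _).symm⟩

namespace Data.IsModel

variable (h : D.IsModel G A)
include h

theorem agreesUpToSign_comp : D.AgreesUpToSign A (fun x => G x ∘ₗ A x) (-1) where
  sign := Or.inr rfl
  plus x Y b := by rw [LinearMap.comp_apply, h.A_plus, h.G_plus]
  minus x X := by rw [LinearMap.comp_apply, h.A_minus, h.G_minus, EFib.neg_one_smul]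

theorem A_skew_comp (x : M) (u v : EFib n x) :
    pairing x ((G x ∘ₗ A x) u) v = - pairing x u ((G x ∘ₗ A x) v) := by
  rw [LinearMap.comp_apply, LinearMap.comp_apply, h.G_symm, h.A_skew, h.G_A]

theorem A_sq_comp (x : M) (u : EFib n x) :
    (G x ∘ₗ A x) ((G x ∘ₗ A x) u) = A x (A x u) := by
  rw [LinearMap.comp_apply, LinearMap.comp_apply, ← h.G_A, h.G_sq]

theorem smooth_comp : SmoothEEnd (fun x => G x ∘ₗ A x) := fun u hu => h.smooth_G _ (h.smooth_A u hu)

/-- The condition `minus_plus` for a section orthogonal to the kernel of `A`. -/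
theorem tri_A_A {s v w : ESec n M} (hs : D.IsMinus s) (hv : D.IsPlus v) (hw : D.IsPlus w) (x : M)
    (hP : tri H s (fun y => A y (A y (v y))) x (w x)
      + tri H s (fun y => A y (v y)) x (A x (w x)) = 0)
    (hu : ∀ y, pairing y (v y) (D.unit y) = 0) :
    tri H s (fun y => A y (v y)) x (A x (w x)) = tri H s v x (w x) := by
  have e : (fun y => A y (A y (v y))) = fun y => - v y :=
    funext fun y => h.A_sq_of_orthogonal (hu y)
  rw [e, tri_neg_mid (h.smooth_of_isMinus hs) (h.smooth_of_isPlus hv) (h.smooth_of_isPlus hw)] at hP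
  linarith

theorem tri_A_A_minus {v s s' : ESec n M} (hv : D.IsPlus v) (hs : D.IsMinus s) (hs' : D.IsMinus s')
    (x : M)
    (hM : tri H v (fun y => A y (A y (s y))) x (s' x)
      + tri H v (fun y => A y (s y)) x (A x (s' x)) = 0) :
    tri H v (fun y => A y (s y)) x (A x (s' x)) = tri H v s x (s' x) := by
  have e : (fun y => A y (A y (s y))) = fun y => - s y :=
    funext fun y => h.A_sq_of_isMinus hs y
  rw [e, tri_neg_mid (h.smooth_of_isPlus hv) (h.smooth_of_isMinus hs) (h.smooth_of_isMinus hs')]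
    at hM
  linarith

/-- On sections of `E_+`, the Nijenhuis expression of `A` only involves `H`. -/
theorem nijenhuis_isPlus (hP : ∀ s v w : ESec n M, D.IsMinus s → D.IsPlus v → D.IsPlus w → ∀ x,
    tri H s (fun y => A y (v y)) x (w x) + tri H s v x (A x (w x)) = 0)
    {v v' w : ESec n M} (hv : D.IsPlus v) (hv' : D.IsPlus v') (hw : D.IsPlus w)
    (hu : ∀ y, pairing y (v y) (D.unit y) = 0) (hu' : ∀ y, pairing y (v' y) (D.unit y) = 0)
    (x : M) : nijenhuis H A v v' x (w x) =
      three H x (v x).1 (v' x).1 (A x (w x)).1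
      - three H x (A x (v x)).1 (A x (v' x)).1 (A x (w x)).1
      + three H x (v x).1 (A x (v' x)).1 (w x).1 + three H x (A x (v x)).1 (v' x).1 (w x).1 := by
  have av := h.isPlus_A hv
  have av' := h.isPlus_A hv'
  have aw := h.isPlus_A hw
  have m (z : ESec n M) (hz : D.IsPlus z) : D.IsMinus (D.toMinus z) :=
    D.isMinus_toMinus (h.smooth_of_isPlus hz)
  have key {z p q : ESec n M} (hz : D.IsPlus z) (hp : D.IsPlus p) (hq : D.IsPlus q)
      (hpu : ∀ y, pairing y (p y) (D.unit y) = 0) := h.tri_A_A (m z hz) hp hq x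
      (hP _ _ _ (m z hz) (h.isPlus_A hp) hq x) hpu
  have t1 := h.tri_isPlus (H := H) hv hv' aw x
  have t2 := h.tri_isPlus (H := H) av av' aw x
  have t3 := h.tri_isPlus (H := H) hv av' hw x
  have t4 := h.tri_isPlus (H := H) av hv' hw x
  rw [nijenhuis, t1, t2, t3, t4]
  -- The mixed triples are grouped by the section moved to `E_-`. If it carries an `A`, its two
  -- triples cancel by the `A`-invariance in `key`; if not, they cancel by the commutation rule
  -- `hP`.
  linarith [key aw hv hv' hu, key av hv' hw hu', key av' hv hw hu, hP _ _ _ (m v hv) hv' hw x,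
    hP _ _ _ (m v' hv') hv hw x, hP _ _ _ (m w hw) hv hv' x]

/-- On sections of `E_-`, the Nijenhuis expression of `A` only involves `H`. -/
theorem nijenhuis_isMinus (hM : ∀ v s s' : ESec n M, D.IsPlus v → D.IsMinus s → D.IsMinus s' → ∀ x,
    tri H v (fun y => A y (s y)) x (s' x) + tri H v s x (A x (s' x)) = 0)
    {s s' r : ESec n M} (hs : D.IsMinus s) (hs' : D.IsMinus s') (hr : D.IsMinus r)
    (x : M) : nijenhuis H A s s' x (r x) =
      three H x (s x).1 (s' x).1 (A x (r x)).1
      - three H x (A x (s x)).1 (A x (s' x)).1 (A x (r x)).1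
      + three H x (s x).1 (A x (s' x)).1 (r x).1 + three H x (A x (s x)).1 (s' x).1 (r x).1 := by
  have as := h.isMinus_A hs
  have as' := h.isMinus_A hs'
  have ar := h.isMinus_A hr
  have m (z : ESec n M) (hz : D.IsMinus z) : D.IsPlus (D.toPlus z) :=
    D.isPlus_toPlus (h.smooth_of_isMinus hz)
  have key {z p q : ESec n M} (hz : D.IsMinus z) (hp : D.IsMinus p) (hq : D.IsMinus q) :=
    h.tri_A_A_minus (m z hz) hp hq x (hM _ _ _ (m z hz) (h.isMinus_A hp) hq x)
  have t1 := h.tri_isMinus (H := H) hs hs' ar x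
  have t2 := h.tri_isMinus (H := H) as as' ar x
  have t3 := h.tri_isMinus (H := H) hs as' hr x
  have t4 := h.tri_isMinus (H := H) as hs' hr x
  rw [nijenhuis, t1, t2, t3, t4]
  linarith [key ar hs hs', key as hs' hr, key as' hs hr, hM _ _ _ (m s hs) hs' hr x,
    hM _ _ _ (m s' hs') hs hr x, hM _ _ _ (m r hr) hs hs' x]

end Data.IsModel

end
end BnGen

/-! ### Integrability implies compatibility. -/

namespace BnGen
section
variable {n : ℕ} {M : Type*} [TopologicalSpace M] [ChartedSpace (EuclideanSpace ℝ (Fin n)) M]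
variable [IsManifold (𝓡 n) ∞ M] {D : Data n M} {G A B : EEnd n M} {H : FormField n M 3} {τ : ℝ}

theorem nijenhuis_swap {u v w : ESec n M} (hu : SmoothESec u) (hv : SmoothESec v)
    (hu' : SmoothESec fun y => B y (u y)) (hv' : SmoothESec fun y => B y (v y))
    (hw : SmoothESec w) (hw' : SmoothESec fun y => B y (w y)) (x : M)
    (h1 : ∀ y, pairing y (u y) (v y) = 0) (h2 : ∀ y, pairing y (B y (u y)) (v y) = 0)
    (h3 : ∀ y, pairing y (u y) (B y (v y)) = 0)
    (h4 : ∀ y, pairing y (B y (u y)) (B y (v y)) = 0) :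
    nijenhuis H B u v x (w x) = - nijenhuis H B v u x (w x) := by
  have t1 := tri_antisymm_left (H := H) hu hv hw' x h1
  have t2 := tri_antisymm_left (H := H) hu' hv hw x h2
  have t3 := tri_antisymm_left (H := H) hu hv' hw x h3
  have t4 := tri_antisymm_left (H := H) hu' hv' hw' x h4
  rw [nijenhuis, nijenhuis, t1, t2, t3, t4]
  ring

theorem nijenhuis_add_left (hB : SmoothEEnd B) {u u' v w : ESec n M} (hu : SmoothESec u)
    (hu' : SmoothESec u') (hv : SmoothESec v) (hw : SmoothESec w) (x : M) :
    nijenhuis H B (fun y => u y + u' y) v x (w x) =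
      nijenhuis H B u v x (w x) + nijenhuis H B u' v x (w x) := by
  simp only [nijenhuis, map_add]
  rw [tri_add_left hu hu' hv (hB w hw), tri_add_left (hB u hu) (hB u' hu') (hB v hv) (hB w hw),
    tri_add_left (hB u hu) (hB u' hu') hv hw, tri_add_left hu hu' (hB v hv) hw]
  ring

theorem nijenhuis_add_mid (hB : SmoothEEnd B) {u v v' w : ESec n M} (hu : SmoothESec u)
    (hv : SmoothESec v) (hv' : SmoothESec v') (hw : SmoothESec w) (x : M) :
    nijenhuis H B u (fun y => v y + v' y) x (w x) =
      nijenhuis H B u v x (w x) + nijenhuis H B u v' x (w x) := by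
  simp only [nijenhuis, map_add]
  rw [tri_add_mid hu hv hv' (hB w hw), tri_add_mid (hB u hu) (hB v hv) (hB v' hv') (hB w hw),
    tri_add_mid (hB u hu) hv hv' hw, tri_add_mid hu (hB v hv) (hB v' hv') hw]
  ring

omit [IsManifold (𝓡 n) ∞ M] in
theorem nijenhuis_add_right (u v : ESec n M) (x : M) (w w' : EFib n x) :
    nijenhuis H B u v x (w + w') = nijenhuis H B u v x w + nijenhuis H B u v x w' := by
  simp only [nijenhuis, map_add, tri_add]
  ring

namespace Data.IsModel

variable (h : D.IsModel G A)
include h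

/-- The unit section is parallel. Taking `A w` and `u` in the commutation rule, where `A u = 0`,
gives `⟨[s, u], A²w⟩ = 0`; constancy of `⟨u, u⟩` gives `⟨[s, u], u⟩ = 0`; and `A²w = -w + ⟨w, u⟩ u`.
-/
theorem tri_unit_of_orthogonal
    (hP : ∀ s v w : ESec n M, D.IsMinus s → D.IsPlus v → D.IsPlus w →
      (∀ y, pairing y (v y) (D.unit y) = 0) → ∀ x,
      tri H s (fun y => A y (v y)) x (w x) + tri H s v x (A x (w x)) = 0)
    {s w : ESec n M} (hs : D.IsMinus s) (hw : D.IsPlus w) (x : M) :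
    tri H s D.unit x (w x) = 0 := by
  have su := h.smooth_of_isPlus h.isPlus_unit
  have ss := h.smooth_of_isMinus hs
  have aw := h.isPlus_A hw
  have h1 : tri H s D.unit x (A x (A x (w x))) = 0 := by
    have := hP s _ D.unit hs aw h.isPlus_unit (fun y => h.pairing_A_unit y _) x
    rw [h.A_unit, tri_zero, add_zero,
      tri_antisymm_right ss (h.smooth_of_isPlus (h.isPlus_A aw)) su x
      fun y => h.pairing_A_unit y _] at this
    linarith
  have h2 : tri H s D.unit x (D.unit x) = 0 := by
    have := tri_swap_right (H := H) ss su su x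
    simp only [h.pairing_unit_unit, dFun_const, zero_apply] at this
    linarith
  rw [h.A_sq, tri_add, tri_smul, h2, tri_neg] at h1
  linarith

/-- Integrability only sees sections orthogonal to the unit. The rule extends to all of `E_+`
because the unit is killed by `A` and parallel, so the component along it contributes nothing. -/
theorem minus_plus_of_orthogonal
    (hP : ∀ s v w : ESec n M, D.IsMinus s → D.IsPlus v → D.IsPlus w →
      (∀ y, pairing y (v y) (D.unit y) = 0) → ∀ x,
      tri H s (fun y => A y (v y)) x (w x) + tri H s v x (A x (w x)) = 0)
    {s v w : ESec n M} (hs : D.IsMinus s) (hv : D.IsPlus v) (hw : D.IsPlus w) (x : M) :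
    tri H s (fun y => A y (v y)) x (w x) + tri H s v x (A x (w x)) = 0 := by
  have ss := h.smooth_of_isMinus hs
  have sv := h.smooth_of_isPlus hv
  have su := h.smooth_of_isPlus h.isPlus_unit
  have aw := h.isPlus_A hw
  have p0 := (h.isPlus_A (h.isPlus_A hv)).neg
  have e0 : (fun y => A y (- A y (A y (v y)))) = fun y => A y (v y) := by
    funext y
    rw [map_neg, h.A_sq, h.pairing_A_unit, zero_smul, add_zero, neg_neg]
  -- The operator `-A²` is the orthogonal projection away from the unit.
  have e1 : v = fun y => - A y (A y (v y)) + pairing y (v y) (D.unit y) • D.unit y := by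
    funext y
    rw [h.A_sq, neg_add, neg_neg, neg_add_cancel_right]
  have hf : SmoothFun (n := n) fun y => pairing y (v y) (D.unit y) := sv.pairing su
  have h1 := hP s _ w hs p0 hw (fun y => by
    rw [map_neg, LinearMap.neg_apply, h.pairing_A_unit, neg_zero]) x
  rw [e0] at h1
  have h2 : tri H s v x (A x (w x)) = tri H s (fun y => - A y (A y (v y))) x (A x (w x)) := by
    have h3 := tri_add_mid (H := H) ss (h.smooth_of_isPlus p0) (su.smul hf)
      (h.smooth_of_isPlus aw) x
    rw [← e1, tri_antisymm_right ss (su.smul hf) (h.smooth_of_isPlus aw) x, tri_smul,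
      tri_antisymm_right ss (h.smooth_of_isPlus aw) su x, h.tri_unit_of_orthogonal hP hs aw] at h3
    · linarith
    · exact fun y => h.pairing_A_unit y _
    · intro y
      rw [map_smul, LinearMap.smul_apply, pairing_comm y (D.unit y) (A y (w y)),
        h.pairing_A_unit, smul_zero]
  rw [h2, h1]

/-- Integrability of `ℱ` and `𝒢ℱ` implies compatibility. -/
theorem isCompatible [T2Space M] (hI : IsIntegrable H 0 A)
    (hI' : IsIntegrable H 0 (fun x => G x ∘ₗ A x)) : D.IsCompatible H A := by
  have hA := D.agreesUpToSign_self A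
  have hB := h.agreesUpToSign_comp
  have N {u v : ESec n M} (hu : SmoothESec u) (hv : SmoothESec v)
      (hu' : ∀ x, A x (A x (u x)) = - u x) (hv' : ∀ x, A x (A x (v x)) = - v x) (x : M)
      (w : EFib n x) : nijenhuis H A u v x w = 0 :=
    hI.nijenhuis_eq_zero h.smooth_A h.A_skew hu hv hu' hv' x w
  have N' {u v : ESec n M} (hu : SmoothESec u) (hv : SmoothESec v)
      (hu' : ∀ x, A x (A x (u x)) = - u x) (hv' : ∀ x, A x (A x (v x)) = - v x) (x : M)
      (w : EFib n x) : nijenhuis H (fun x => G x ∘ₗ A x) u v x w = 0 :=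
    hI'.nijenhuis_eq_zero h.smooth_comp h.A_skew_comp hu hv
      (fun x => (h.A_sq_comp x _).trans (hu' x)) (fun x => (h.A_sq_comp x _).trans (hv' x)) x w
  have hP : ∀ s v w : ESec n M, D.IsMinus s → D.IsPlus v → D.IsPlus w → ∀ x,
      tri H s (fun y => A y (v y)) x (w x) + tri H s v x (A x (w x)) = 0 := by
    intro s v w hs hv hw x
    refine h.minus_plus_of_orthogonal (fun s v w hs hv hw hvu x => ?_) hs hv hw x
    have n1 := N (h.smooth_of_isMinus hs) (h.smooth_of_isPlus hv) (h.A_sq_of_isMinus hs)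
      (fun y => h.A_sq_of_orthogonal (hvu y)) x (w x)
    have n2 := N' (h.smooth_of_isMinus hs) (h.smooth_of_isPlus hv) (h.A_sq_of_isMinus hs)
      (fun y => h.A_sq_of_orthogonal (hvu y)) x (w x)
    -- Adding the identities for `τ = 1` and `τ = -1` isolates the sign-free part.
    rw [hA.nijenhuis_minus_plus_plus h hs hv hw] at n1
    rw [hB.nijenhuis_minus_plus_plus h hs hv hw] at n2
    linarith
  have hM : ∀ v s s' : ESec n M, D.IsPlus v → D.IsMinus s → D.IsMinus s' → ∀ x,
      tri H v (fun y => A y (s y)) x (s' x) + tri H v s x (A x (s' x)) = 0 := by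
    intro v s s' hv hs hs' x
    have n1 := N (h.smooth_of_isMinus hs) (h.smooth_of_isMinus hs') (h.A_sq_of_isMinus hs)
      (h.A_sq_of_isMinus hs') x (v x)
    have n2 := N' (h.smooth_of_isMinus hs) (h.smooth_of_isMinus hs') (h.A_sq_of_isMinus hs)
      (h.A_sq_of_isMinus hs') x (v x)
    rw [hA.nijenhuis_minus_minus_plus h hs hs' hv] at n1
    rw [hB.nijenhuis_minus_minus_plus h hs hs' hv] at n2
    rw [← tri_rotate (h.smooth_of_isMinus (h.isMinus_A hs)) (h.smooth_of_isMinus hs')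
        (h.smooth_of_isPlus hv) x (h.pairing_isMinus_isPlus (h.isMinus_A hs) hv)
        (h.pairing_isMinus_isPlus hs' hv),
      ← tri_rotate (w := v) (u := s) (h.smooth_of_isMinus hs)
        (h.smooth_of_isMinus (h.isMinus_A hs'))
        (h.smooth_of_isPlus hv) x (h.pairing_isMinus_isPlus hs hv)
        (h.pairing_isMinus_isPlus (h.isMinus_A hs') hv)]
    linarith
  refine ⟨hP, hM, fun x Y Y' Z a b k hY hY' => ?_, fun x X Y Z => ?_⟩
  · have ext (Y : TangentSpace (𝓡 n) x) (a : ℝ) (hY : D.g x Y (D.Xp x) + a * D.c x = 0) :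
        ∃ v, D.IsPlus v ∧ v x = D.plus x Y a ∧ ∀ y, pairing y (v y) (D.unit y) = 0 := by
      obtain ⟨v, hv, e⟩ := D.exists_isPlus x Y a
      -- Applying `-A²` makes the extension orthogonal to the unit everywhere without changing its
      -- value at `x`, which was already orthogonal.
      refine ⟨_, (h.isPlus_A (h.isPlus_A hv)).neg, ?_, fun y => ?_⟩
      · rw [h.A_sq_of_orthogonal, e, neg_neg]
        rw [e, Data.unit, pairing_plus_plus D x (h.hermitian.metric.symm x), hY]
      · rw [map_neg, LinearMap.neg_apply, h.pairing_A_unit, neg_zero]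
    obtain ⟨v, hv, ev, hvu⟩ := ext Y a hY
    obtain ⟨v', hv', ev', hvu'⟩ := ext Y' b hY'
    obtain ⟨w, hw, ew⟩ := D.exists_isPlus x Z k
    have n1 := N (h.smooth_of_isPlus hv) (h.smooth_of_isPlus hv')
      (fun y => h.A_sq_of_orthogonal (hvu y)) (fun y => h.A_sq_of_orthogonal (hvu' y)) x (w x)
    rw [h.nijenhuis_isPlus hP hv hv' hw hvu hvu', ev, ev', ew, h.A_plus, h.A_plus, h.A_plus] at n1
    exact n1
  · obtain ⟨s, hs, es⟩ := D.exists_isMinus x X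
    obtain ⟨s', hs', es'⟩ := D.exists_isMinus x Y
    obtain ⟨r, hr, er⟩ := D.exists_isMinus x Z
    have n1 := N (h.smooth_of_isMinus hs) (h.smooth_of_isMinus hs')
      (h.A_sq_of_isMinus hs) (h.A_sq_of_isMinus hs') x (r x)
    rw [h.nijenhuis_isMinus hM hs hs' hr, es, es', er, h.A_minus, h.A_minus, h.A_minus] at n1
    exact n1

variable (hC : D.IsCompatible H A)
include hC

theorem nijenhuis_eq_zero_of_isPlus {v v' w : ESec n M} (hv : D.IsPlus v) (hv' : D.IsPlus v')
    (hw : D.IsPlus w) (hu : ∀ y, pairing y (v y) (D.unit y) = 0)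
    (hu' : ∀ y, pairing y (v' y) (D.unit y) = 0) (x : M) : nijenhuis H A v v' x (w x) = 0 := by
  rw [h.nijenhuis_isPlus hC.minus_plus hv hv' hw hu hu']
  have hs := h.hermitian.metric.symm x
  have k1 := hu x
  have k2 := hu' x
  obtain ⟨Y, a, -, -, rfl⟩ := hv
  obtain ⟨Y', b, -, -, rfl⟩ := hv'
  obtain ⟨Z, k, -, -, rfl⟩ := hw
  simp only [Data.plusSec, Data.unit, pairing_plus_plus D x hs] at k1 k2
  have := hC.three_plus x (Y x) (Y' x) (Z x) (a x) (b x) (k x) k1 k2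
  simp only [Data.plusSec, h.A_plus]
  exact this

theorem nijenhuis_eq_zero_of_isMinus {s s' r : ESec n M} (hs : D.IsMinus s) (hs' : D.IsMinus s')
    (hr : D.IsMinus r) (x : M) : nijenhuis H A s s' x (r x) = 0 := by
  rw [h.nijenhuis_isMinus hC.plus_minus hs hs' hr]
  obtain ⟨X, -, rfl⟩ := hs
  obtain ⟨Y, -, rfl⟩ := hs'
  obtain ⟨Z, -, rfl⟩ := hr
  have := hC.three_minus x (X x) (Y x) (Z x)
  simp only [Data.minusSec, h.A_minus]
  exact this

end Data.IsModel

end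
end BnGen

/-! ### Compatibility implies integrability. -/

namespace BnGen
section
variable {n : ℕ} {M : Type*} [TopologicalSpace M] [ChartedSpace (EuclideanSpace ℝ (Fin n)) M]
variable [IsManifold (𝓡 n) ∞ M] {D : Data n M} {G A B : EEnd n M} {H : FormField n M 3} {τ : ℝ}

namespace Data.IsModel

variable (h : D.IsModel G A) (hC : D.IsCompatible H A) (hB : D.AgreesUpToSign A B τ)
include h hC

theorem tri_A_A_of_isCompatible {s v w : ESec n M} (hs : D.IsMinus s) (hv : D.IsPlus v)
    (hw : D.IsPlus w) (hu : ∀ y, pairing y (v y) (D.unit y) = 0) (x : M) :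
    tri H s (fun y => A y (v y)) x (A x (w x)) = tri H s v x (w x) :=
  h.tri_A_A hs hv hw x (hC.minus_plus _ _ _ hs (h.isPlus_A hv) hw x) hu

theorem tri_A_A_minus_of_isCompatible {v s s' : ESec n M} (hv : D.IsPlus v) (hs : D.IsMinus s)
    (hs' : D.IsMinus s') (x : M) :
    tri H v (fun y => A y (s y)) x (A x (s' x)) = tri H v s x (s' x) :=
  h.tri_A_A_minus hv hs hs' x (hC.plus_minus _ _ _ hv (h.isMinus_A hs) hs' x)

include hB

/-- The sign-free part vanishes by the commutation rule for `s`, the part multiplied by `τ` by the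
resulting `A`-invariance for `A s`. The other mixed types reduce to the two commutation rules after
swapping or rotating arguments. -/
theorem nijenhuis_eq_zero_mpp {s v w : ESec n M} (hs : D.IsMinus s) (hv : D.IsPlus v)
    (hw : D.IsPlus w) (hu : ∀ y, pairing y (v y) (D.unit y) = 0) (x : M) :
    nijenhuis H B s v x (w x) = 0 := by
  rw [hB.nijenhuis_minus_plus_plus h hs hv hw, hC.minus_plus s v w hs hv hw,
    h.tri_A_A_of_isCompatible hC (h.isMinus_A hs) hv hw hu]
  ring

theorem nijenhuis_eq_zero_mpm {s v s' : ESec n M} (hs : D.IsMinus s) (hv : D.IsPlus v)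
    (hs' : D.IsMinus s') (x : M) :
    nijenhuis H B s v x (s' x) = 0 := by
  have as := h.isMinus_A hs
  have as' := h.isMinus_A hs'
  have av := h.isPlus_A hv
  have key {p q r : ESec n M} (hp : D.IsMinus p) (hq : D.IsPlus q) (hr : D.IsMinus r) :=
    tri_antisymm_left (H := H) (h.smooth_of_isMinus hp) (h.smooth_of_isPlus hq)
      (h.smooth_of_isMinus hr) x (h.pairing_isMinus_isPlus hp hq)
  rw [hB.nijenhuis_minus_plus_minus h hs hv hs', key hs hv as', key as hv hs', key as av as',
    key hs av hs', h.tri_A_A_minus_of_isCompatible hC av hs hs']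
  linear_combination (- τ) * hC.plus_minus v s s' hv hs hs' x

theorem nijenhuis_eq_zero_mmp {s s' v : ESec n M} (hs : D.IsMinus s) (hs' : D.IsMinus s')
    (hv : D.IsPlus v) (x : M) : nijenhuis H B s s' x (v x) = 0 := by
  have as := h.isMinus_A hs
  have as' := h.isMinus_A hs'
  have av := h.isPlus_A hv
  have key {p q r : ESec n M} (hp : D.IsMinus p) (hq : D.IsMinus q) (hr : D.IsPlus r) :=
    tri_rotate (H := H) (h.smooth_of_isMinus hp) (h.smooth_of_isMinus hq)
      (h.smooth_of_isPlus hr) x (h.pairing_isMinus_isPlus hp hr) (h.pairing_isMinus_isPlus hq hr)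
  rw [hB.nijenhuis_minus_minus_plus h hs hs' hv, key hs hs' av, key as as' av, key as hs' hv,
    key hs as' hv, h.tri_A_A_minus_of_isCompatible hC av hs hs']
  linear_combination τ * hC.plus_minus v s s' hv hs hs' x

theorem nijenhuis_eq_zero_ppm {v v' s : ESec n M} (hv : D.IsPlus v) (hv' : D.IsPlus v')
    (hs : D.IsMinus s) (hu : ∀ y, pairing y (v y) (D.unit y) = 0) (x : M) :
    nijenhuis H B v v' x (s x) = 0 := by
  have as := h.isMinus_A hs
  have av := h.isPlus_A hv
  have av' := h.isPlus_A hv'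
  have key {p q r : ESec n M} (hp : D.IsPlus p) (hq : D.IsPlus q) (hr : D.IsMinus r) :=
    tri_rotate (H := H) (h.smooth_of_isPlus hp) (h.smooth_of_isPlus hq)
      (h.smooth_of_isMinus hr) x (h.pairing_isPlus_isMinus hr hp) (h.pairing_isPlus_isMinus hr hq)
  rw [hB.nijenhuis_plus_plus_minus hv hv' hs, key hv hv' as, key av av' as, key av hv' hs,
    key hv av' hs, h.tri_A_A_of_isCompatible hC as hv hv' hu]
  linear_combination hC.minus_plus s v v' hs hv hv' x

/-- Compatibility implies the integrability of `ℱ` and `𝒢ℱ`. -/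
theorem isIntegrable [T2Space M] (hsm : SmoothEEnd B)
    (hskew : ∀ x u v, pairing x (B x u) v = - pairing x u (B x v))
    (hsq : ∀ x u, B x (B x u) = A x (A x u)) : IsIntegrable H 0 B := by
  have hg := h.hermitian.metric
  refine isIntegrable_of_nijenhuis hsm hskew
    (fun x w => exists_smoothESec D.g hg.smooth x w (exists_flat_eq (hg.nondegenerate x) _)) ?_
  intro u u' hu hu' hu2 hu2' x w
  have split {u : ESec n M} (hu : SmoothESec u) : ∃ s v : ESec n M, D.IsMinus s ∧ D.IsPlus v ∧
      u = fun y => s y + v y := by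
    obtain ⟨X, Y, b, hX, hY, hb, e⟩ := h.smooth_decomp hu
    exact ⟨_, _, ⟨X, hX, rfl⟩, ⟨Y, b, hY, hb, rfl⟩, e⟩
  -- The equation `A²u = -u` says that `u` is orthogonal to the unit. As the unit lies in `E_+`,
  -- this constrains only the `E_+` part of `u`.
  have orth {u s v : ESec n M} (hu2 : ∀ x, B x (B x (u x)) = - u x) (hs : D.IsMinus s)
      (e : u = fun y => s y + v y) (y : M) : pairing y (v y) (D.unit y) = 0 := by
    have h1 := hu2 y
    rw [hsq, h.A_sq, add_eq_left] at h1
    have h2 := congrArg (fun z => pairing y z (D.unit y)) h1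
    simp only [map_smul, LinearMap.smul_apply, h.pairing_unit_unit, map_zero, LinearMap.zero_apply,
      smul_eq_mul, mul_one] at h2
    rw [e, map_add, LinearMap.add_apply, h.pairing_isMinus_isPlus hs h.isPlus_unit, zero_add] at h2
    exact h2
  obtain ⟨w, hw, rfl⟩ := exists_smoothESec D.g hg.smooth x w (exists_flat_eq (hg.nondegenerate x) _)
  obtain ⟨s, v, hs, hv, e⟩ := split hu
  obtain ⟨s', v', hs', hv', e'⟩ := split hu'
  obtain ⟨r, z, hr, hz, rfl⟩ := split hw
  have ov := orth hu2 hs e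
  have ov' := orth hu2' hs' e'
  have ss := h.smooth_of_isMinus hs
  have ss' := h.smooth_of_isMinus hs'
  have sv := h.smooth_of_isPlus hv
  have sv' := h.smooth_of_isPlus hv'
  have swap {w : ESec n M} (hw : SmoothESec w) :
      nijenhuis H B v s' x (w x) = - nijenhuis H B s' v x (w x) := by
    have bs := hB.apply_isMinus hs'
    have bv := hB.apply_isPlus hv
    have e1 (y : M) : B y (s' y) = τ • A y (s' y) := congrFun bs y
    have e2 (y : M) : B y (v y) = A y (v y) := congrFun bv y
    have as := h.isMinus_A hs'
    have av := h.isPlus_A hv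
    refine nijenhuis_swap sv ss' (hsm v sv) (hsm s' ss') hw (hsm w hw) x
      (h.pairing_isPlus_isMinus hs' hv) (fun y => ?_) (fun y => ?_) (fun y => ?_)
    · rw [e2, h.pairing_isPlus_isMinus hs' av]
    · rw [e1, map_smul, h.pairing_isPlus_isMinus as hv, smul_zero]
    · rw [e1, e2, map_smul, h.pairing_isPlus_isMinus as av, smul_zero]
  have key {w : ESec n M} (hw : SmoothESec w) : nijenhuis H B u u' x (w x) =
      nijenhuis H B s s' x (w x) + nijenhuis H B s v' x (w x) - nijenhuis H B s' v x (w x)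
        + nijenhuis H B v v' x (w x) := by
    rw [e, e', nijenhuis_add_left hsm ss sv (ss'.add sv') hw,
      nijenhuis_add_mid hsm ss ss' sv' hw, nijenhuis_add_mid hsm sv ss' sv' hw, swap hw]
    ring
  -- All eight sign types of triples appear; the type `(+,-,·)` has been replaced by `(-,+,·)`
  -- through `swap`.
  rw [nijenhuis_add_right, key (h.smooth_of_isMinus hr), key (h.smooth_of_isPlus hz),
    hB.nijenhuis_minus_minus_minus h hs hs' hr, h.nijenhuis_eq_zero_of_isMinus hC hs hs' hr,
    h.nijenhuis_eq_zero_mpm hC hB hs hv' hr, h.nijenhuis_eq_zero_mpm hC hB hs' hv hr,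
    h.nijenhuis_eq_zero_ppm hC hB hv hv' hr ov, h.nijenhuis_eq_zero_mmp hC hB hs hs' hz,
    h.nijenhuis_eq_zero_mpp hC hB hs hv' hz ov', h.nijenhuis_eq_zero_mpp hC hB hs' hv hz ov,
    hB.nijenhuis_plus_plus_plus hv hv' hz, h.nijenhuis_eq_zero_of_isPlus hC hv hv' hz ov ov']
  ring

omit hB in
theorem isGenPseudoKahler [T2Space M] : IsGenPseudoKahler H 0 G A where
  metric := h.isGenMetric
  commute x := LinearMap.ext fun u => h.G_A x u
  complex₁ := ⟨h.isGenAlmostComplex, h.isIntegrable hC (D.agreesUpToSign_self A) h.smooth_A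
    h.A_skew fun _ _ => rfl⟩
  complex₂ := ⟨h.isGenAlmostComplex_comp, h.isIntegrable hC h.agreesUpToSign_comp h.smooth_comp
    h.A_skew_comp h.A_sq_comp⟩

end Data.IsModel

end
end BnGen

namespace BnGen
section
variable {n : ℕ} {M : Type*} [TopologicalSpace M] [ChartedSpace (EuclideanSpace ℝ (Fin n)) M]

/-! ### The functions entering the rescaling -/

theorem SmoothFun.comp_contDiffAt {f : M → ℝ} {φ : ℝ → ℝ} (hf : SmoothFun (n := n) f)
    (hφ : ∀ x, ContDiffAt ℝ ∞ φ (f x)) : SmoothFun (n := n) (fun x => φ (f x)) := fun x =>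
  (hφ x).contMDiffAt.comp x (hf x)

theorem dFun_comp {f : M → ℝ} {φ : ℝ → ℝ} {x : M} (hf : SmoothFun (n := n) f)
    (hφ : ContDiffAt ℝ ∞ φ (f x)) {v : TangentSpace (𝓡 n) x} (h : dFun f x v = 0) :
    dFun (fun y => φ (f y)) x v = 0 := by
  have h1 : MDifferentiableAt 𝓘(ℝ, ℝ) 𝓘(ℝ, ℝ) φ (f x) :=
    (hφ.differentiableAt (by simp)).mdifferentiableAt
  have h2 := mfderiv_comp x h1 (hf.mdifferentiableAt x)
  have h3 := congrArg (fun l : TangentSpace (𝓡 n) x →L[ℝ] ℝ => l v) h2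
  refine h3.trans ?_
  change (mfderiv 𝓘(ℝ, ℝ) 𝓘(ℝ, ℝ) φ (f x)) (dFun f x v) = 0
  rw [h]
  exact map_zero _

section

variable {t : ℝ}

theorem one_sub_sq_ne_zero (h1 : t ≠ -1) (h2 : t ≠ 1) : 1 - t ^ 2 ≠ 0 := by
  have : 1 - t ^ 2 = (t - -1) * (1 - t) := by ring
  rw [this]
  exact mul_ne_zero (sub_ne_zero.2 h1) (sub_ne_zero.2 h2.symm)

theorem sign_mul_self_of_ne_zero {s : ℝ} (hs : s ≠ 0) : Real.sign s * Real.sign s = 1 := by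
  rcases Real.sign_apply_eq_of_ne_zero s hs with h | h <;> rw [h] <;> norm_num

theorem sign_mul_rpow_mul {s : ℝ} (hs : s ≠ 0) :
    Real.sign s * (|s| ^ (-(1 / 2) : ℝ) * |s| ^ (-(1 / 2) : ℝ)) * s = 1 := by
  have h0 : 0 < |s| := abs_pos.2 hs
  rw [← Real.rpow_add h0]
  norm_num
  rw [Real.rpow_neg_one]
  rcases lt_or_gt_of_ne hs with h | h
  · rw [Real.sign_of_neg h, abs_of_neg h]; field_simp
  · rw [Real.sign_of_pos h, abs_of_pos h]; field_simp

theorem eventually_sign_eq {s : ℝ} (hs : s ≠ 0) : ∀ᶠ r in 𝓝 s, Real.sign r = Real.sign s := by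
  rcases lt_or_gt_of_ne hs with h | h
  · filter_upwards [gt_mem_nhds h] with r hr
    rw [Real.sign_of_neg h, Real.sign_of_neg hr]
  · filter_upwards [lt_mem_nhds h] with r hr
    rw [Real.sign_of_pos h, Real.sign_of_pos hr]

theorem contDiffAt_sign (ht : 1 - t ^ 2 ≠ 0) :
    ContDiffAt ℝ ∞ (fun t : ℝ => Real.sign (1 - t ^ 2)) t := by
  have hc : ContinuousAt (fun t : ℝ => 1 - t ^ 2) t := by fun_prop
  exact contDiffAt_const.congr_of_eventuallyEq (hc.eventually (eventually_sign_eq ht))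

theorem contDiffAt_rpow (ht : 1 - t ^ 2 ≠ 0) :
    ContDiffAt ℝ ∞ (fun t : ℝ => |1 - t ^ 2| ^ (-(1 / 2) : ℝ)) t := by
  have h1 : ContDiffAt ℝ ∞ (fun t : ℝ => 1 - t ^ 2) t := by fun_prop
  have h2 : ContDiffAt ℝ ∞ (fun t : ℝ => |1 - t ^ 2|) t := h1.abs ht
  exact h2.rpow_const_of_ne (abs_ne_zero.2 ht)

theorem contDiffAt_div_one_sub_sq (ht : 1 - t ^ 2 ≠ 0) :
    ContDiffAt ℝ ∞ (fun t : ℝ => t / (1 - t ^ 2)) t := by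
  have h1 : ContDiffAt ℝ ∞ (fun t : ℝ => 1 - t ^ 2) t := by fun_prop
  exact contDiffAt_id.div h1 ht

end

namespace Data

variable {D : Data n M}

/-- The factor `|1 - c₊²|^{-1/2}`. -/
noncomputable def scale (D : Data n M) (x : M) : ℝ := |1 - D.c x ^ 2| ^ (-(1 / 2) : ℝ)

/-- The factor `c₊ / (1 - c₊²)`. -/
noncomputable def ratio (D : Data n M) (x : M) : ℝ := D.c x / (1 - D.c x ^ 2)

variable (hc : ∀ x, 1 - D.c x ^ 2 ≠ 0)
include hc

theorem eps_mul_self (x : M) : D.eps x * D.eps x = 1 := sign_mul_self_of_ne_zero (hc x)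

theorem eps_mul_scale (x : M) : D.eps x * (D.scale x * D.scale x) * (1 - D.c x ^ 2) = 1 :=
  sign_mul_rpow_mul (hc x)

theorem ratio_mul (x : M) : D.ratio x * (1 - D.c x ^ 2) = D.c x := div_mul_cancel₀ _ (hc x)

theorem smooth_eps (h : SmoothFun (n := n) D.c) : SmoothFun (n := n) D.eps :=
  h.comp_contDiffAt fun x => contDiffAt_sign (hc x)

theorem smooth_scale (h : SmoothFun (n := n) D.c) : SmoothFun (n := n) D.scale :=
  h.comp_contDiffAt fun x => contDiffAt_rpow (hc x)

theorem smooth_ratio (h : SmoothFun (n := n) D.c) : SmoothFun (n := n) D.ratio :=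
  h.comp_contDiffAt fun x => contDiffAt_div_one_sub_sq (hc x)

theorem eventually_eps_eq (h : SmoothFun (n := n) D.c) (x : M) :
    ∀ᶠ y in 𝓝 x, D.eps y = D.eps x := by
  have h1 : Continuous D.c := ContMDiff.continuous h
  have h2 : ContinuousAt (fun y => 1 - D.c y ^ 2) x := by fun_prop
  exact h2.eventually (eventually_sign_eq (hc x))

end Data

/-! ### The modified endomorphism `J₊` -/

namespace Data

variable (D : Data n M)

/-- The endomorphism `J₊ + c₊ / (1 - c₊²) (g(X₊, ·) X₋ - g(X₋, ·) X₊)`. -/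
noncomputable def modifiedJp : EndField n M := fun x =>
  D.Jp x + D.ratio x • ((D.g x (D.Xp x)).smulRight (D.Xm x) - (D.g x (D.Xm x)).smulRight (D.Xp x))

theorem modifiedJp_apply (x : M) (X : TangentSpace (𝓡 n) x) : D.modifiedJp x X =
    D.Jp x X + D.ratio x • (D.g x (D.Xp x) X • D.Xm x - D.g x (D.Xm x) X • D.Xp x) := rfl

variable {D} [IsManifold (𝓡 n) ∞ M] (h : D.IsHermitian) (hc : ∀ x, 1 - D.c x ^ 2 ≠ 0)
include h

theorem IsHermitian.g_Xm_Xp (x : M) : D.g x (D.Xm x) (D.Xp x) = 0 := by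
  rw [h.metric.symm, h.g_Xp_Xm]

include hc

/-- Since `g(X₊, X₊) = 1 - c₊²`, the coefficient `c₊/(1 - c₊²)` of the correction produces `c₊X₋`,
which cancels `J₊X₊ = -c₊X₋`. -/
theorem IsHermitian.modifiedJp_Xp (x : M) : D.modifiedJp x (D.Xp x) = 0 := by
  rw [modifiedJp_apply, h.Jp_Xp, h.g_Xp_Xp, h.g_Xm_Xp, zero_smul, sub_zero, smul_smul,
    ratio_mul hc, neg_smul, neg_add_cancel]

theorem IsHermitian.modifiedJp_Xm (x : M) : D.modifiedJp x (D.Xm x) = 0 := by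
  rw [modifiedJp_apply, h.Jp_Xm, h.g_Xm_Xm, h.g_Xp_Xm, zero_smul, zero_sub, smul_neg, smul_smul,
    ratio_mul hc, add_neg_cancel]

omit hc in
theorem IsHermitian.modifiedJp_of_orthogonal {x : M} {v : TangentSpace (𝓡 n) x}
    (h1 : D.g x v (D.Xp x) = 0) (h2 : D.g x v (D.Xm x) = 0) : D.modifiedJp x v = D.Jp x v := by
  rw [modifiedJp_apply, h.metric.symm x _ v, h.metric.symm x _ v, h1, h2, zero_smul, zero_smul,
    sub_zero, smul_zero, add_zero]

theorem IsHermitian.isModifiedJp : D.IsModifiedJp D.modifiedJp := fun x =>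
  ⟨h.modifiedJp_Xp hc x, h.modifiedJp_Xm hc x, fun _ h1 h2 => h.modifiedJp_of_orthogonal h1 h2⟩

/-- Every tangent vector splits along `X₊`, `X₋` and their orthogonal complement. -/
theorem IsHermitian.exists_split (x : M) (X : TangentSpace (𝓡 n) x) :
    ∃ (v : TangentSpace (𝓡 n) x) (a b : ℝ), X = v + a • D.Xp x + b • D.Xm x ∧
      D.g x v (D.Xp x) = 0 ∧ D.g x v (D.Xm x) = 0 := by
  have hx := hc x
  refine ⟨X - (D.g x X (D.Xp x) / (1 - D.c x ^ 2)) • D.Xp x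
    - (D.g x X (D.Xm x) / (1 - D.c x ^ 2)) • D.Xm x, D.g x X (D.Xp x) / (1 - D.c x ^ 2),
    D.g x X (D.Xm x) / (1 - D.c x ^ 2), by abel, ?_, ?_⟩
  · simp only [map_sub, map_smul, sub_apply, smul_apply, h.g_Xp_Xp, h.g_Xm_Xp, smul_eq_mul]
    field_simp
    ring
  · simp only [map_sub, map_smul, sub_apply, smul_apply, h.g_Xp_Xm, h.g_Xm_Xm, smul_eq_mul]
    field_simp
    ring

theorem IsHermitian.eq_modifiedJp {J : EndField n M} (hJ : D.IsModifiedJp J) :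
    J = D.modifiedJp := by
  funext x
  ext1 X
  obtain ⟨v, a, b, rfl, h1, h2⟩ := h.exists_split hc x X
  obtain ⟨j1, j2, j3⟩ := hJ x
  rw [map_add, map_add, map_smul, map_smul, j1, j2, j3 v h1 h2, map_add, map_add, map_smul,
    map_smul, h.modifiedJp_Xp hc, h.modifiedJp_Xm hc, h.modifiedJp_of_orthogonal h1 h2]

theorem IsHermitian.existsUnique_isModifiedJp : ∃! J, D.IsModifiedJp J :=
  ⟨D.modifiedJp, h.isModifiedJp hc, fun _ hJ => h.eq_modifiedJp hc hJ⟩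

/-- The rescaled data satisfy the same algebraic identities. -/
theorem IsHermitian.rescale (hsm : SmoothFun (n := n) D.c) :
    (D.rescale D.modifiedJp).IsHermitian where
  metric :=
    { smooth := h.metric.smooth.smul (smooth_eps hc hsm)
      symm := fun x v w => by
        change D.eps x * D.g x v w = D.eps x * D.g x w v
        rw [h.metric.symm]
      nondegenerate := fun x v hv => h.metric.nondegenerate x v fun w => by
        have h1 : D.eps x * D.g x v w = 0 := hv w
        have h2 := eps_mul_self hc x
        linear_combination D.eps x * h1 - D.g x v w * h2 }
  Jm_sq := h.Jm_sq
  Jm_skew x X Y := by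
    change D.eps x * D.g x (D.Jm x X) Y = - (D.eps x * D.g x X (D.Jm x Y))
    rw [h.Jm_skew]; ring
  Jp_sq x X := by
    change D.modifiedJp x (D.modifiedJp x X) = - X
      + (D.eps x * D.g x X (D.scale x • D.Xp x)) • D.scale x • D.Xp x
      + (D.eps x * D.g x X (D.scale x • D.Xm x)) • D.scale x • D.Xm x
    have h1 := eps_mul_scale hc x
    have h2 := ratio_mul hc x
    -- Both sides equal `1/(1 - c₊²)`. This matches the normalization of the rescaled `X_±` with the
    -- correction terms in the square of the modified `J₊`.
    have e : D.eps x * (D.scale x * D.scale x) = 1 + D.ratio x * D.c x := by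
      refine mul_right_cancel₀ (hc x) ?_
      linear_combination h1 - D.c x * h2
    rw [modifiedJp_apply D x X, map_add, map_smul, map_sub, map_smul, map_smul,
      h.modifiedJp_Xp hc, h.modifiedJp_Xm hc, modifiedJp_apply, h.Jp_sq,
      h.metric.symm x _ (D.Jp x X), h.metric.symm x _ (D.Jp x X), h.Jp_skew, h.Jp_skew, h.Jp_Xp,
      h.Jp_Xm]
    simp only [map_smul, smul_eq_mul, smul_smul, smul_zero, sub_zero, add_zero]
    have e1 : D.eps x * (D.scale x * D.g x X (D.Xp x)) * D.scale x =
      (1 + D.ratio x * D.c x) * D.g x X (D.Xp x) := by rw [← e]; ring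
    have e2 : D.eps x * (D.scale x * D.g x X (D.Xm x)) * D.scale x =
      (1 + D.ratio x * D.c x) * D.g x X (D.Xm x) := by rw [← e]; ring
    rw [e1, e2]
    module
  Jp_skew x X Y := by
    change D.eps x * D.g x (D.modifiedJp x X) Y = - (D.eps x * D.g x X (D.modifiedJp x Y))
    rw [modifiedJp_apply, modifiedJp_apply]
    simp only [map_add, map_sub, map_smul, add_apply, sub_apply, smul_apply, smul_eq_mul,
      h.Jp_skew, h.metric.symm x X]
    ring
  Jp_Xp x := by
    change D.modifiedJp x (D.scale x • D.Xp x) = - (0 : ℝ) • (D.scale x • D.Xm x)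
    rw [map_smul, h.modifiedJp_Xp hc, smul_zero, neg_zero, zero_smul]
  Jp_Xm x := by
    change D.modifiedJp x (D.scale x • D.Xm x) = (0 : ℝ) • (D.scale x • D.Xp x)
    rw [map_smul, h.modifiedJp_Xm hc, smul_zero, zero_smul]
  g_Xp_Xm x := by
    change D.eps x * D.g x (D.scale x • D.Xp x) (D.scale x • D.Xm x) = 0
    rw [map_smul, map_smul, smul_apply, h.g_Xp_Xm, smul_zero, smul_zero, mul_zero]
  g_Xp_Xp x := by
    change D.eps x * D.g x (D.scale x • D.Xp x) (D.scale x • D.Xp x) = 1 - 0 ^ 2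
    rw [map_smul, map_smul, smul_apply, h.g_Xp_Xp, smul_eq_mul, smul_eq_mul]
    linear_combination eps_mul_scale hc x
  g_Xm_Xm x := by
    change D.eps x * D.g x (D.scale x • D.Xm x) (D.scale x • D.Xm x) = 1 - 0 ^ 2
    rw [map_smul, map_smul, smul_apply, h.g_Xm_Xm, smul_eq_mul, smul_eq_mul]
    linear_combination eps_mul_scale hc x

end Data

end
end BnGen

namespace BnGen
section
variable {n : ℕ} {M : Type*} [TopologicalSpace M] [ChartedSpace (EuclideanSpace ℝ (Fin n)) M]
variable {D : Data n M} {G A : EEnd n M} {x : M}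

/-! ### The endomorphisms of `E` determined by the rescaled data -/

namespace Data

/-- The endomorphism `𝒢^end` of the rescaled data, in terms of the original one. -/
noncomputable def rescaleG (D : Data n M) (G : EEnd n M) : EEnd n M := fun x =>
  { toFun := fun u => (D.eps x • (G x (0, u.2.1, 0)).1, D.eps x • D.g x u.1, u.2.2)
    map_add' := fun u v => by
      have e : ((0, (u + v).2.1, 0) : EFib n x) = (0, u.2.1, 0) + (0, v.2.1, 0) := by simp
      rw [e, map_add, Prod.fst_add, Prod.fst_add, map_add, smul_add, smul_add]
      rfl
    map_smul' := fun r u => by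
      have e : ((0, (r • u).2.1, 0) : EFib n x) = r • (0, u.2.1, 0) := by simp
      rw [e, map_smul, Prod.smul_fst, Prod.smul_fst, map_smul, smul_comm _ r, smul_comm _ r]
      rfl }

theorem rescaleG_apply (u : EFib n x) : D.rescaleG G x u =
    (D.eps x • (G x (0, u.2.1, 0)).1, D.eps x • D.g x u.1, u.2.2) := rfl

/-- The endomorphism of `E` with the given components, for a generalized metric `G`. -/
noncomputable def toEnd (D : Data n M) (G : EEnd n M) : EEnd n M := fun x =>
  -- The vectors `½(u.1 ∓ (G u).1)` are the anchors of the components of `u` in `E_∓`.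
  { toFun := fun u => D.minus x (D.Jm x ((1 / 2 : ℝ) • (u.1 - (G x u).1)))
      + D.plus x (D.Jp x ((1 / 2 : ℝ) • (u.1 + (G x u).1)) + u.2.2 • D.Xm x)
        (- D.g x ((1 / 2 : ℝ) • (u.1 + (G x u).1)) (D.Xm x))
    map_add' := fun u v => by
      rw [add_add_add_comm, ← minus_add, ← plus_add]
      congr 2
      · rw [map_add, Prod.fst_add, Prod.fst_add, ← map_add, ← smul_add, add_sub_add_comm]
      · rw [map_add, Prod.fst_add, Prod.fst_add, Prod.snd_add, Prod.snd_add, add_smul,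
          add_add_add_comm (a := D.Jp x _), ← map_add, ← smul_add, add_add_add_comm]
      · rw [map_add, Prod.fst_add, Prod.fst_add, ← neg_add, ← add_apply, ← map_add, ← smul_add,
          add_add_add_comm]
    map_smul' := fun r u => by
      have e : (G x (r • u)).1 = r • (G x u).1 := by rw [map_smul]; rfl
      have e1 : (1 / 2 : ℝ) • ((r • u).1 - (G x (r • u)).1) =
          r • ((1 / 2 : ℝ) • (u.1 - (G x u).1)) := by
        rw [e, Prod.smul_fst]; module
      have e2 : (1 / 2 : ℝ) • ((r • u).1 + (G x (r • u)).1) =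
          r • ((1 / 2 : ℝ) • (u.1 + (G x u).1)) := by
        rw [e, Prod.smul_fst]; module
      have e3 : (r • u).2.2 = r * u.2.2 := rfl
      rw [e1, e2, e3, RingHom.id_apply]
      generalize (1 / 2 : ℝ) • (u.1 - (G x u).1) = p
      generalize (1 / 2 : ℝ) • (u.1 + (G x u).1) = q
      rw [smul_add r (D.minus x _), ← minus_smul, ← plus_smul, map_smul, map_smul, map_smul (D.g x),
        smul_add, smul_smul, smul_apply, mul_neg, smul_eq_mul] }

theorem toEnd_minus (hG : ∀ X, G x (D.minus x X) = - D.minus x X) (X : TangentSpace (𝓡 n) x) :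
    D.toEnd G x (D.minus x X) = D.minus x (D.Jm x X) := by
  have e1 : (1 / 2 : ℝ) • ((D.minus x X).1 - (G x (D.minus x X)).1) = X := by
    rw [hG, Prod.fst_neg]; simp only [minus]; module
  have e2 : (1 / 2 : ℝ) • ((D.minus x X).1 + (G x (D.minus x X)).1) = 0 := by
    rw [hG, Prod.fst_neg, add_neg_cancel, smul_zero]
  have e3 : (D.minus x X).2.2 = 0 := rfl
  change D.minus x (D.Jm x _) + D.plus x (D.Jp x _ + (D.minus x X).2.2 • D.Xm x) (- D.g x _ _) = _
  rw [e1, e2, e3, map_zero, map_zero, zero_apply, neg_zero, zero_smul, add_zero]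
  simp [plus]

theorem toEnd_plus (hG : ∀ X a, G x (D.plus x X a) = D.plus x X a) (X : TangentSpace (𝓡 n) x)
    (a : ℝ) : D.toEnd G x (D.plus x X a) =
      D.plus x (D.Jp x X + a • D.Xm x) (- D.g x X (D.Xm x)) := by
  have e1 : (1 / 2 : ℝ) • ((D.plus x X a).1 + (G x (D.plus x X a)).1) = X := by
    rw [hG]; simp only [plus]; module
  have e2 : (1 / 2 : ℝ) • ((D.plus x X a).1 - (G x (D.plus x X a)).1) = 0 := by
    rw [hG, sub_self, smul_zero]
  have e3 : (D.plus x X a).2.2 = a := rfl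
  change D.minus x (D.Jm x _) + D.plus x (D.Jp x _ + (D.plus x X a).2.2 • D.Xm x) (- D.g x _ _) = _
  rw [e1, e2, e3, map_zero]
  simp [minus]

variable [IsManifold (𝓡 n) ∞ M]

/-- The operator `𝒢` contains the inverse of `g`: it maps `i_X g` to `X`. Hence `rescaleG` can use
`𝒢` in place of the inverse metric and inherits its smoothness. -/
theorem IsModel.G_form (h : D.IsModel G A) (X : TangentSpace (𝓡 n) x) :
    (G x (0, D.g x X, 0)).1 = X := by
  have e : ((0, D.g x X, 0) : EFib n x) = (1 / 2 : ℝ) • (D.plus x X 0 - D.minus x X) := by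
    refine Prod.ext ?_ (Prod.ext ?_ ?_)
    · simp [plus, minus]
    · simp only [plus, minus, Prod.snd_sub, Prod.fst_sub, Prod.smul_snd, Prod.smul_fst]; module
    · simp [plus, minus]
  rw [e, map_smul, map_sub, h.G_plus, h.G_minus, Prod.smul_fst, Prod.fst_sub, Prod.fst_neg]
  simp only [plus, minus]
  module

theorem IsModel.smooth_modifiedJp (h : D.IsModel G A) (hc : ∀ x, 1 - D.c x ^ 2 ≠ 0) :
    SmoothEndField D.modifiedJp := fun X hX => by
  have hg := h.hermitian.metric.smooth
  exact (h.smooth_Jp X hX).add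
    (((h.smooth_Xm.smul (hg.apply₂ h.smooth_Xp hX)).sub
      (h.smooth_Xp.smul (hg.apply₂ h.smooth_Xm hX))).smul (smooth_ratio hc h.smooth_c))

theorem IsModel.rescale (h : D.IsModel G A) (hc : ∀ x, 1 - D.c x ^ 2 ≠ 0) :
    (D.rescale D.modifiedJp).IsModel (D.rescaleG G)
      ((D.rescale D.modifiedJp).toEnd (D.rescaleG G)) := by
  have hε := smooth_eps hc h.smooth_c
  have hρ := smooth_scale hc h.smooth_c
  have hm (x : M) (X : TangentSpace (𝓡 n) x) : D.rescaleG G x ((D.rescale D.modifiedJp).minus x X)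
      = - (D.rescale D.modifiedJp).minus x X := by
    rw [rescaleG_apply]
    refine Prod.ext ?_ (Prod.ext ?_ ?_)
    · change D.eps x • (G x (0, - (D.eps x • D.g x X), 0)).1 = - X
      have e : - (D.eps x • D.g x X) = D.g x (- (D.eps x • X)) := by rw [map_neg, map_smul]
      rw [e, h.G_form, smul_neg, smul_smul, eps_mul_self hc, one_smul]
    · change D.eps x • D.g x X = - - (D.eps x • D.g x X)
      rw [neg_neg]
    · exact neg_zero.symm
  have hp (x : M) (X : TangentSpace (𝓡 n) x) (a : ℝ) :
      D.rescaleG G x ((D.rescale D.modifiedJp).plus x X a) =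
        (D.rescale D.modifiedJp).plus x X a := by
    rw [rescaleG_apply]
    refine Prod.ext ?_ (Prod.ext rfl rfl)
    change D.eps x • (G x (0, D.eps x • D.g x X, 0)).1 = X
    rw [← map_smul, h.G_form, smul_smul, eps_mul_self hc, one_smul]
  exact
    { hermitian := h.hermitian.rescale hc h.smooth_c
      smooth_Jp := h.smooth_modifiedJp hc
      smooth_Jm := h.smooth_Jm
      smooth_Xp := h.smooth_Xp.smul hρ
      smooth_Xm := h.smooth_Xm.smul hρ
      smooth_c := smoothFun_const 0
      smooth_G := fun u hu =>
        ⟨(h.smooth_G (fun x => (0, (u x).2.1, 0))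
            ⟨smoothVField_zero, hu.2.1, smoothFun_const 0⟩).1.smul hε,
          (h.hermitian.metric.smooth.apply hu.1).smul hε, hu.2.2⟩
      G_minus := hm
      G_plus := hp
      A_minus := fun x X => toEnd_minus (hm x) X
      A_plus := fun x X a => toEnd_plus (hp x) X a }

end Data

end
end BnGen

/-! ### The connection on `TM ⊂ E_+` and its parallel vector fields. -/

namespace BnGen
section
variable {n : ℕ} {M : Type*} [TopologicalSpace M] [ChartedSpace (EuclideanSpace ℝ (Fin n)) M]
variable [IsManifold (𝓡 n) ∞ M] {D : Data n M} {G A : EEnd n M} {H : FormField n M 3} {x : M}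

theorem tri_smul_mid {u v w : ESec n M} {f : M → ℝ} (hu : SmoothESec u) (hv : SmoothESec v)
    (hw : SmoothESec w) (hf : SmoothFun (n := n) f) (x : M) :
    tri H u (fun y => f y • v y) x (w x) =
      f x * tri H u v x (w x) + dFun f x (u x).1 * pairing x (v x) (w x) := by
  have h1 := tri_swap_right (H := H) hu (hv.smul hf) hw x
  have h2 := tri_swap_right (H := H) hu hv hw x
  simp only [map_smul, LinearMap.smul_apply, smul_eq_mul, tri_smul] at h1
  rw [dFun_mul hf (hv.pairing hw)] at h1
  linear_combination h1 - f x * h2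

theorem koszul_smul {g : BilinField n M} {ε : M → ℝ} (hg : SmoothBilinField g)
    (hε : SmoothFun (n := n) ε) (hd : ∀ v : TangentSpace (𝓡 n) x, dFun ε x v = 0)
    {X Y Z : VField n M} (hX : SmoothVField X) (hY : SmoothVField Y) (hZ : SmoothVField Z) :
    koszul (fun y => ε y • g y) X Y Z x = ε x * koszul g X Y Z x := by
  have e {X Y : VField n M} (hX : SmoothVField X) (hY : SmoothVField Y)
      (v : TangentSpace (𝓡 n) x) : dFun (fun y => (ε y • g y) (X y) (Y y)) x v =
        ε x * dFun (fun y => g y (X y) (Y y)) x v := by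
    change dFun (fun y => ε y * g y (X y) (Y y)) x v = _
    rw [dFun_mul hε (hg.apply₂ hX hY), hd]
    ring
  simp only [koszul]
  rw [e hY hZ, e hX hZ, e hX hY]
  simp only [smul_apply, smul_eq_mul]
  ring

namespace Data

/-- The metric connection with torsion of `TM ⊂ E_+` induced by the Dorfman bracket. -/
noncomputable def conn (D : Data n M) (H : FormField n M 3) (X Y : VField n M) (x : M)
    (Z : TangentSpace (𝓡 n) x) : ℝ :=
  tri H (D.minusSec X) (D.plusSec Y fun _ => 0) x (D.plus x Z 0)

omit [IsManifold (𝓡 n) ∞ M] in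
theorem conn_add (X Y : VField n M) (Z Z' : TangentSpace (𝓡 n) x) :
    D.conn H X Y x (Z + Z') = D.conn H X Y x Z + D.conn H X Y x Z' := by
  rw [conn, conn, conn, ← tri_add, ← plus_add, add_zero]

omit [IsManifold (𝓡 n) ∞ M] in
theorem conn_smul (X Y : VField n M) (r : ℝ) (Z : TangentSpace (𝓡 n) x) :
    D.conn H X Y x (r • Z) = r * D.conn H X Y x Z := by
  rw [conn, conn, ← tri_smul, ← plus_smul, mul_zero]

omit [IsManifold (𝓡 n) ∞ M] in
theorem conn_zero (X Y : VField n M) : D.conn H X Y x 0 = 0 := by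
  rw [← zero_smul ℝ (0 : TangentSpace (𝓡 n) x), conn_smul, zero_mul]

section

variable (hg : IsPseudoMetric D.g) {X Y Y' Z : VField n M} {b : M → ℝ} (hX : SmoothVField X)
  (hY : SmoothVField Y) (hY' : SmoothVField Y') (hZ : SmoothVField Z)
  (hb : SmoothFun (n := n) b) (x : M)
include hg hX hY hZ

theorem two_mul_conn :
    2 * D.conn H X Y x (Z x) = koszul D.g X Y Z x - three H x (X x) (Y x) (Z x) := by
  rw [conn, two_mul_tri_minus_plus_plus hg hX hY hZ x (smoothFun_const 0)]
  ring

include hb in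
theorem tri_minus_plus_plus (k : ℝ) :
    tri H (D.minusSec X) (D.plusSec Y b) x (D.plus x (Z x) k) =
      D.conn H X Y x (Z x) + k * dFun b x (X x) := by
  have h1 := two_mul_tri_minus_plus_plus (H := H) hg hX hY hZ x hb k
  have h2 := two_mul_conn (H := H) hg hX hY hZ x
  linarith

include hY' in
theorem conn_add_mid : D.conn H X (fun y => Y y + Y' y) x (Z x) =
    D.conn H X Y x (Z x) + D.conn H X Y' x (Z x) := by
  have h0 : SmoothFun (n := n) fun _ : M => (0 : ℝ) := smoothFun_const 0
  have h1 := tri_add_mid (H := H) (hg.smooth_minusSec hX) (hg.smooth_plusSec hY h0)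
    (hg.smooth_plusSec hY' h0) (hg.smooth_plusSec hZ h0) x
  have e : (fun y => D.plusSec Y (fun _ => 0) y + D.plusSec Y' (fun _ => 0) y) =
      D.plusSec (fun y => Y y + Y' y) fun _ => 0 := by
    funext y
    rw [plusSec, plusSec, ← plus_add, add_zero]
    rfl
  rw [e] at h1
  exact h1

include hb in
theorem conn_smul_mid : D.conn H X (fun y => b y • Y y) x (Z x) =
    b x * D.conn H X Y x (Z x) + dFun b x (X x) * D.g x (Y x) (Z x) := by
  have h0 : SmoothFun (n := n) fun _ : M => (0 : ℝ) := smoothFun_const 0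
  have h1 := tri_smul_mid (H := H) (hg.smooth_minusSec hX) (hg.smooth_plusSec hY h0)
    (hg.smooth_plusSec hZ h0) hb x
  have e : (fun y => b y • D.plusSec Y (fun _ => 0) y) =
      D.plusSec (fun y => b y • Y y) fun _ => 0 := by
    funext y
    rw [plusSec, ← plus_smul, mul_zero]
    rfl
  have e1 : pairing x (D.plusSec Y (fun _ => 0) x) (D.plusSec Z (fun _ => 0) x) =
      D.g x (Y x) (Z x) := by
    rw [plusSec, plusSec, pairing_plus_plus D x (hg.symm x), mul_zero, add_zero]
  rw [e, e1] at h1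
  exact h1

theorem conn_swap : D.conn H X Y x (Z x) + D.conn H X Z x (Y x) =
    dFun (fun y => D.g y (Y y) (Z y)) x (X x) := by
  have h0 : SmoothFun (n := n) fun _ : M => (0 : ℝ) := smoothFun_const 0
  have h1 := tri_swap_right (H := H) (hg.smooth_minusSec hX) (hg.smooth_plusSec hY h0)
    (hg.smooth_plusSec hZ h0) x
  have e : (fun y => pairing y (D.plusSec Y (fun _ => 0) y) (D.plusSec Z (fun _ => 0) y)) =
      fun y => D.g y (Y y) (Z y) := by
    funext y
    rw [plusSec, plusSec, pairing_plus_plus D y (hg.symm y), mul_zero, add_zero]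
  rw [e] at h1
  exact h1

end

namespace IsModel

variable (h : D.IsModel G A) (hC : D.IsCompatible H A) {X Y Z : VField n M} (hX : SmoothVField X)
  (hY : SmoothVField Y) (hZ : SmoothVField Z) (x : M)
include h hC hX hZ

-- This is the `TM`-block of the commutation rule: the `ℝ`-parts produced by `A` are paired with `0`
-- or differentiate the constant `0`.
include hY in
theorem conn_Jp :
    D.conn H X (fun y => D.Jp y (Y y)) x (Z x) + D.conn H X Y x (D.Jp x (Z x)) = 0 := by
  have hg := h.hermitian.metric
  have h0 : SmoothFun (n := n) fun _ : M => (0 : ℝ) := smoothFun_const 0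
  have h1 := hC.minus_plus _ _ _ ⟨X, hX, rfl⟩ ⟨Y, _, hY, h0, rfl⟩ ⟨Z, _, hZ, h0, rfl⟩ x
  have e : (fun y => A y (D.plusSec Y (fun _ => 0) y)) =
      D.plusSec (fun y => D.Jp y (Y y)) fun y => - D.g y (Y y) (D.Xm y) := by
    funext y
    rw [plusSec, h.A_plus, zero_smul, add_zero]
    rfl
  have e' : A x (D.plusSec Z (fun _ => 0) x) =
      D.plus x (D.Jp x (Z x)) (- D.g x (Z x) (D.Xm x)) := by
    rw [plusSec, h.A_plus, zero_smul, add_zero]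
  rw [e, e', plusSec,
    tri_minus_plus_plus hg hX (h.smooth_Jp Y hY) hZ (hg.smooth.apply₂ hY h.smooth_Xm).neg,
    tri_minus_plus_plus hg hX hY (h.smooth_Jp Z hZ) h0, dFun_const, zero_apply, mul_zero,
    zero_mul, add_zero, add_zero] at h1
  exact h1

/-- The section `1` of `E_+` is parallel, `A` is parallel, and `A1 = X₋`. -/
theorem conn_Xm : D.conn H X D.Xm x (Z x) = 0 := by
  have hg := h.hermitian.metric
  have h0 : SmoothFun (n := n) fun _ : M => (0 : ℝ) := smoothFun_const 0
  have hp : D.IsPlus (D.plusSec (fun _ => 0) fun _ => 1) :=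
    ⟨_, _, smoothVField_zero, smoothFun_const 1, rfl⟩
  have hz : D.IsPlus (D.plusSec Z fun _ => 0) := ⟨Z, _, hZ, h0, rfl⟩
  have h1 := hC.minus_plus _ _ _ ⟨X, hX, rfl⟩ hp hz x
  have e : (fun y => A y (D.plusSec (fun _ => 0) (fun _ => 1) y)) =
      D.plusSec D.Xm fun _ => 0 := by
    funext y
    rw [plusSec, h.A_plus, one_smul, map_zero, map_zero, zero_apply, neg_zero, zero_add]
    rfl
  have e' : A x (D.plusSec Z (fun _ => 0) x) =
      D.plus x (D.Jp x (Z x)) (- D.g x (Z x) (D.Xm x)) := by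
    rw [plusSec, h.A_plus, zero_smul, add_zero]
  have h2 := tri_minus_plus_plus (H := H) hg hX smoothVField_zero (h.smooth_Jp Z hZ)
    (smoothFun_const 1) x (- D.g x (Z x) (D.Xm x))
  have h3 := conn_swap (H := H) hg hX smoothVField_zero (h.smooth_Jp Z hZ) x
  simp only [map_zero, zero_apply, dFun_const, conn_zero, mul_zero, add_zero] at h2 h3
  rw [e, e', h2, h3, add_zero] at h1
  exact h1

/-- Parallelism of the unit, paired with `Z + k`. The freedom in `k` separates the `TM`-part, giving
that `X₊` is parallel, from the `ℝ`-part, giving `dc₊ = 0`. -/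
theorem conn_unit (k : ℝ) : D.conn H X D.Xp x (Z x) + k * dFun D.c x (X x) = 0 := by
  rw [← tri_minus_plus_plus h.hermitian.metric hX h.smooth_Xp hZ h.smooth_c]
  exact h.tri_unit_of_orthogonal (fun s v w hs hv hw _ => hC.minus_plus s v w hs hv hw)
    ⟨X, hX, rfl⟩ (w := D.plusSec Z fun _ => k) ⟨Z, _, hZ, smoothFun_const k, rfl⟩ x

theorem conn_Xp : D.conn H X D.Xp x (Z x) = 0 := by
  have := h.conn_unit hC hX hZ x 0
  rwa [zero_mul, add_zero] at this

omit hZ in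
theorem dFun_c : dFun D.c x (X x) = 0 := by
  have := h.conn_unit hC hX hX x 1
  rwa [h.conn_Xp hC hX hX, one_mul, zero_add] at this

end IsModel

end Data

end
end BnGen

/-! ### The commutation rules for the rescaled data. -/

namespace BnGen
section
variable {n : ℕ} {M : Type*} [TopologicalSpace M] [ChartedSpace (EuclideanSpace ℝ (Fin n)) M]
variable [IsManifold (𝓡 n) ∞ M] {D : Data n M} {G A : EEnd n M} {H : FormField n M 3} {x : M}

namespace Data

/-- The endomorphism `ℱ` of the rescaled data. -/
noncomputable def rescaleA (D : Data n M) (G : EEnd n M) : EEnd n M :=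
  (D.rescale D.modifiedJp).toEnd (D.rescaleG G)

/-- The rescaled three-form. -/
noncomputable def rescaleForm (D : Data n M) (H : FormField n M 3) : FormField n M 3 :=
  fun x => D.eps x • H x

omit [IsManifold (𝓡 n) ∞ M] in
theorem three_rescaleForm (a b c : TangentSpace (𝓡 n) x) :
    three (D.rescaleForm H) x a b c = D.eps x * three H x a b c := rfl

namespace IsModel

variable (h : D.IsModel G A) (hC : D.IsCompatible H A) (hc : ∀ x, 1 - D.c x ^ 2 ≠ 0)
include h hC

theorem dFun_c_eq_zero [T2Space M] (v : TangentSpace (𝓡 n) x) : dFun D.c x v = 0 := by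
  obtain ⟨X, hX, rfl⟩ := exists_smoothVField x v
  exact h.dFun_c hC hX x

include hc

theorem dFun_eps [T2Space M] (v : TangentSpace (𝓡 n) x) : dFun D.eps x v = 0 :=
  dFun_comp h.smooth_c (contDiffAt_sign (hc x)) (h.dFun_c_eq_zero hC v)

theorem dFun_scale [T2Space M] (v : TangentSpace (𝓡 n) x) : dFun D.scale x v = 0 :=
  dFun_comp h.smooth_c (contDiffAt_rpow (hc x)) (h.dFun_c_eq_zero hC v)

theorem dFun_ratio [T2Space M] (v : TangentSpace (𝓡 n) x) : dFun D.ratio x v = 0 :=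
  dFun_comp h.smooth_c (contDiffAt_div_one_sub_sq (hc x)) (h.dFun_c_eq_zero hC v)

theorem koszul_rescale [T2Space M] {X Y Z : VField n M} (hX : SmoothVField X)
    (hY : SmoothVField Y) (hZ : SmoothVField Z) :
    koszul (D.rescale D.modifiedJp).g X Y Z x = D.eps x * koszul D.g X Y Z x :=
  koszul_smul h.hermitian.metric.smooth (smooth_eps hc h.smooth_c) (fun v => h.dFun_eps hC hc v)
    hX hY hZ

/-- As `dε = 0`, the Koszul expression is multiplied by `ε`, just as `H` is. -/
theorem conn_rescale [T2Space M] {X Y Z : VField n M} (hX : SmoothVField X)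
    (hY : SmoothVField Y) (hZ : SmoothVField Z) (x : M) :
    (D.rescale D.modifiedJp).conn (D.rescaleForm H) X Y x (Z x) =
      D.eps x * D.conn H X Y x (Z x) := by
  have h1 := two_mul_conn (H := D.rescaleForm H) (h.hermitian.rescale hc h.smooth_c).metric
    hX hY hZ x
  have h2 := two_mul_conn (H := H) h.hermitian.metric hX hY hZ x
  rw [h.koszul_rescale hC hc hX hY hZ, three_rescaleForm] at h1
  linear_combination (1 / 2 : ℝ) * h1 - (1 / 2 : ℝ) * D.eps x * h2

/-- The rescaled `ℱ` on `TM ⊕ ℝ` is built from `J₊`, the parallel fields `X_±` and coefficients with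
zero differential, so the `J₊`-rule for the old connection is all that is needed. -/
theorem rescale_minus_plus [T2Space M] {s v w : ESec n M}
    (hs : (D.rescale D.modifiedJp).IsMinus s) (hv : (D.rescale D.modifiedJp).IsPlus v)
    (hw : (D.rescale D.modifiedJp).IsPlus w) (x : M) :
    tri (D.rescaleForm H) s (fun y => D.rescaleA G y (v y)) x (w x)
      + tri (D.rescaleForm H) s v x (D.rescaleA G x (w x)) = 0 := by
  have h' := h.rescale hc
  have hg := h.hermitian.metric
  have hg' := h'.hermitian.metric
  obtain ⟨X, hX, rfl⟩ := hs
  obtain ⟨Y, b, hY, hb, rfl⟩ := hv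
  obtain ⟨Z, k, hZ, hk, rfl⟩ := hw
  have hρ := smooth_scale hc h.smooth_c
  have hκ := smooth_ratio hc h.smooth_c
  have gs : ∀ {U V : VField n M}, SmoothVField U → SmoothVField V →
      SmoothFun (n := n) fun y => D.g y (U y) (V y) := hg.smooth.apply₂
  -- `α` and `β` are the coefficients of `X₋` and `X₊` when the `TM`-part of the rescaled `ℱ(U + f)`
  -- is written as `J₊U + α X₋ + β X₊`.
  let α : VField n M → (M → ℝ) → M → ℝ := fun U f y =>
    D.ratio y * D.g y (U y) (D.Xp y) + D.scale y * f y
  let β : VField n M → M → ℝ := fun U y => - (D.ratio y * D.g y (U y) (D.Xm y))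
  have sα {U : VField n M} {f : M → ℝ} (hU : SmoothVField U) (hf : SmoothFun (n := n) f) :
      SmoothFun (n := n) (α U f) := (hκ.mul (gs hU h.smooth_Xp)).add (hρ.mul hf)
  have sβ {U : VField n M} (hU : SmoothVField U) : SmoothFun (n := n) (β U) :=
    (hκ.mul (gs hU h.smooth_Xm)).neg
  have eJ (U : VField n M) (f : M → ℝ) (y : M) :
      D.modifiedJp y (U y) + f y • (D.scale y • D.Xm y) =
        (D.Jp y (U y) + α U f y • D.Xm y) + β U y • D.Xp y := by
    rw [modifiedJp_apply, hg.symm y (D.Xp y), hg.symm y (D.Xm y)]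
    simp only [α, β]
    module
  have eA (U : VField n M) (f : M → ℝ) (y : M) :
      D.rescaleA G y ((D.rescale D.modifiedJp).plusSec U f y) =
        (D.rescale D.modifiedJp).plus y ((D.Jp y (U y) + α U f y • D.Xm y) + β U y • D.Xp y)
          (- (D.eps y * (D.scale y * D.g y (U y) (D.Xm y)))) := by
    rw [plusSec, rescaleA, h'.A_plus, ← eJ]
    congr 2
    change D.eps y * D.g y (U y) (D.scale y • D.Xm y) = _
    rw [map_smul, smul_eq_mul]
  have sJ {U : VField n M} {f : M → ℝ} (hU : SmoothVField U) (hf : SmoothFun (n := n) f) :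
      SmoothVField fun y => (D.Jp y (U y) + α U f y • D.Xm y) + β U y • D.Xp y :=
    ((h.smooth_Jp U hU).add (h.smooth_Xm.smul (sα hU hf))).add (h.smooth_Xp.smul (sβ hU))
  have sE : SmoothFun (n := n) fun y => D.eps y * (D.scale y * D.g y (Y y) (D.Xm y)) :=
    (smooth_eps hc h.smooth_c).mul (hρ.mul (gs hY h.smooth_Xm))
  have t1 := tri_minus_plus_plus (H := D.rescaleForm H) hg' hX (sJ hY hb) hZ sE.neg x (k x)
  have t2 := tri_minus_plus_plus (H := D.rescaleForm H) hg' hX hY (sJ hZ hk) hb x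
    (- (D.eps x * (D.scale x * D.g x (Z x) (D.Xm x))))
  have e1 : (fun y => D.rescaleA G y ((D.rescale D.modifiedJp).plusSec Y b y)) =
      (D.rescale D.modifiedJp).plusSec
        (fun y => (D.Jp y (Y y) + α Y b y • D.Xm y) + β Y y • D.Xp y)
        fun y => - (D.eps y * (D.scale y * D.g y (Y y) (D.Xm y))) := funext fun y => eA Y b y
  rw [e1, eA Z k x, t2]
  refine (congrArg (· + _) t1).trans ?_
  rw [h.conn_rescale hC hc hX (sJ hY hb) hZ, h.conn_rescale hC hc hX hY (sJ hZ hk),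
    conn_add_mid hg hX ((h.smooth_Jp Y hY).add (h.smooth_Xm.smul (sα hY hb)))
      (h.smooth_Xp.smul (sβ hY)) hZ,
    conn_add_mid hg hX (h.smooth_Jp Y hY) (h.smooth_Xm.smul (sα hY hb)) hZ,
    conn_smul_mid hg hX h.smooth_Xm hZ (sα hY hb), conn_smul_mid hg hX h.smooth_Xp hZ (sβ hY),
    h.conn_Xm hC hX hZ, h.conn_Xp hC hX hZ, conn_add, conn_add, conn_smul, conn_smul]
  have d1 : dFun (α Y b) x (X x) = D.ratio x * dFun (fun y => D.g y (Y y) (D.Xp y)) x (X x)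
      + D.scale x * dFun b x (X x) := by
    simp only [α]
    rw [dFun_add (hκ.mul (gs hY h.smooth_Xp)) (hρ.mul hb), dFun_mul hκ (gs hY h.smooth_Xp),
      dFun_mul hρ hb, h.dFun_ratio hC hc, h.dFun_scale hC hc]
    ring
  have d2 : dFun (β Y) x (X x) = - (D.ratio x * dFun (fun y => D.g y (Y y) (D.Xm y)) x (X x)) := by
    simp only [β]
    rw [dFun_neg, dFun_mul hκ (gs hY h.smooth_Xm), h.dFun_ratio hC hc]
    ring
  have d3 : dFun (fun y => - (D.eps y * (D.scale y * D.g y (Y y) (D.Xm y)))) x (X x) =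
      - (D.eps x * (D.scale x * dFun (fun y => D.g y (Y y) (D.Xm y)) x (X x))) := by
    rw [dFun_neg, dFun_mul (smooth_eps hc h.smooth_c) (hρ.mul (gs hY h.smooth_Xm)),
      dFun_mul hρ (gs hY h.smooth_Xm), h.dFun_eps hC hc, h.dFun_scale hC hc]
    ring
  have c1 := h.conn_Jp hC hX hY hZ x
  -- Because `X_±` are parallel, the derivative of `g(Y, X_±)` is the connection of `Y` paired with
  -- `X_±`.
  have c2 := conn_swap (H := H) hg hX hY h.smooth_Xm x
  have c3 := conn_swap (H := H) hg hX hY h.smooth_Xp x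
  rw [h.conn_Xm hC hX hY, add_zero] at c2
  rw [h.conn_Xp hC hX hY, add_zero] at c3
  rw [c2, c3, d1, d2, d3, hg.symm x (D.Xm x), hg.symm x (D.Xp x)]
  simp only [α, β]
  -- The terms in `ratio` cancel because the rank-two correction is skew, those in `scale` because
  -- the `TM`–`ℝ` blocks of the rescaled `ℱ` are opposite adjoints.
  linear_combination D.eps x * c1

/-- On `E_-` the endomorphism `J₋` is unchanged and the whole bracket expression is multiplied by
`ε`. -/
theorem rescale_plus_minus [T2Space M] {v s s' : ESec n M}
    (hv : (D.rescale D.modifiedJp).IsPlus v) (hs : (D.rescale D.modifiedJp).IsMinus s)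
    (hs' : (D.rescale D.modifiedJp).IsMinus s') (x : M) :
    tri (D.rescaleForm H) v (fun y => D.rescaleA G y (s y)) x (s' x)
      + tri (D.rescaleForm H) v s x (D.rescaleA G x (s' x)) = 0 := by
  have h' := h.rescale hc
  have hg := h.hermitian.metric
  have hg' := h'.hermitian.metric
  obtain ⟨Y, b, hY, hb, rfl⟩ := hv
  obtain ⟨X, hX, rfl⟩ := hs
  obtain ⟨Z, hZ, rfl⟩ := hs'
  have key {X Z : VField n M} (hX : SmoothVField X) (hZ : SmoothVField Z) :
      tri (D.rescaleForm H) ((D.rescale D.modifiedJp).plusSec Y b)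
        ((D.rescale D.modifiedJp).minusSec X) x ((D.rescale D.modifiedJp).minus x (Z x)) =
      D.eps x * tri H (D.plusSec Y b) (D.minusSec X) x (D.minus x (Z x)) := by
    have h1 := two_mul_tri_plus_minus_minus (H := H) hg hX hY hZ x hb
    have h2 := two_mul_tri_plus_minus_minus (H := D.rescaleForm H) hg' hX hY hZ x hb
    rw [h.koszul_rescale hC hc hY hX hZ, three_rescaleForm] at h2
    linear_combination (1 / 2 : ℝ) * h2 - (1 / 2 : ℝ) * D.eps x * h1
  have e1 : (fun y => D.rescaleA G y ((D.rescale D.modifiedJp).minusSec X y)) =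
      (D.rescale D.modifiedJp).minusSec fun y => D.Jm y (X y) := funext fun y => h'.A_minus y _
  have e2 : D.rescaleA G x ((D.rescale D.modifiedJp).minusSec Z x) =
      (D.rescale D.modifiedJp).minus x (D.Jm x (Z x)) := h'.A_minus x _
  have e3 : (fun y => A y (D.minusSec X y)) = D.minusSec fun y => D.Jm y (X y) :=
    funext fun y => h.A_minus y _
  have e4 : A x (D.minusSec Z x) = D.minus x (D.Jm x (Z x)) := h.A_minus x _
  have h1 := hC.plus_minus _ _ _ ⟨Y, b, hY, hb, rfl⟩ ⟨X, hX, rfl⟩ ⟨Z, hZ, rfl⟩ x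
  rw [e3, e4] at h1
  rw [e1, e2, key hX (h.smooth_Jm Z hZ)]
  refine (congrArg (· + _) (key (h.smooth_Jm X hX) hZ)).trans ?_
  rw [← mul_add]
  exact mul_eq_zero_of_right _ h1

end IsModel

end Data

end
end BnGen

/-! ### The algebraic conditions on the three-form and the rescaled twist. -/

namespace BnGen
section
variable {n : ℕ} {M : Type*} [TopologicalSpace M] [ChartedSpace (EuclideanSpace ℝ (Fin n)) M]
variable [IsManifold (𝓡 n) ∞ M] {D : Data n M} {G A : EEnd n M} {H : FormField n M 3} {x : M}

omit [IsManifold (𝓡 n) ∞ M] in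
theorem three_zero_right (a b : TangentSpace (𝓡 n) x) : three H x a b 0 = 0 := by
  rw [← zero_smul ℝ (0 : TangentSpace (𝓡 n) x), three_smul_right, zero_mul]

namespace Data

/-- `v` is orthogonal to `X₊` and `X₋`. -/
def IsOrtho (D : Data n M) (x : M) (v : TangentSpace (𝓡 n) x) : Prop :=
  D.g x v (D.Xp x) = 0 ∧ D.g x v (D.Xm x) = 0

section

variable {y z : TangentSpace (𝓡 n) x} (h : D.IsHermitian) (hy : D.IsOrtho x y)
  (hz : D.IsOrtho x z)
include h hy

theorem IsHermitian.isOrtho_Jp : D.IsOrtho x (D.Jp x y) := by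
  constructor
  · rw [h.Jp_skew, h.Jp_Xp, map_smul, hy.2, smul_zero, neg_zero]
  · rw [h.Jp_skew, h.Jp_Xm, map_smul, hy.1, smul_zero, neg_zero]

theorem IsHermitian.Jp_Jp_of_isOrtho : D.Jp x (D.Jp x y) = - y := by
  rw [h.Jp_sq, hy.1, hy.2, zero_smul, zero_smul, add_zero, add_zero]

variable (hC : D.IsCompatible H A)
include hC

/-- The unit is put in the third slot, where `A u = 0` removes the terms with `A w`. With `J₊y` and
`X₋` in the others, `J₊X₋ = c₊X₊` repeats `X₊` and kills another term, leaving `H(J₊J₊y, X₋, X₊)`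
with `J₊J₊y = -y`. -/
theorem IsHermitian.three_Xm_Xp : three H x y (D.Xm x) (D.Xp x) = 0 := by
  have hy' := h.isOrtho_Jp hy
  have h1 := hC.three_plus x (D.Jp x y) (D.Xm x) (D.Xp x) 0 0 (D.c x)
    (by rw [hy'.1, zero_mul, add_zero]) (by rw [h.g_Xm_Xp, zero_mul, add_zero])
  rw [h.Jp_Xp, neg_smul, neg_add_cancel, three_zero_right, three_zero_right, zero_smul, add_zero,
    add_zero, h.Jp_Xm, three_smul_mid, three_self_right, h.Jp_Jp_of_isOrtho hy,
    ← neg_one_smul ℝ, three_smul_left] at h1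
  linarith

include hz

/-- The unit in the third slot is annihilated by `A`; only the two terms without `A w` remain. -/
theorem IsHermitian.three_Jp_Xp :
    three H x y (D.Jp x z) (D.Xp x) + three H x (D.Jp x y) z (D.Xp x) = 0 := by
  have h1 := hC.three_plus x y z (D.Xp x) 0 0 (D.c x)
    (by rw [hy.1, zero_mul, add_zero]) (by rw [hz.1, zero_mul, add_zero])
  rw [h.Jp_Xp, neg_smul, neg_add_cancel, three_zero_right, three_zero_right, zero_smul,
    add_zero, add_zero] at h1
  linarith

theorem IsHermitian.three_Jp_Jp_Xp :
    three H x (D.Jp x y) (D.Jp x z) (D.Xp x) = three H x y z (D.Xp x) := by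
  have h1 := h.three_Jp_Xp hy (h.isOrtho_Jp hz) hC
  rw [h.Jp_Jp_of_isOrtho hz, ← neg_one_smul ℝ, three_smul_mid] at h1
  linarith

/-- With `X₋` in the third slot, `A w` is `c₊X₊` up to its `ℝ`-part, and the two terms containing it
cancel by the `J₊`-invariance of `i_{X₊}H`. -/
theorem IsHermitian.three_Jp_Xm :
    three H x y (D.Jp x z) (D.Xm x) + three H x (D.Jp x y) z (D.Xm x) = 0 := by
  have h1 := hC.three_plus x y z (D.Xm x) 0 0 0
    (by rw [hy.1, zero_mul, add_zero]) (by rw [hz.1, zero_mul, add_zero])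
  rw [h.Jp_Xm, zero_smul, add_zero, add_zero, add_zero, three_smul_right, three_smul_right,
    h.three_Jp_Jp_Xp hy hz hC] at h1
  linarith

theorem IsHermitian.three_Jp_Jp_Xm :
    three H x (D.Jp x y) (D.Jp x z) (D.Xm x) = three H x y z (D.Xm x) := by
  have h1 := h.three_Jp_Xm hy (h.isOrtho_Jp hz) hC
  rw [h.Jp_Jp_of_isOrtho hz, ← neg_one_smul ℝ, three_smul_mid] at h1
  linarith

end

namespace IsModel

variable (h : D.IsModel G A) (hC : D.IsCompatible H A) (hc : ∀ x, 1 - D.c x ^ 2 ≠ 0)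
include h hC hc

/-- Orthogonality to `X₊` replaces orthogonality to the unit, as the new constant is `0`. Thus `Y`
and `Y'` have no `X₊`-component, and expanding the rest reduces the claim to the old condition on
the complement and the identities for `i_{X_±}H`. -/
theorem rescale_three_plus (x : M) (Y Y' Z : TangentSpace (𝓡 n) x) (a b k : ℝ)
    (hY : D.g x Y (D.Xp x) = 0) (hY' : D.g x Y' (D.Xp x) = 0) :
    three H x Y Y' (D.modifiedJp x Z + k • D.Xm x)
      - three H x (D.modifiedJp x Y + a • D.Xm x) (D.modifiedJp x Y' + b • D.Xm x)
        (D.modifiedJp x Z + k • D.Xm x)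
      + three H x Y (D.modifiedJp x Y' + b • D.Xm x) Z
      + three H x (D.modifiedJp x Y + a • D.Xm x) Y' Z = 0 := by
  have hh := h.hermitian
  have hJ {v : TangentSpace (𝓡 n) x} (hv : D.IsOrtho x v) (p q : ℝ) :
      D.modifiedJp x (v + p • D.Xp x + q • D.Xm x) = D.Jp x v := by
    rw [map_add, map_add, map_smul, map_smul, hh.modifiedJp_Xp hc, hh.modifiedJp_Xm hc, smul_zero,
      smul_zero, add_zero, add_zero, hh.modifiedJp_of_orthogonal hv.1 hv.2]
  have h0 {v : TangentSpace (𝓡 n) x} (hv : D.IsOrtho x v) (p q : ℝ)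
      (hp : D.g x (v + p • D.Xp x + q • D.Xm x) (D.Xp x) = 0) : p = 0 := by
    simp only [map_add, map_smul, add_apply, smul_apply, hv.1, hh.g_Xp_Xp, hh.g_Xm_Xp, smul_eq_mul,
      mul_zero, add_zero, zero_add] at hp
    exact (mul_eq_zero.1 hp).resolve_right (hc x)
  obtain ⟨y, p, α, rfl, y1, y2⟩ := hh.exists_split hc x Y
  obtain ⟨y', p', β, rfl, y1', y2'⟩ := hh.exists_split hc x Y'
  obtain ⟨z, δ, γ, rfl, z1, z2⟩ := hh.exists_split hc x Z
  have hy : D.IsOrtho x y := ⟨y1, y2⟩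
  have hy' : D.IsOrtho x y' := ⟨y1', y2'⟩
  have hz : D.IsOrtho x z := ⟨z1, z2⟩
  rw [hJ hy, hJ hy', hJ hz]
  obtain rfl := h0 hy p α hY
  obtain rfl := h0 hy' p' β hY'
  simp only [zero_smul, add_zero]
  have q := hC.three_plus x y y' z 0 0 0
    (by rw [y1, zero_mul, add_zero]) (by rw [y1', zero_mul, add_zero])
  simp only [zero_smul, add_zero] at q
  have mid (v w : TangentSpace (𝓡 n) x) : three H x v (D.Xm x) w = - three H x v w (D.Xm x) :=
    three_swap_right H x _ _ _
  have left (v w : TangentSpace (𝓡 n) x) : three H x (D.Xm x) v w = three H x v w (D.Xm x) := by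
    rw [three_swap_left, three_swap_right, neg_neg]
  have i1 := hh.three_Xm_Xp hy hC
  have i2 := hh.three_Xm_Xp hy' hC
  have i3 := hh.three_Xm_Xp (hh.isOrtho_Jp hy) hC
  have i4 := hh.three_Xm_Xp (hh.isOrtho_Jp hy') hC
  rw [mid, neg_eq_zero] at i1 i2 i3 i4
  simp only [three_add_left, three_add_mid, three_add_right, three_smul_left, three_smul_mid,
    three_smul_right, three_self_right, three_self_outer, mid, left, i1, i2, i3, i4]
  -- The coefficients are those of `X_±` in the three arguments: `α`, `β`, `γ`, `δ` from the
  -- splittings, and `a`, `b`, `k` from the `ℝ`-parts.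
  linear_combination q - k * hh.three_Jp_Jp_Xm hy hy' hC + γ * hh.three_Jp_Xm hy hy' hC
    + δ * hh.three_Jp_Xp hy hy' hC - β * hh.three_Jp_Xm hy hz hC
    + α * hh.three_Jp_Xm hy' hz hC + b * hh.three_Jp_Jp_Xm hy hz hC
    - a * hh.three_Jp_Jp_Xm hy' hz hC

/-- The rescaled data are compatible with the rescaled three-form. -/
theorem isCompatible_rescale [T2Space M] :
    (D.rescale D.modifiedJp).IsCompatible (D.rescaleForm H) (D.rescaleA G) where
  minus_plus _ _ _ hs hv hw := h.rescale_minus_plus hC hc hs hv hw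
  plus_minus _ _ _ hv hs hs' := h.rescale_plus_minus hC hc hv hs hs'
  three_plus x Y Y' Z a b k hY hY' := by
    have key {V : TangentSpace (𝓡 n) x} {r : ℝ}
        (hV : D.eps x * D.g x V (D.scale x • D.Xp x) + r * 0 = 0) : D.g x V (D.Xp x) = 0 := by
      rw [map_smul, smul_eq_mul, mul_zero, add_zero] at hV
      -- Multiplying by `scale · (1 - c₊²)` turns the prefactor `ε · scale` into `1`.
      linear_combination (D.scale x * (1 - D.c x ^ 2)) * hV
        - D.g x V (D.Xp x) * eps_mul_scale hc x
    have h1 := h.rescale_three_plus hC hc x Y Y' Z (a * D.scale x) (b * D.scale x)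
      (k * D.scale x) (key hY) (key hY')
    simp only [mul_smul] at h1
    have h2 := congrArg (D.eps x * ·) h1
    simp only [mul_add, mul_sub, mul_zero] at h2
    exact h2
  three_minus x X Y Z := by
    have h2 := congrArg (D.eps x * ·) (hC.three_minus x X Y Z)
    simp only [mul_add, mul_sub, mul_zero] at h2
    exact h2

end IsModel

end Data

/-! ### The rescaled three-form -/

namespace Data

variable (hc : ∀ x, 1 - D.c x ^ 2 ≠ 0) (hsm : SmoothFun (n := n) D.c)
include hc hsm

-- The sign `ε` is locally constant by continuity of `c₊`, so near the chart point the chart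
-- expression is multiplied by a constant.
omit [IsManifold (𝓡 n) ∞ M] in
theorem extD_rescaleForm (x : M) : extD (D.rescaleForm H) x = D.eps x • extD H x := by
  have h1 : ∀ᶠ z in 𝓝 (extChartAt (𝓡 n) x x),
      D.eps ((extChartAt (𝓡 n) x).symm z) = D.eps x := by
    have := (continuousAt_extChartAt_symm (I := 𝓡 n) x).eventually
      (p := fun y => D.eps y = D.eps x) (by
        rw [extChartAt_to_inv]
        exact eventually_eps_eq hc hsm x)
    exact this
  have h2 : formInChart x (D.rescaleForm H) =ᶠ[𝓝 (extChartAt (𝓡 n) x x)]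
      fun z => D.eps x • formInChart x H z := by
    filter_upwards [h1] with z hz
    rw [← hz]
    rfl
  have h3 := h2.extDeriv_eq.trans (extDeriv_fun_smul (D.eps x) _)
  rw [extD, h3]
  rfl

theorem smoothForm_rescaleForm (hH : SmoothForm H) : SmoothForm (D.rescaleForm H) := by
  intro x₀
  have h1 : ContDiffOn ℝ ∞ (fun z => D.eps ((extChartAt (𝓡 n) x₀).symm z))
      (extChartAt (𝓡 n) x₀).target :=
    contMDiffOn_iff_contDiffOn.1
      ((smooth_eps hc hsm).comp_contMDiffOn (contMDiffOn_extChartAt_symm x₀))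
  exact h1.smul (hH x₀)

theorem isTwist_rescaleForm (hH : IsTwist H 0) : IsTwist (D.rescaleForm H) 0 where
  smooth_H := smoothForm_rescaleForm hc hsm hH.smooth_H
  smooth_F := hH.smooth_F
  closed_F := hH.closed_F
  d_H x a b c d := by
    have h1 := hH.d_H x a b c d
    have e (p q : TangentSpace (𝓡 n) x) : (0 : FormField n M 2) x ![p, q] = 0 := rfl
    rw [extD_rescaleForm hc hsm]
    change D.eps x * extD H x ![a, b, c, d] = _
    rw [h1]
    simp only [e]
    ring

end Data

end
end BnGen

theorem mainTheorem7 {n : ℕ} (hn : Even n) {M : Type*} [TopologicalSpace M] [T2Space M]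
    [SecondCountableTopology M] [ChartedSpace (EuclideanSpace ℝ (Fin n)) M]
    [IsManifold (𝓡 n) ∞ M]
    (H : BnGen.FormField n M 3) (hH : BnGen.IsTwist H 0)
    (G A : BnGen.EEnd n M) (hK : BnGen.IsGenPseudoKahler H 0 G A)
    (D : BnGen.Data n M) (hD : BnGen.IsComponents G A D)
    (hc : ∀ x, D.c x ≠ -1 ∧ D.c x ≠ 0 ∧ D.c x ≠ 1) :
    BnGen.IsTwist (fun x => D.eps x • H x) 0 ∧
    (∃! J, D.IsModifiedJp J) ∧
    ∀ J, D.IsModifiedJp J →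
      ∃ G' A' : BnGen.EEnd n M,
        BnGen.IsGenPseudoKahler (fun x => D.eps x • H x) 0 G' A' ∧
        BnGen.IsComponents G' A' (D.rescale J) := by
  have h := hK.isModel hD
  have hC := h.isCompatible hK.complex₁.integrable hK.complex₂.integrable
  have hc' (x : M) : 1 - D.c x ^ 2 ≠ 0 := BnGen.one_sub_sq_ne_zero (hc x).1 (hc x).2.2
  refine ⟨BnGen.Data.isTwist_rescaleForm hc' hD.smooth_c hH,
    h.hermitian.existsUnique_isModifiedJp hc', fun J hJ => ?_⟩
  obtain rfl := h.hermitian.eq_modifiedJp hc' hJ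
  exact ⟨_, _, (h.rescale hc').isGenPseudoKahler (h.isCompatible_rescale hC hc'),
    (h.rescale hc').isComponents⟩
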